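/- \textbf{Setting.} Let $n\ge 2$, let $U\subset\mathbb R^n$ be a bounded domain (for instance with $C^1$ boundary), $\Gamma=\partial U$. Let $N\ge1$ and $0=\alpha_0<\alpha_1<\dots<\alpha_N$ be fixed, and put $$a=\frac{\alpha_N}{\alpha_N+1}\in(0,1),\qquad \kappa_0=\frac{a}{2-a}+\frac12 .$$ Let $\phi:U\to(0,1]$ and $a_0,\dots,a_N:U\to[0,\infty)$ be measurable with $a_0,a_N>0$ and $B_1=\int_U a_N\,dx<\infty$; put $g(x,s)=\sum_{j=0}^N a_j(x)s^{\alpha_j}$, and let $K(x,\xi)=1/g(x,s(x,\xi))$, where $s=s(x,\xi)\ge0$ is the unique solution of $s\,g(x,s)=\xi$, $\xi\ge 0$. Let $W_1=a_N^a/(2N\max_j a_j)$, $B_*=\max\{B_1,1\}$ and $\|u\|_{L^2_\phi}^2=\int_U\phi u^2dx$. For $i=1,2$ let $p_i$ be a solution of $$\phi\,p_t=\nabla\cdot\big(K(x,|\nabla p|)\nabla p\big)\ \text{ on }U\times(0,\infty),\qquad p_i=\Psi_i\ \text{ on }\Gamma\times(0,\infty),$$ where $\Psi_i(x,t)$ is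 a given extension to $U$ of the boundary data. The regularity that is assumed is the following. The functions $p_i,\partial_tp_i,\Psi_i,\partial_t\Psi_i$ are continuous on $\overline U\times(0,\infty)$ and, for each $t>0$, locally Lipschitz in $x\in U$; $\partial_t^2\Psi_i$ exists in $U\times(0,\infty)$. The equation holds for every $t>0$ in the weak form $$\int_U\phi\,\partial_tp_i\,v\,dx=-\int_U K(x,|\nabla p_i|)\nabla p_i\cdot\nabla v\,dx$$ for all $v\in C(\overline U)$ that are locally Lipschitz in $U$, vanish on $\Gamma$ and make the right-hand integrand integrable. For every $t>0$, $\int_UK(x,|\nabla p_i|)|\nabla p_i|^2dx<\infty$; for almost every $x\in U$, $\nabla p_i(x,t)$ is differentiable in $t>0$ with derivative $\nabla \partial_tp_i$; and, locally uniformly in $t>0$, $K(x,|\nabla p_i|)|\nabla p_i||\nabla\partial_tp_i|$ is dominated by an integrable function of $x$. For $\Psi\in\{\Psi_1,\Psi_2\}$ the integrals in $$G[\Psi](t)=B_*+\int_U a_0^{-1}|\nabla\Psi|^2dx+\int_UW_1|\nabla\Psi|^{2-a}dx+\Big(\int_U|\Psi_t|^2\phi\,dx\Big)^{\frac{2-a}{2(1-a)}},$$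 $$G_1[\Psi](t)=\int_Ua_0^{-1}|\nabla\Psi_t|^2dx,\qquad G_2[\Psi](t)=\int_U|\Psi_{tt}|^2\phi\,dx$$ are finite and these functions are continuous for $t>0$. Put $$\bar P=(p_1-\Psi_1)-(p_2-\Psi_2),\qquad \Phi=\Psi_1-\Psi_2,$$ and assume that for some $c_P>0$ the inequality $$\Big(\int_U|u|^2\phi\,dx\Big)^{1/2}\le c_P\Big(\int_UW_1|\nabla u|^{2-a}dx\Big)^{\frac1{2-a}}$$ holds, at each time $t>0$, for $u=p_1-\Psi_1$, $u=p_2-\Psi_2$ and $u=\bar P$. Put $\tilde G=G[\Psi_1]+G[\Psi_2]$, $\tilde G_k=G_k[\Psi_1]+G_k[\Psi_2]$ $(k=1,2)$, $$\tilde{\mathcal A}=\sum_{i=1}^2\limsup_{t\to\infty}G[\Psi_i](t),\qquad \tilde{\mathcal B}=\sum_{i=1}^2\limsup_{t\to\infty}\big[G[\Psi_i]'(t)\big]^-,$$ where $[z]^-=\max\{-z,0\}$ and $\tilde{\mathcal B}$ is considered when $G[\Psi_1],G[\Psi_2]\in C^1((0,\infty))$, and $$D(t)=\int_Ua_0^{-1}|\nabla\Phi|^2dx+\Big(\int_Ua_0^{-1}|\nabla\Phi|^2dx\Big)^{1/2}+\Big(\int_U|\Phi_t|^2\phi\,dx\Big)^{1/2}.$$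 Let $V$ be one of the following two functions: either $$V(t)=\big(\mathcal M_1(t)+\mathcal M_2(t)\big)^{\frac2{2-a}}+\int_{t-1}^t(\tilde G_1+\tilde G_2)\,d\tau,$$ where $\mathcal M_i$ is any continuous increasing function on $[0,\infty)$ with $\mathcal M_i\ge G[\Psi_i]$ on $(0,\infty)$; or, provided that $\tilde{\mathcal B}<\infty$, $$V(t)=\tilde{\mathcal B}^{\frac1{1-a}}+\tilde G(t)^{\frac2{2-a}}+\int_{t-1}^t(\tilde G_1+\tilde G_2)\,d\tau .$$ \textbf{Theorem.} Assume $\tilde{\mathcal A}=\infty$. If $\int_1^\infty V(t)^{-\frac a{2-a}}dt=\infty$, then $$\limsup_{t\to\infty}\|\bar P(t)\|_{L^2_\phi}^2\le C\limsup_{t\to\infty}\Big(V(t)^{\kappa_0}D(t)\Big),$$ where both sides take values in $[0,\infty]$ and the constant $C>0$ depends only on $n$, $U$, the exponents $N,\alpha_0,\dots,\alpha_N$ and $c_P$; in particular it depends neither on $\phi$ and the $a_j$ nor on the initial and boundary data. -/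

import Mathlib

open MeasureTheory Set Filter Topology
open scoped ENNReal

namespace Forchheimer

noncomputable section

/-- The Euclidean space of dimension `n`. -/
abbrev E (n : ℕ) : Type := EuclideanSpace ℝ (Fin n)

/-! ### The Forchheimer polynomial and the nonlinear conductivity -/

/-- The generalized polynomial `g(s) = ∑ c_j s ^ α_j` with coefficients `c`
(the values `a_j(x)` at one point `x`). -/
def g {N : ℕ} (α c : Fin (N + 1) → ℝ) (s : ℝ) : ℝ :=
  ∑ j, c j * s ^ α j

theorem existsUnique_root {N : ℕ} {α c : Fin (N + 1) → ℝ} (hα0 : α 0 = 0)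
    (hα : StrictMono α) (hc0 : 0 < c 0) (hc : ∀ j, 0 ≤ c j) {ξ : ℝ} (hξ : 0 ≤ ξ) :
    ∃! s : ℝ, 0 ≤ s ∧ s * g α c s = ξ := by
  have hαn : ∀ j, 0 ≤ α j := fun j => by
    have := hα.monotone (Fin.zero_le j)
    rwa [hα0] at this
  have hcont : Continuous (fun s : ℝ => s * g α c s) := by
    unfold g
    refine continuous_id.mul (continuous_finsetSum _ fun j _ => ?_)
    exact continuous_const.mul (Real.continuous_rpow_const (hαn j))
  have hge : ∀ s : ℝ, 0 ≤ s → c 0 ≤ g α c s := fun s hs => by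
    have h := Finset.single_le_sum (f := fun j => c j * s ^ α j)
      (fun j _ => mul_nonneg (hc j) (Real.rpow_nonneg hs _)) (Finset.mem_univ 0)
    simpa [g, hα0] using h
  have hmono : ∀ s r : ℝ, 0 ≤ s → s < r → s * g α c s < r * g α c r := fun s r hs hsr => by
    have h1 : g α c s ≤ g α c r := Finset.sum_le_sum fun j _ =>
      mul_le_mul_of_nonneg_left (Real.rpow_le_rpow hs hsr.le (hαn j)) (hc j)
    have h2 := hge r (hs.trans hsr.le)
    nlinarith
  have hb : 0 ≤ ξ / c 0 := div_nonneg hξ hc0.le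
  have hup : ξ ≤ (ξ / c 0) * g α c (ξ / c 0) := by
    have h := mul_le_mul_of_nonneg_left (hge _ hb) hb
    rwa [div_mul_cancel₀ _ hc0.ne'] at h
  obtain ⟨s, hs, hsξ⟩ := intermediate_value_Icc hb hcont.continuousOn
    (show ξ ∈ Icc _ _ from ⟨by simpa using hξ, hup⟩)
  refine ⟨s, ⟨hs.1, hsξ⟩, fun r hr => ?_⟩
  rcases lt_trichotomy r s with h | h | h
  · have := hmono r s hr.1 h
    have h3 : s * g α c s = ξ := hsξ
    linarith [hr.2]
  · exact h
  · have := hmono s r hs.1 h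
    have h3 : s * g α c s = ξ := hsξ
    linarith [hr.2]

open Classical in
/-- The non-negative solution `s` of `s g(s) = ξ`; by `existsUnique_root` it exists and is
unique for all coefficients and all `ξ ≥ 0` that occur (otherwise the value is `0`). -/
def root {N : ℕ} (α c : Fin (N + 1) → ℝ) (ξ : ℝ) : ℝ :=
  if h : ∃ s : ℝ, 0 ≤ s ∧ s * g α c s = ξ then h.choose else 0

/-- `K(x, ξ) = 1 / g(x, s(x, ξ))`. -/
def K {n N : ℕ} (α : Fin (N + 1) → ℝ) (a : Fin (N + 1) → E n → ℝ) (x : E n) (ξ : ℝ) : ℝ :=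
  1 / g α (fun j => a j x) (root α (fun j => a j x) ξ)

/-- The exponent `a = α_N / (α_N + 1)`. -/
def expo {N : ℕ} (α : Fin (N + 1) → ℝ) : ℝ :=
  α (Fin.last N) / (α (Fin.last N) + 1)

/-- The exponent `κ₀ = a / (2 - a) + 1 / 2`. -/
def kappa {N : ℕ} (α : Fin (N + 1) → ℝ) : ℝ :=
  expo α / (2 - expo α) + 1 / 2

/-- The weight `W₁ = a_N ^ a / (2 N max_j a_j)`. -/
def W1 {n N : ℕ} (α : Fin (N + 1) → ℝ) (a : Fin (N + 1) → E n → ℝ) (x : E n) : ℝ :=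
  a (Fin.last N) x ^ expo α /
    (2 * N * Finset.univ.sup' Finset.univ_nonempty (fun j => a j x))

/-- The porosity `φ` has values in `(0, 1]`, the coefficients are non-negative, the first and
the last are positive, and the last has a finite integral. -/
structure IsMedium {n N : ℕ} (U : Set (E n)) (φ : E n → ℝ) (a : Fin (N + 1) → E n → ℝ) :
    Prop where
  measurable_porosity : Measurable φ
  porosity_mem : ∀ x ∈ U, φ x ∈ Ioc (0 : ℝ) 1
  measurable_coeff : ∀ j, Measurable (a j)
  coeff_nonneg : ∀ j, ∀ x ∈ U, 0 ≤ a j x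
  coeff_zero_pos : ∀ x ∈ U, 0 < a 0 x
  coeff_last_pos : ∀ x ∈ U, 0 < a (Fin.last N) x
  integrable_coeff_last : IntegrableOn (a (Fin.last N)) U

/-! ### Functions of time and space, weighted norms -/

/-- The time derivative of `u = u(t, x)`. -/
def dt {n : ℕ} (u : ℝ → E n → ℝ) (t : ℝ) (x : E n) : ℝ :=
  deriv (fun s => u s x) t

/-- The weighted norm `(∫_U f |u|^q dx)^(1/q)`, for scalar and for vector valued `u`. -/
def wnorm {n : ℕ} {F : Type} [NormedAddCommGroup F] (U : Set (E n)) (f : E n → ℝ) (q : ℝ)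
    (u : E n → F) : ℝ :=
  (∫ x in U, f x * ‖u x‖ ^ q) ^ (1 / q)

/-- The two-weight Poincaré-Sobolev inequality with constant `cP` for the function `u`. -/
def PoincareSobolev {n N : ℕ} (U : Set (E n)) (φ : E n → ℝ) (α : Fin (N + 1) → ℝ)
    (a : Fin (N + 1) → E n → ℝ) (cP : ℝ) (u : E n → ℝ) : Prop :=
  wnorm U φ 2 u ≤ cP * wnorm U (W1 α a) (2 - expo α) (gradient u)

/-- Regularity for positive times: `u` and `u_t` exist and are continuous on
`(0, ∞) × closure U`, and locally Lipschitz in `x ∈ U` (so that the gradients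
`∇u` and `∇u_t` exist almost everywhere). -/
structure Regular {n : ℕ} (U : Set (E n)) (u : ℝ → E n → ℝ) : Prop where
  cont : ContinuousOn (Function.uncurry u) (Ioi 0 ×ˢ closure U)
  diff_time : ∀ t > 0, ∀ x ∈ closure U, DifferentiableAt ℝ (fun s => u s x) t
  cont_dt : ContinuousOn (Function.uncurry (dt u)) (Ioi 0 ×ˢ closure U)
  lip : ∀ t > 0, LocallyLipschitzOn U (u t)
  lip_dt : ∀ t > 0, LocallyLipschitzOn U (dt u t)

/-! ### Solutions -/

/-- Regular solutions `p` of `φ p_t = ∇ · (K(x, |∇p|) ∇p)` on `U × (0, ∞)` whose boundary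
values on `∂U × (0, ∞)` are those of `Ψ`. The equation is understood in the weak form, at every
time `t > 0`, with all test functions that are continuous on `closure U`, locally Lipschitz
in `U`, zero on the boundary, and whose pairing with the flux is integrable; classical solutions
satisfy it by integration by parts. The fields `energy`, `energy_dt` and `grad_dt` are the
regularity in time that allows one to differentiate `∫ H(x, |∇p|) dx` under the integral sign. -/
structure IsSolution {n N : ℕ} (U : Set (E n)) (φ : E n → ℝ) (α : Fin (N + 1) → ℝ)
    (a : Fin (N + 1) → E n → ℝ) (p Ψ : ℝ → E n → ℝ) : Prop where
  regular : Regular U p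
  boundary : ∀ t > 0, ∀ x ∈ frontier U, p t x = Ψ t x
  weak : ∀ t > 0, ∀ v : E n → ℝ, ContinuousOn v (closure U) → LocallyLipschitzOn U v →
    (∀ x ∈ frontier U, v x = 0) →
    IntegrableOn
      (fun x => K α a x ‖gradient (p t) x‖ * inner ℝ (gradient (p t) x) (gradient v x)) U →
    ∫ x in U, φ x * dt p t x * v x =
      -∫ x in U, K α a x ‖gradient (p t) x‖ * inner ℝ (gradient (p t) x) (gradient v x)
  energy : ∀ t > 0,
    IntegrableOn (fun x => K α a x ‖gradient (p t) x‖ * ‖gradient (p t) x‖ ^ 2) U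
  energy_dt : ∀ t > 0, ∃ ε > 0, ∃ b : E n → ℝ, IntegrableOn b U ∧
    ∀ᵐ x ∂(volume.restrict U), ∀ s ∈ Ioo (t - ε) (t + ε),
      K α a x ‖gradient (p s) x‖ * ‖gradient (p s) x‖ * ‖gradient (dt p s) x‖ ≤ b x
  grad_dt : ∀ᵐ x ∂(volume.restrict U), ∀ t > 0,
    HasDerivAt (fun s => gradient (p s) x) (gradient (dt p t) x) t

/-! ### Quantities built from the boundary data -/

/-- `G[Ψ](t)`. -/
def G {n N : ℕ} (U : Set (E n)) (φ : E n → ℝ) (α : Fin (N + 1) → ℝ)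
    (a : Fin (N + 1) → E n → ℝ) (Ψ : ℝ → E n → ℝ) (t : ℝ) : ℝ :=
  max (∫ x in U, a (Fin.last N) x) 1
    + (∫ x in U, (a 0 x)⁻¹ * ‖gradient (Ψ t) x‖ ^ 2)
    + (∫ x in U, W1 α a x * ‖gradient (Ψ t) x‖ ^ (2 - expo α))
    + (∫ x in U, |dt Ψ t x| ^ 2 * φ x) ^ ((2 - expo α) / (2 * (1 - expo α)))

/-- `G₁[Ψ](t)`. -/
def G1 {n N : ℕ} (U : Set (E n)) (a : Fin (N + 1) → E n → ℝ) (Ψ : ℝ → E n → ℝ) (t : ℝ) : ℝ :=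
  ∫ x in U, (a 0 x)⁻¹ * ‖gradient (dt Ψ t) x‖ ^ 2

/-- `G₂[Ψ](t)`. -/
def G2 {n : ℕ} (U : Set (E n)) (φ : E n → ℝ) (Ψ : ℝ → E n → ℝ) (t : ℝ) : ℝ :=
  ∫ x in U, |dt (dt Ψ) t x| ^ 2 * φ x

/-- Regularity of an extension `Ψ` of the boundary data: the integrals in `G`, `G₁`, `G₂` are
finite and these three quantities are continuous in time. -/
structure IsBoundaryData {n N : ℕ} (U : Set (E n)) (φ : E n → ℝ) (α : Fin (N + 1) → ℝ)
    (a : Fin (N + 1) → E n → ℝ) (Ψ : ℝ → E n → ℝ) : Prop where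
  regular : Regular U Ψ
  diff_dt : ∀ t > 0, ∀ x ∈ U, DifferentiableAt ℝ (fun s => dt Ψ s x) t
  integrable_grad : ∀ t > 0, IntegrableOn (fun x => (a 0 x)⁻¹ * ‖gradient (Ψ t) x‖ ^ 2) U
  integrable_grad_W1 : ∀ t > 0,
    IntegrableOn (fun x => W1 α a x * ‖gradient (Ψ t) x‖ ^ (2 - expo α)) U
  integrable_grad_dt : ∀ t > 0,
    IntegrableOn (fun x => (a 0 x)⁻¹ * ‖gradient (dt Ψ t) x‖ ^ 2) U
  integrable_dt_dt : ∀ t > 0, IntegrableOn (fun x => |dt (dt Ψ) t x| ^ 2 * φ x) U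
  cont_G : ContinuousOn (G U φ α a Ψ) (Ioi 0)
  cont_G1 : ContinuousOn (G1 U a Ψ) (Ioi 0)
  cont_G2 : ContinuousOn (G2 U φ Ψ) (Ioi 0)

/-- `M` is a continuous increasing function on `[0, ∞)` that bounds `f` from above. -/
structure IsMajorant (M f : ℝ → ℝ) : Prop where
  cont : ContinuousOn M (Ici 0)
  mono : MonotoneOn M (Ici 0)
  le : ∀ t > 0, f t ≤ M t

/-- `limsup f(t)` as `t → ∞`, for `f ≥ 0`, with values in `[0, ∞]`. -/
def limsupInf (f : ℝ → ℝ) : ℝ≥0∞ :=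
  limsup (fun t => ENNReal.ofReal (f t)) atTop

/-- `𝓐[Ψ₁] + 𝓐[Ψ₂]`, where `𝓐[Ψ] = limsup G[Ψ](t)`. -/
def Atilde {n N : ℕ} (U : Set (E n)) (φ : E n → ℝ) (α : Fin (N + 1) → ℝ)
    (a : Fin (N + 1) → E n → ℝ) (Ψ₁ Ψ₂ : ℝ → E n → ℝ) : ℝ≥0∞ :=
  limsupInf (G U φ α a Ψ₁) + limsupInf (G U φ α a Ψ₂)

/-- `𝓑[Ψ₁] + 𝓑[Ψ₂]`, where `𝓑[Ψ] = limsup [G[Ψ]'(t)]⁻` (negative part). -/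
def Btilde {n N : ℕ} (U : Set (E n)) (φ : E n → ℝ) (α : Fin (N + 1) → ℝ)
    (a : Fin (N + 1) → E n → ℝ) (Ψ₁ Ψ₂ : ℝ → E n → ℝ) : ℝ≥0∞ :=
  limsupInf (fun t => max (-deriv (G U φ α a Ψ₁) t) 0)
    + limsupInf (fun t => max (-deriv (G U φ α a Ψ₂) t) 0)

/-- `∫_{t-1}^t (G̃₁ + G̃₂) dτ`, where `G̃_k = G_k[Ψ₁] + G_k[Ψ₂]`. -/
def window {n N : ℕ} (U : Set (E n)) (φ : E n → ℝ) (a : Fin (N + 1) → E n → ℝ)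
    (Ψ₁ Ψ₂ : ℝ → E n → ℝ) (t : ℝ) : ℝ :=
  ∫ τ in (t - 1)..t, ((G1 U a Ψ₁ τ + G1 U a Ψ₂ τ) + (G2 U φ Ψ₁ τ + G2 U φ Ψ₂ τ))

/-- The growth function `V` in the general case; `M₁`, `M₂` are the majorants of
`G[Ψ₁]`, `G[Ψ₂]`. -/
def Vgen {n N : ℕ} (U : Set (E n)) (φ : E n → ℝ) (α : Fin (N + 1) → ℝ)
    (a : Fin (N + 1) → E n → ℝ) (Ψ₁ Ψ₂ : ℝ → E n → ℝ) (M₁ M₂ : ℝ → ℝ) (t : ℝ) : ℝ :=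
  (M₁ t + M₂ t) ^ (2 / (2 - expo α)) + window U φ a Ψ₁ Ψ₂ t

/-- The growth function `V` that is used when `Btilde` is finite. -/
def Vfin {n N : ℕ} (U : Set (E n)) (φ : E n → ℝ) (α : Fin (N + 1) → ℝ)
    (a : Fin (N + 1) → E n → ℝ) (Ψ₁ Ψ₂ : ℝ → E n → ℝ) (t : ℝ) : ℝ :=
  (Btilde U φ α a Ψ₁ Ψ₂).toReal ^ (1 / (1 - expo α))
    + (G U φ α a Ψ₁ t + G U φ α a Ψ₂ t) ^ (2 / (2 - expo α)) + window U φ a Ψ₁ Ψ₂ t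

/-- The size `D(t)` of the difference `Φ` of the boundary data. -/
def D {n N : ℕ} (U : Set (E n)) (φ : E n → ℝ) (a : Fin (N + 1) → E n → ℝ)
    (Φ : ℝ → E n → ℝ) (t : ℝ) : ℝ :=
  (∫ x in U, (a 0 x)⁻¹ * ‖gradient (Φ t) x‖ ^ 2)
    + (∫ x in U, (a 0 x)⁻¹ * ‖gradient (Φ t) x‖ ^ 2) ^ (1 / 2 : ℝ)
    + (∫ x in U, |dt Φ t x| ^ 2 * φ x) ^ (1 / 2 : ℝ)

/-- `∫_1^∞ V(t) ^ (-a / (2 - a)) dt = ∞`. -/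
def DivergentIntegral {N : ℕ} (α : Fin (N + 1) → ℝ) (V : ℝ → ℝ) : Prop :=
  ∫⁻ t in Ici (1 : ℝ), ENNReal.ofReal (V t ^ (-(expo α / (2 - expo α)))) = ⊤

end

end Forchheimer

/-!
Testing the weak equation with `pᵢ - Ψᵢ` and applying the Poincaré-Sobolev inequality gives, for
`y = ‖pᵢ - Ψᵢ‖²` and the energy `E` of `pᵢ`, an inequality
`y' ≤ -c y ^ ((2 - a) / 2) - E / 2 + C G`. Comparison with a power of a majorant of `G` bounds `y`;
when `G'` is eventually bounded from below, a power of `G` plus a constant is itself a barrier.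
Testing with the time derivative bounds the growth of the potential whose gradient is the flux, and
combining the two inequalities over a unit window bounds the energies at time `t` by a multiple of
`V t`.

For two solutions the flux is monotone, but its coercivity degenerates like
`K(x, max |∇p₁| |∇p₂|)`. Hölder's inequality against the energies turns this into the linear
inequality `Y' ≤ -c V ^ (-a / (2 - a)) Y + C V ^ (1 / 2) D` for `Y = ‖P̄‖²`. As
`∫ V ^ (-a / (2 - a)) = ∞`, the initial value is forgotten and `limsup Y` is at most a multiple of
the limit superior of the quotient of the two coefficients, which is `V ^ κ₀ D`.
-/

namespace Forchheimer

noncomputable section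

/-! ### Convexity -/

section Convexity

lemma rpow_sub_rpow_le_mul_sub {r s p : ℝ} (hr : 0 ≤ r) (hrs : r ≤ s) (hp : 1 ≤ p) :
    s ^ p - r ^ p ≤ p * s ^ (p - 1) * (s - r) := by
  rcases hrs.eq_or_lt with rfl | hlt
  · simp
  · have hslope := (convexOn_rpow hp).slope_le_of_hasDerivAt hr (hr.trans hrs) hlt
      (Real.hasDerivAt_rpow_const (Or.inr hp))
    rwa [slope_def_field, div_le_iff₀ (sub_pos.2 hlt)] at hslope

lemma mul_sub_le_integral_of_monotone {f : ℝ → ℝ} (hf : Monotone f) (x y : ℝ) :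
    f x * (y - x) ≤ ∫ t in x..y, f t := by
  have hconst : ∀ u v : ℝ, ∫ _ in u..v, f x = f x * (v - u) := fun u v => by
    rw [intervalIntegral.integral_const, smul_eq_mul, mul_comm]
  rcases le_total x y with hxy | hyx
  · rw [← hconst]
    exact intervalIntegral.integral_mono_on hxy intervalIntegrable_const hf.intervalIntegrable
      fun t ht => hf ht.1
  · rw [intervalIntegral.integral_symm, le_neg, ← mul_neg, neg_sub, ← hconst]
    exact intervalIntegral.integral_mono_on hyx hf.intervalIntegrable intervalIntegrable_const
      fun t ht => hf ht.2

lemma hasFDerivAt_of_continuousAt_subgradient {F : Type*} [NormedAddCommGroup F]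
    [NormedSpace ℝ F] {f : F → ℝ} {A : F → F →L[ℝ] ℝ} {y : F} (hA : ContinuousAt A y)
    (hsub : ∀ z w, A z (w - z) ≤ f w - f z) : HasFDerivAt f (A y) y := by
  rw [hasFDerivAt_iff_isLittleO, Asymptotics.isLittleO_iff]
  intro ε hε
  filter_upwards [Metric.continuousAt_iff'.1 hA ε hε] with w hw
  rw [dist_eq_norm] at hw
  have hgap : f w - f y - A y (w - y) ≤ (A w - A y) (w - y) := by
    have := hsub w y
    rw [← neg_sub w y, map_neg] at this
    rw [sub_apply]
    linarith
  rw [Real.norm_of_nonneg (sub_nonneg.2 (hsub y w))]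
  calc f w - f y - A y (w - y) ≤ ‖(A w - A y) (w - y)‖ := hgap.trans (Real.le_norm_self _)
    _ ≤ ‖A w - A y‖ * ‖w - y‖ := ContinuousLinearMap.le_opNorm _ _
    _ ≤ ε * ‖w - y‖ := by gcongr

/-- It suffices to know the inequality for parallel vectors: the two sides are affine in
`⟪y, z⟫`, and the coefficient of `⟪y, z⟫` has a sign. -/
lemma mul_norm_sub_sq_le_inner_smul_sub_smul {F : Type*} [NormedAddCommGroup F]
    [InnerProductSpace ℝ F] {c k l : ℝ} {y z : F} (hc : 2 * c ≤ k + l)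
    (hradial : c * (‖y‖ - ‖z‖) ^ 2 ≤ (k * ‖y‖ - l * ‖z‖) * (‖y‖ - ‖z‖)) :
    c * ‖y - z‖ ^ 2 ≤ inner ℝ (k • y - l • z) (y - z) := by
  have hinner : inner ℝ (k • y - l • z) (y - z) =
      k * ‖y‖ ^ 2 + l * ‖z‖ ^ 2 - (k + l) * inner ℝ y z := by
    simp only [inner_sub_left, inner_sub_right, real_inner_smul_left,
      real_inner_self_eq_norm_sq, real_inner_comm y z]
    ring
  have hcs := mul_le_mul_of_nonneg_left (real_inner_le_norm y z) (sub_nonneg.2 hc)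
  rw [hinner, norm_sub_sq_real]
  linarith

end Convexity

/-! ### The conductivity at one point -/

/-- Admissible exponents `α` and coefficients `c` of the Forchheimer polynomial at one point. -/
structure IsCoeff {N : ℕ} (α c : Fin (N + 1) → ℝ) : Prop where
  exponent_zero : α 0 = 0
  exponent_strictMono : StrictMono α
  coeff_zero_pos : 0 < c 0
  coeff_nonneg : ∀ j, 0 ≤ c j
  coeff_last_pos : 0 < c (Fin.last N)
  one_le : 1 ≤ N

/-- The conductivity `K(ξ) = 1 / g(s(ξ))` at one point: `K α a x` is
`cond α (fun j => a j x)` by definition. -/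
def cond {N : ℕ} (α c : Fin (N + 1) → ℝ) (ξ : ℝ) : ℝ :=
  1 / g α c (root α c ξ)

/-- The potential `H(ξ) = 2 ∫₀^ξ K(σ) σ dσ` of the flux `K(|y|) y` at one point, written with
`K(σ) σ = s(σ)`. -/
def potential {N : ℕ} (α c : Fin (N + 1) → ℝ) (ξ : ℝ) : ℝ :=
  2 * ∫ σ in (0 : ℝ)..ξ, root α c σ

/-- The weight `W₁` at one point: `W1 α a x` is `weight α (fun j => a j x)` by definition. -/
def weight {N : ℕ} (α c : Fin (N + 1) → ℝ) : ℝ :=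
  c (Fin.last N) ^ expo α / (2 * N * Finset.univ.sup' Finset.univ_nonempty c)

lemma root_nonneg {N : ℕ} (α c : Fin (N + 1) → ℝ) (ξ : ℝ) : 0 ≤ root α c ξ := by
  unfold root
  split_ifs with h
  · exact h.choose_spec.1
  · exact le_rfl

namespace IsCoeff

variable {N : ℕ} {α c : Fin (N + 1) → ℝ} (h : IsCoeff α c)
include h

lemma exponent_nonneg (j : Fin (N + 1)) : 0 ≤ α j :=
  h.exponent_zero.symm.trans_le (h.exponent_strictMono.monotone (Fin.zero_le j))

lemma exponent_le_last (j : Fin (N + 1)) : α j ≤ α (Fin.last N) :=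
  h.exponent_strictMono.monotone (Fin.le_last j)

lemma exponent_last_pos : 0 < α (Fin.last N) :=
  h.exponent_zero.symm.trans_lt
    (h.exponent_strictMono (Fin.lt_def.2 (by simpa using Nat.zero_lt_of_lt h.one_le)))

lemma expo_pos : 0 < expo α :=
  div_pos h.exponent_last_pos (by linarith [h.exponent_last_pos])

lemma expo_lt_one : expo α < 1 :=
  (div_lt_one (by linarith [h.exponent_last_pos])).2 (lt_add_one _)

lemma one_sub_expo : 1 - expo α = (α (Fin.last N) + 1)⁻¹ := by
  have := h.exponent_last_pos
  unfold expo
  field_simp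
  ring

lemma expo_mul_exponent_last_add_one : expo α * (α (Fin.last N) + 1) = α (Fin.last N) :=
  div_mul_cancel₀ _ (by linarith [h.exponent_last_pos])

lemma term_le_g (j : Fin (N + 1)) {s : ℝ} (hs : 0 ≤ s) : c j * s ^ α j ≤ g α c s :=
  Finset.single_le_sum (f := fun j => c j * s ^ α j)
    (fun i _ => mul_nonneg (h.coeff_nonneg i) (Real.rpow_nonneg hs _)) (Finset.mem_univ j)

lemma coeff_zero_le_g {s : ℝ} (hs : 0 ≤ s) : c 0 ≤ g α c s := by
  simpa [h.exponent_zero] using h.term_le_g 0 hs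

lemma g_pos {s : ℝ} (hs : 0 ≤ s) : 0 < g α c s :=
  h.coeff_zero_pos.trans_le (h.coeff_zero_le_g hs)

lemma monotoneOn_g : MonotoneOn (g α c) (Ici 0) := fun _ hr _ _ hrs =>
  Finset.sum_le_sum fun j _ => mul_le_mul_of_nonneg_left
    (Real.rpow_le_rpow hr hrs (h.exponent_nonneg j)) (h.coeff_nonneg j)

lemma strictMonoOn_mul_g : StrictMonoOn (fun s => s * g α c s) (Ici 0) :=
  fun _ hr _ hs hrs => mul_lt_mul hrs (h.monotoneOn_g hr hs hrs.le) (h.g_pos hr) hs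

lemma continuous_g : Continuous (g α c) :=
  continuous_finsetSum _ fun j _ =>
    continuous_const.mul (Real.continuous_rpow_const (h.exponent_nonneg j))

lemma mul_g_sub_mul_g_le {r s : ℝ} (hr : 0 ≤ r) (hrs : r ≤ s) :
    s * g α c s - r * g α c r ≤ (α (Fin.last N) + 1) * g α c s * (s - r) := by
  have hmul_g : ∀ s : ℝ, 0 ≤ s → s * g α c s = ∑ j, c j * s ^ (α j + 1) := fun s hs => by
    rw [g, Finset.mul_sum]
    refine Finset.sum_congr rfl fun j _ => ?_
    rw [Real.rpow_add_one' hs (by linarith [h.exponent_nonneg j])]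
    ring
  rw [hmul_g r hr, hmul_g s (hr.trans hrs), ← Finset.sum_sub_distrib, g, Finset.mul_sum,
    Finset.sum_mul]
  refine Finset.sum_le_sum fun j _ => ?_
  have hpow : s ^ (α j + 1) - r ^ (α j + 1) ≤ (α j + 1) * s ^ α j * (s - r) := by
    simpa using rpow_sub_rpow_le_mul_sub hr hrs
      (le_add_of_nonneg_left (h.exponent_nonneg j) : 1 ≤ α j + 1)
  calc c j * s ^ (α j + 1) - c j * r ^ (α j + 1)
      = c j * (s ^ (α j + 1) - r ^ (α j + 1)) := by ring
    _ ≤ c j * ((α (Fin.last N) + 1) * s ^ α j * (s - r)) := by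
        refine mul_le_mul_of_nonneg_left (hpow.trans ?_) (h.coeff_nonneg j)
        have := hr.trans hrs
        have := sub_nonneg.2 hrs
        gcongr
        exact h.exponent_le_last j
    _ = (α (Fin.last N) + 1) * (c j * s ^ α j) * (s - r) := by ring

lemma root_mul_g {ξ : ℝ} (hξ : 0 ≤ ξ) : root α c ξ * g α c (root α c ξ) = ξ := by
  have hex := (existsUnique_root h.exponent_zero h.exponent_strictMono h.coeff_zero_pos
    h.coeff_nonneg hξ).exists
  unfold root
  rw [dif_pos hex]
  exact hex.choose_spec.2

lemma root_of_neg {ξ : ℝ} (hξ : ξ < 0) : root α c ξ = 0 := by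
  refine dif_neg fun ⟨s, hs, hsξ⟩ => hξ.not_ge ?_
  rw [← hsξ]
  exact mul_nonneg hs (h.g_pos hs).le

lemma root_le_iff {ξ s : ℝ} (hs : 0 ≤ s) : root α c ξ ≤ s ↔ ξ ≤ s * g α c s := by
  rcases lt_or_ge ξ 0 with hξ | hξ
  · rw [h.root_of_neg hξ]
    exact iff_of_true hs (hξ.le.trans (mul_nonneg hs (h.g_pos hs).le))
  · rw [← h.strictMonoOn_mul_g.le_iff_le (root_nonneg α c ξ) hs]
    simp only [h.root_mul_g hξ]

lemma le_root_mul_g (ξ : ℝ) : ξ ≤ root α c ξ * g α c (root α c ξ) :=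
  (h.root_le_iff (root_nonneg _ _ _)).1 le_rfl

lemma monotone_root : Monotone (root α c) := fun _ η hle =>
  (h.root_le_iff (root_nonneg _ _ _)).2 (hle.trans (h.le_root_mul_g η))

lemma root_sub_root_le {ξ η : ℝ} (hle : ξ ≤ η) :
    root α c η - root α c ξ ≤ (c 0)⁻¹ * (η - ξ) := by
  set r := root α c ξ
  have hr : 0 ≤ r := root_nonneg α c ξ
  have hδ : 0 ≤ (c 0)⁻¹ * (η - ξ) :=
    mul_nonneg (inv_nonneg.2 h.coeff_zero_pos.le) (sub_nonneg.2 hle)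
  rw [sub_le_iff_le_add', h.root_le_iff (add_nonneg hr hδ), add_mul]
  have hstart : ξ ≤ r * g α c (r + (c 0)⁻¹ * (η - ξ)) :=
    (h.le_root_mul_g ξ).trans (mul_le_mul_of_nonneg_left
      (h.monotoneOn_g hr (add_nonneg hr hδ) (le_add_of_nonneg_right hδ)) hr)
  have hincr := mul_le_mul_of_nonneg_left (h.coeff_zero_le_g (add_nonneg hr hδ)) hδ
  rw [mul_right_comm, inv_mul_cancel₀ h.coeff_zero_pos.ne', one_mul] at hincr
  linarith

lemma continuous_root : Continuous (root α c) := by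
  refine (LipschitzWith.of_le_add_mul (Real.toNNReal (c 0)⁻¹) fun ξ η => ?_).continuous
  have hc : 0 ≤ (c 0)⁻¹ := inv_nonneg.2 h.coeff_zero_pos.le
  rw [Real.coe_toNNReal _ hc, Real.dist_eq, ← sub_le_iff_le_add']
  rcases le_total η ξ with hle | hle
  · rw [abs_of_nonneg (sub_nonneg.2 hle)]
    exact h.root_sub_root_le hle
  · exact (sub_nonpos.2 (h.monotone_root hle)).trans (mul_nonneg hc (abs_nonneg _))

lemma g_root_pos (ξ : ℝ) : 0 < g α c (root α c ξ) := h.g_pos (root_nonneg _ _ _)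

lemma cond_pos (ξ : ℝ) : 0 < cond α c ξ := one_div_pos.2 (h.g_root_pos ξ)

lemma cond_le (ξ : ℝ) : cond α c ξ ≤ (c 0)⁻¹ := by
  rw [cond, one_div]
  exact inv_anti₀ h.coeff_zero_pos (h.coeff_zero_le_g (root_nonneg _ _ _))

lemma antitone_cond : Antitone (cond α c) := fun ξ _ hle =>
  one_div_le_one_div_of_le (h.g_root_pos ξ)
    (h.monotoneOn_g (root_nonneg _ _ _) (root_nonneg _ _ _) (h.monotone_root hle))

lemma continuous_cond : Continuous (cond α c) :=
  continuous_const.div (h.continuous_g.comp h.continuous_root) fun ξ => (h.g_root_pos ξ).ne'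

lemma cond_mul_self {ξ : ℝ} (hξ : 0 ≤ ξ) : cond α c ξ * ξ = root α c ξ := by
  rw [cond, one_div, inv_mul_eq_div, div_eq_iff (h.g_root_pos ξ).ne', h.root_mul_g hξ]

lemma one_sub_expo_mul_cond_mul_sub_le {ξ η : ℝ} (hξ : 0 ≤ ξ) (hle : ξ ≤ η) :
    (1 - expo α) * cond α c η * (η - ξ) ≤ root α c η - root α c ξ := by
  have hlip := h.mul_g_sub_mul_g_le (root_nonneg α c ξ) (h.monotone_root hle)
  rw [h.root_mul_g hξ, h.root_mul_g (hξ.trans hle)] at hlip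
  have hg := h.g_root_pos η
  have hα := h.exponent_last_pos
  rw [h.one_sub_expo, cond, one_div, ← mul_inv, inv_mul_eq_div, div_le_iff₀ (by positivity)]
  linarith

lemma one_sub_expo_mul_cond_max_le_inner {F : Type*} [NormedAddCommGroup F]
    [InnerProductSpace ℝ F] (y z : F) :
    (1 - expo α) * (cond α c (max ‖y‖ ‖z‖) * ‖y - z‖ ^ 2) ≤
      inner ℝ (cond α c ‖y‖ • y - cond α c ‖z‖ • z) (y - z) := by
  wlog hle : ‖z‖ ≤ ‖y‖ generalizing y z
  · rw [max_comm, norm_sub_rev, ← inner_neg_neg, neg_sub, neg_sub]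
    exact this z y (le_of_not_ge hle)
  rw [max_eq_left hle, ← mul_assoc]
  refine mul_norm_sub_sq_le_inner_smul_sub_smul ?_ ?_
  · have hcond := h.antitone_cond hle
    nlinarith [h.expo_pos, h.cond_pos ‖y‖]
  · rw [h.cond_mul_self (norm_nonneg y), h.cond_mul_self (norm_nonneg z), sq, ← mul_assoc]
    exact mul_le_mul_of_nonneg_right
      (h.one_sub_expo_mul_cond_mul_sub_le (norm_nonneg z) hle) (sub_nonneg.2 hle)

lemma two_mul_root_mul_sub_le (ξ η : ℝ) :
    2 * root α c ξ * (η - ξ) ≤ potential α c η - potential α c ξ := by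
  rw [potential, potential, ← mul_sub, intervalIntegral.integral_interval_sub_left
    h.monotone_root.intervalIntegrable h.monotone_root.intervalIntegrable, mul_assoc]
  exact mul_le_mul_of_nonneg_left (mul_sub_le_integral_of_monotone h.monotone_root ξ η)
    zero_le_two

lemma potential_le {ξ : ℝ} (hξ : 0 ≤ ξ) : potential α c ξ ≤ 2 * (cond α c ξ * ξ ^ 2) := by
  have := h.two_mul_root_mul_sub_le ξ 0
  rw [← h.cond_mul_self hξ, potential, intervalIntegral.integral_same] at this
  linarith

/-- Since `K` decreases, `s(σ) = K(σ) σ` lies above the chord `K(ξ) σ` for `0 ≤ σ ≤ ξ`. -/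
lemma cond_mul_sq_le_potential {ξ : ℝ} (hξ : 0 ≤ ξ) :
    cond α c ξ * ξ ^ 2 ≤ potential α c ξ := by
  have hchord : ∫ σ in (0 : ℝ)..ξ, cond α c ξ * σ ≤ ∫ σ in (0 : ℝ)..ξ, root α c σ := by
    refine intervalIntegral.integral_mono_on hξ
      (Continuous.intervalIntegrable (by fun_prop) _ _) h.monotone_root.intervalIntegrable
      fun σ hσ => ?_
    rw [← h.cond_mul_self hσ.1]
    exact mul_le_mul_of_nonneg_right (h.antitone_cond hσ.2) hσ.1
  rw [intervalIntegral.integral_const_mul, integral_id] at hchord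
  rw [potential]
  linarith

lemma potential_nonneg {ξ : ℝ} (hξ : 0 ≤ ξ) : 0 ≤ potential α c ξ :=
  (mul_nonneg (h.cond_pos ξ).le (sq_nonneg ξ)).trans (h.cond_mul_sq_le_potential hξ)

lemma hasFDerivAt_potential_norm {F : Type*} [NormedAddCommGroup F] [InnerProductSpace ℝ F]
    (y : F) :
    HasFDerivAt (fun z => potential α c ‖z‖) ((2 * cond α c ‖y‖) • innerSL ℝ y) y := by
  refine hasFDerivAt_of_continuousAt_subgradient
    (A := fun z => (2 * cond α c ‖z‖) • innerSL ℝ z) ?_ fun z w => ?_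
  · have := h.continuous_cond
    exact Continuous.continuousAt (by fun_prop)
  · refine le_trans ?_ (h.two_mul_root_mul_sub_le ‖z‖ ‖w‖)
    have hcs := mul_le_mul_of_nonneg_left (real_inner_le_norm z w) (h.cond_pos ‖z‖).le
    simp only [smul_apply, innerSL_apply_apply, smul_eq_mul]
    rw [inner_sub_right, real_inner_self_eq_norm_sq, ← h.cond_mul_self (norm_nonneg z)]
    linarith

lemma hasDerivAt_potential_norm {F : Type*} [NormedAddCommGroup F] [InnerProductSpace ℝ F]
    {y : ℝ → F} {y' : F} {t : ℝ} (hy : HasDerivAt y y' t) :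
    HasDerivAt (fun s => potential α c ‖y s‖) (2 * (cond α c ‖y t‖ * inner ℝ (y t) y')) t := by
  simpa [mul_assoc, Function.comp_def] using
    (h.hasFDerivAt_potential_norm (y t)).comp_hasDerivAt t hy

lemma cond_mul_mul_le_add {ξ η : ℝ} (hξ : 0 ≤ ξ) (hη : 0 ≤ η) :
    cond α c ξ * (ξ * η) ≤ cond α c ξ * ξ ^ 2 + cond α c η * η ^ 2 := by
  have hcond_ξ := h.cond_pos ξ
  have hcond_η := h.cond_pos η
  rcases le_total ξ η with hle | hle
  · have hroot := h.monotone_root hle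
    rw [← h.cond_mul_self hξ, ← h.cond_mul_self hη] at hroot
    nlinarith [mul_nonneg hcond_ξ.le (sq_nonneg ξ)]
  · nlinarith [mul_nonneg hcond_η.le (sq_nonneg η), mul_nonneg hcond_ξ.le hξ]

lemma cond_mul_mul_sq_le (ξ η : ℝ) :
    (cond α c ξ * (ξ * η)) ^ 2 ≤ (cond α c ξ * ξ ^ 2) * ((c 0)⁻¹ * η ^ 2) := by
  have hcond := h.cond_pos ξ
  calc (cond α c ξ * (ξ * η)) ^ 2 = (cond α c ξ * ξ ^ 2 * η ^ 2) * cond α c ξ := by ring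
    _ ≤ (cond α c ξ * ξ ^ 2 * η ^ 2) * (c 0)⁻¹ := by gcongr; exact h.cond_le ξ
    _ = _ := by ring

lemma two_mul_cond_mul_inner_le {F : Type*} [NormedAddCommGroup F] [InnerProductSpace ℝ F]
    (y z : F) :
    2 * (cond α c ‖y‖ * inner ℝ y z) ≤ cond α c ‖y‖ * ‖y‖ ^ 2 + (c 0)⁻¹ * ‖z‖ ^ 2 := by
  have hcond := h.cond_pos ‖y‖
  calc 2 * (cond α c ‖y‖ * inner ℝ y z) = cond α c ‖y‖ * (2 * inner ℝ y z) := by ring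
    _ ≤ cond α c ‖y‖ * (‖y‖ ^ 2 + ‖z‖ ^ 2) := by
      gcongr
      nlinarith [real_inner_le_norm y z, sq_nonneg (‖y‖ - ‖z‖)]
    _ = cond α c ‖y‖ * ‖y‖ ^ 2 + cond α c ‖y‖ * ‖z‖ ^ 2 := mul_add _ _ _
    _ ≤ _ := by gcongr; exact h.cond_le _

lemma coeff_sup_pos : 0 < Finset.univ.sup' Finset.univ_nonempty c :=
  h.coeff_zero_pos.trans_le (Finset.le_sup' c (Finset.mem_univ 0))

lemma weight_denom_pos : 0 < 2 * N * Finset.univ.sup' Finset.univ_nonempty c :=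
  mul_pos (mul_pos two_pos (Nat.cast_pos.2 h.one_le)) h.coeff_sup_pos

lemma coeff_last_le_weight_denom :
    c (Fin.last N) ≤ 2 * N * Finset.univ.sup' Finset.univ_nonempty c := by
  have hN : (1 : ℝ) ≤ N := Nat.one_le_cast.2 h.one_le
  refine (Finset.le_sup' c (Finset.mem_univ _)).trans ?_
  exact le_mul_of_one_le_left h.coeff_sup_pos.le (by linarith)

lemma weight_pos : 0 < weight α c :=
  div_pos (Real.rpow_pos_of_pos h.coeff_last_pos _) h.weight_denom_pos

lemma g_le_weight_denom_mul_max {s : ℝ} (hs : 0 ≤ s) :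
    g α c s ≤
      2 * N * Finset.univ.sup' Finset.univ_nonempty c * max 1 (s ^ α (Fin.last N)) := by
  have hsup := h.coeff_sup_pos
  have hN : (1 : ℝ) ≤ N := Nat.one_le_cast.2 h.one_le
  have hterm : ∀ j ∈ Finset.univ, c j * s ^ α j ≤
      Finset.univ.sup' Finset.univ_nonempty c * max 1 (s ^ α (Fin.last N)) := fun j _ => by
    refine mul_le_mul (Finset.le_sup' c (Finset.mem_univ j)) ?_ (Real.rpow_nonneg hs _) hsup.le
    rcases le_total s 1 with hs1 | hs1
    · exact le_max_of_le_left (Real.rpow_le_one hs hs1 (h.exponent_nonneg j))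
    · exact le_max_of_le_right (Real.rpow_le_rpow_of_exponent_le hs1 (h.exponent_le_last j))
  have hsum := Finset.sum_le_card_nsmul _ _ _ hterm
  rw [Finset.card_univ, Fintype.card_fin, nsmul_eq_mul, ← mul_assoc] at hsum
  refine hsum.trans ?_
  push_cast
  gcongr
  linarith

lemma coeff_last_rpow_mul_max_le {ξ : ℝ} (hξ : 0 ≤ ξ) :
    c (Fin.last N) ^ expo α * max 1 (root α c ξ ^ α (Fin.last N)) ≤
      max (c (Fin.last N)) ξ ^ expo α := by
  set s := root α c ξ with hs_def
  have hs : 0 ≤ s := root_nonneg _ _ _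
  have hlast := h.coeff_last_pos
  have hα := h.exponent_last_pos
  have hpow : s ^ α (Fin.last N) = (s ^ (α (Fin.last N) + 1)) ^ expo α := by
    rw [← Real.rpow_mul hs, mul_comm, h.expo_mul_exponent_last_add_one]
  have hξ_ge : c (Fin.last N) * s ^ (α (Fin.last N) + 1) ≤ ξ := by
    have := mul_le_mul_of_nonneg_left (h.term_le_g (Fin.last N) hs) hs
    rw [hs_def, h.root_mul_g hξ, ← hs_def] at this
    rw [Real.rpow_add_one' hs (by positivity)]
    linarith
  rw [mul_max_of_nonneg _ _ (Real.rpow_nonneg hlast.le _), mul_one, hpow,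
    ← Real.mul_rpow hlast.le (Real.rpow_nonneg hs _)]
  exact max_le (Real.rpow_le_rpow hlast.le (le_max_left _ _) h.expo_pos.le)
    (Real.rpow_le_rpow (by positivity) (le_max_of_le_right hξ_ge) h.expo_pos.le)

lemma weight_le_cond_mul_max_rpow {ξ : ℝ} (hξ : 0 ≤ ξ) :
    weight α c ≤ cond α c ξ * max (c (Fin.last N)) ξ ^ expo α := by
  have hlast := Real.rpow_nonneg h.coeff_last_pos.le (expo α)
  rw [weight, cond, one_div, inv_mul_eq_div, div_le_div_iff₀ h.weight_denom_pos (h.g_root_pos ξ)]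
  have hg := mul_le_mul_of_nonneg_left (h.g_le_weight_denom_mul_max (root_nonneg α c ξ)) hlast
  have hmax := mul_le_mul_of_nonneg_right (h.coeff_last_rpow_mul_max_le hξ) h.weight_denom_pos.le
  linarith

lemma weight_mul_max_rpow_le {ξ : ℝ} (hξ : 0 ≤ ξ) :
    weight α c * max (c (Fin.last N)) ξ ^ (2 - expo α) ≤
      cond α c ξ * ξ ^ 2 + c (Fin.last N) := by
  have hlast := h.coeff_last_pos
  rcases le_total (c (Fin.last N)) ξ with hle | hle
  · have hweight := mul_le_mul_of_nonneg_right (h.weight_le_cond_mul_max_rpow hξ)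
      (Real.rpow_nonneg hξ (2 - expo α))
    rw [max_eq_right hle] at hweight ⊢
    rw [mul_assoc, ← Real.rpow_add (hlast.trans_le hle), add_sub_cancel, Real.rpow_two] at hweight
    linarith
  · have hweight : weight α c * c (Fin.last N) ^ (2 - expo α) ≤ c (Fin.last N) := by
      rw [weight, div_mul_eq_mul_div, ← Real.rpow_add hlast, add_sub_cancel, Real.rpow_two,
        div_le_iff₀ h.weight_denom_pos, sq]
      exact mul_le_mul_of_nonneg_left h.coeff_last_le_weight_denom hlast.le
    rw [max_eq_left hle]
    linarith [mul_nonneg (h.cond_pos ξ).le (sq_nonneg ξ)]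

lemma weight_mul_rpow_le {ξ : ℝ} (hξ : 0 ≤ ξ) :
    weight α c * ξ ^ (2 - expo α) ≤ cond α c ξ * ξ ^ 2 + c (Fin.last N) :=
  (mul_le_mul_of_nonneg_left (Real.rpow_le_rpow hξ (le_max_right _ _)
    (by linarith [h.expo_lt_one])) h.weight_pos.le).trans (h.weight_mul_max_rpow_le hξ)

/-- Here `z` is a difference of two gradients and `ξ` the larger of their norms: the degeneracy
of `K` at large gradients is paid for with the factor `K(ξ) ξ² + a_N`, whose integral is an
energy. -/
lemma weight_mul_rpow_le_mul_rpow {ξ z : ℝ} (hξ : 0 ≤ ξ) (hz : 0 ≤ z) :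
    weight α c * z ^ (2 - expo α) ≤
      (cond α c ξ * z ^ 2) ^ ((2 - expo α) / 2) *
        (cond α c ξ * ξ ^ 2 + c (Fin.last N)) ^ (expo α / 2) := by
  have hw := h.weight_pos
  have ha := h.expo_lt_one
  have ha₀ := h.expo_pos
  have hk := h.cond_pos ξ
  have hm : 0 < max (c (Fin.last N)) ξ := lt_max_of_lt_left h.coeff_last_pos
  have hpow : z ^ (2 - expo α) = (z ^ 2) ^ ((2 - expo α) / 2) := by
    rw [← Real.rpow_two, ← Real.rpow_mul hz, mul_div_cancel₀ _ two_ne_zero]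
  have hweight : weight α c ≤ cond α c ξ ^ ((2 - expo α) / 2) *
      (weight α c * max (c (Fin.last N)) ξ ^ (2 - expo α)) ^ (expo α / 2) := by
    calc weight α c = weight α c ^ ((2 - expo α) / 2) * weight α c ^ (expo α / 2) := by
          rw [← Real.rpow_add hw, ← add_div, sub_add_cancel, div_self two_ne_zero, Real.rpow_one]
      _ ≤ (cond α c ξ * max (c (Fin.last N)) ξ ^ expo α) ^ ((2 - expo α) / 2) *
            weight α c ^ (expo α / 2) := by
          gcongr
          · linarith
          · exact h.weight_le_cond_mul_max_rpow hξ
      _ = _ := by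
          rw [Real.mul_rpow hk.le (by positivity), Real.mul_rpow hw.le (by positivity),
            ← Real.rpow_mul hm.le, ← Real.rpow_mul hm.le]
          ring_nf
  rw [Real.mul_rpow hk.le (by positivity), hpow]
  calc weight α c * (z ^ 2) ^ ((2 - expo α) / 2)
      ≤ cond α c ξ ^ ((2 - expo α) / 2) *
          (cond α c ξ * ξ ^ 2 + c (Fin.last N)) ^ (expo α / 2) *
          (z ^ 2) ^ ((2 - expo α) / 2) := by
        refine mul_le_mul_of_nonneg_right (hweight.trans ?_) (by positivity)
        gcongr
        exact h.weight_mul_max_rpow_le hξ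
    _ = _ := by ring

end IsCoeff

section Measurability

variable {X : Type*} [MeasurableSpace X] {μ : Measure X} {U : Set X} {N : ℕ}
  {α : Fin (N + 1) → ℝ} {c : Fin (N + 1) → X → ℝ} {ξ : X → ℝ}

lemma aemeasurable_root (hU : MeasurableSet U) (hc : ∀ x ∈ U, IsCoeff α (fun j => c j x))
    (hm : ∀ j, Measurable (c j)) (hξ : Measurable ξ) :
    AEMeasurable (fun x => root α (fun j => c j x) (ξ x)) (μ.restrict U) := by
  refine aemeasurable_restrict_of_measurable_subtype hU (measurable_of_Iic fun s => ?_)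
  rcases lt_or_ge s 0 with hs | hs
  · convert MeasurableSet.empty
    ext x
    simpa using hs.trans_le (root_nonneg _ _ _)
  · have hpre : (fun x : U => root α (fun j => c j x) (ξ x)) ⁻¹' Iic s =
        {x : U | ξ x ≤ s * g α (fun j => c j x) s} :=
      Set.ext fun x => (hc x x.2).root_le_iff hs
    rw [hpre]
    exact measurableSet_le (hξ.comp measurable_subtype_coe) (measurable_const.mul
      (Finset.measurable_sum _ fun j _ => ((hm j).comp measurable_subtype_coe).mul_const _))

lemma aestronglyMeasurable_potential [SFinite μ] (hU : MeasurableSet U)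
    (hc : ∀ x ∈ U, IsCoeff α (fun j => c j x)) (hm : ∀ j, Measurable (c j))
    (hξ : Measurable ξ) :
    AEStronglyMeasurable (fun x => potential α (fun j => c j x) (ξ x)) (μ.restrict U) := by
  have hjoint : AEStronglyMeasurable
      (fun q : X × ℝ => root α (fun j => c j q.1) (ξ q.1 * q.2))
      ((μ.restrict U).prod (volume.restrict (Ioc 0 1))) := by
    rw [Measure.prod_restrict]
    refine (aemeasurable_root (hU.prod measurableSet_Ioc) (c := fun j (q : X × ℝ) => c j q.1)
      (fun q hq => hc q.1 hq.1) (fun j => by exact (hm j).comp measurable_fst)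
      ?_).aestronglyMeasurable
    exact (hξ.comp measurable_fst).mul measurable_snd
  have hscale : ∀ x, potential α (fun j => c j x) (ξ x) =
      2 * (ξ x * ∫ σ in Ioc (0 : ℝ) 1, root α (fun j => c j x) (ξ x * σ)) := fun x => by
    rw [← intervalIntegral.integral_of_le zero_le_one,
      intervalIntegral.mul_integral_comp_mul_left, mul_zero, mul_one, potential]
  simp only [hscale]
  exact (hξ.aestronglyMeasurable.mul hjoint.integral_prod_right').const_mul 2

end Measurability

/-! ### Differential inequalities -/

lemma sub_le_of_hasDerivAt_le {w w' : ℝ → ℝ} {s t m : ℝ} (hst : s ≤ t)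
    (hw : ∀ τ ∈ Icc s t, HasDerivAt w (w' τ) τ) (hm : ∀ τ ∈ Icc s t, w' τ ≤ m) :
    w t - w s ≤ m * (t - s) := by
  have h := intervalIntegral.sub_le_integral_of_hasDeriv_right_of_le (φ := fun _ => m) hst
    (fun τ hτ => (hw τ hτ).continuousAt.continuousWithinAt)
    (fun τ hτ => (hw τ (Ioo_subset_Icc_self hτ)).hasDerivWithinAt)
    (by simp) (fun τ hτ => hm τ (Ioo_subset_Icc_self hτ))
  simpa [mul_comm] using h

lemma exists_last_nonpos {w : ℝ → ℝ} {r t : ℝ} (hrt : r ≤ t) (hw : ContinuousOn w (Icc r t))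
    (hr : w r ≤ 0) (ht : 0 < w t) : ∃ s ∈ Ico r t, w s ≤ 0 ∧ ∀ τ ∈ Ioc s t, 0 < w τ := by
  have hclosed : IsClosed (Icc r t ∩ w ⁻¹' Iic 0) :=
    hw.preimage_isClosed_of_isClosed isClosed_Icc isClosed_Iic
  have hcompact : IsCompact (Icc r t ∩ w ⁻¹' Iic 0) :=
    isCompact_Icc.of_isClosed_subset hclosed inter_subset_left
  obtain ⟨s, ⟨hs, hws⟩, hlast⟩ := hcompact.exists_isGreatest ⟨r, ⟨le_rfl, hrt⟩, hr⟩
  refine ⟨s, ⟨hs.1, hs.2.lt_of_ne ?_⟩, hws, fun τ hτ => ?_⟩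
  · rintro rfl
    exact (not_le.2 ht) hws
  · by_contra! hle
    exact (not_le.2 hτ.1) (hlast ⟨⟨hs.1.trans hτ.1.le, hτ.2⟩, hle⟩)

/- The rate of decrease is expressed through increments, so that barriers that are merely monotone
can be subtracted from differentiable functions. -/
lemma eventually_nonpos_of_decrease {w : ℝ → ℝ} {T m : ℝ} (hm : 0 < m)
    (hw : ContinuousOn w (Ici T))
    (hdecr : ∀ s t, T ≤ s → s ≤ t → (∀ τ ∈ Icc s t, 0 < w τ) → w t ≤ w s - m * (t - s)) :
    ∀ᶠ t in atTop, w t ≤ 0 := by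
  obtain ⟨r, hTr, hwr⟩ : ∃ r, T ≤ r ∧ w r ≤ 0 := by
    by_contra! hpos
    have hT : T ≤ T + w T / m := le_add_of_nonneg_right (div_pos (hpos T le_rfl) hm).le
    have hnonpos := hdecr T _ le_rfl hT fun τ hτ => hpos τ hτ.1
    rw [add_sub_cancel_left, mul_div_cancel₀ _ hm.ne', sub_self] at hnonpos
    exact (hpos _ hT).not_ge hnonpos
  filter_upwards [eventually_ge_atTop r] with t hrt
  by_contra! hwt
  obtain ⟨s, hs, hws, hpos⟩ :=
    exists_last_nonpos hrt (hw.mono fun τ hτ => hTr.trans hτ.1) hwr hwt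
  have hTs : T ≤ s := hTr.trans hs.1
  have hlim : Tendsto w (𝓝[>] s) (𝓝 (w s)) :=
    (hw s hTs).mono_left (nhdsWithin_mono _ fun τ hτ => hTs.trans (le_of_lt hτ))
  have hle : ∀ᶠ τ in 𝓝[>] s, w t ≤ w τ := by
    filter_upwards [Ioo_mem_nhdsGT hs.2] with τ hτ
    have hinc := hdecr τ t (hTs.trans hτ.1.le) hτ.2.le fun σ hσ =>
      hpos σ ⟨hτ.1.trans_le hσ.1, hσ.2⟩
    exact hinc.trans (sub_le_self _ (mul_nonneg hm.le (sub_nonneg.2 hτ.2.le)))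
  exact hwt.not_ge ((ge_of_tendsto hlim hle).trans hws)

lemma neg_mul_rpow_add_mul_le_neg {θ c C g u y : ℝ} (hθ : 0 < θ) (hc : 0 < c) (hC : 0 ≤ C)
    (hu : 0 ≤ u) (hgu : g ≤ u) (hy : ((C + 1) / c * u) ^ (1 / θ) ≤ y) :
    -(c * y ^ θ) + C * g ≤ -u := by
  have hpow : (C + 1) / c * u ≤ y ^ θ := by
    have h := Real.rpow_le_rpow (by positivity) hy hθ.le
    rwa [← Real.rpow_mul (by positivity), one_div_mul_cancel hθ.ne', Real.rpow_one] at h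
  have hdamp : (C + 1) * u ≤ c * y ^ θ := by
    calc (C + 1) * u = c * ((C + 1) / c * u) := by field_simp
      _ ≤ c * y ^ θ := mul_le_mul_of_nonneg_left hpow hc.le
  linarith [mul_le_mul_of_nonneg_left hgu hC]

lemma eventually_le_of_majorant {y y' G M : ℝ → ℝ} {θ c C : ℝ} (hθ : 0 < θ) (hc : 0 < c)
    (hC : 0 ≤ C) (hy : ∀ t > 0, HasDerivAt y (y' t) t)
    (hG : ∀ t > 0, 1 ≤ G t) (hM : IsMajorant M G)
    (hy' : ∀ t > 0, y' t ≤ -(c * y t ^ θ) + C * G t) :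
    ∀ᶠ t in atTop, y t ≤ ((C + 1) / c * M t) ^ (1 / θ) := by
  have hM1 : ∀ t > 0, 1 ≤ M t := fun t ht => (hG t ht).trans (hM.le t ht)
  have hcont : ContinuousOn (fun t => y t - ((C + 1) / c * M t) ^ (1 / θ)) (Ici 1) := by
    refine ContinuousOn.sub
      (fun t ht => (hy t (one_pos.trans_le ht)).continuousAt.continuousWithinAt) ?_
    exact (continuousOn_const.mul (hM.cont.mono (Ici_subset_Ici.2 zero_le_one))).rpow_const
      fun t _ => Or.inr (by positivity)
  refine (eventually_nonpos_of_decrease one_pos hcont fun s t hs hst hpos => ?_).mono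
    fun t ht => sub_nonpos.1 ht
  have hdecay : y t - y s ≤ -1 * (t - s) := by
    refine sub_le_of_hasDerivAt_le hst (fun τ hτ => hy τ (by linarith [hτ.1])) fun τ hτ => ?_
    have hτ0 : 0 < τ := by linarith [hτ.1]
    have hMτ := hM1 τ hτ0
    have hdamp := neg_mul_rpow_add_mul_le_neg hθ hc hC (by linarith) (hM.le τ hτ0)
      (sub_pos.1 (hpos τ hτ)).le
    linarith [hy' τ hτ0]
  have hbarrier : ((C + 1) / c * M s) ^ (1 / θ) ≤ ((C + 1) / c * M t) ^ (1 / θ) := by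
    have hMst : M s ≤ M t := hM.mono (mem_Ici.2 (by linarith)) (mem_Ici.2 (by linarith)) hst
    have hMs := hM1 s (by linarith)
    exact Real.rpow_le_rpow (by positivity) (by gcongr) (by positivity)
  linarith

lemma mul_rpow_sub_one_le_half {B r u : ℝ} (hB : 0 ≤ B) (hr : r < 2) (hu : 0 < u)
    (hBu : (2 * B) ^ (1 / (2 - r)) ≤ u) : B * u ^ (r - 1) ≤ u / 2 := by
  have hr2 : 0 < 2 - r := sub_pos.2 hr
  have hpow : 2 * B ≤ u ^ (2 - r) := by
    have h := Real.rpow_le_rpow (by positivity) hBu hr2.le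
    rwa [← Real.rpow_mul (by positivity), one_div_mul_cancel hr2.ne', Real.rpow_one] at h
  calc B * u ^ (r - 1) = 2 * B * u ^ (r - 1) / 2 := by ring
    _ ≤ u ^ (2 - r) * u ^ (r - 1) / 2 := by gcongr
    _ = u / 2 := by rw [← Real.rpow_add hu, sub_add_sub_cancel]; norm_num

lemma neg_half_le_deriv_rpow {κ r β u u' : ℝ} (hκ : 0 < κ) (hr0 : 0 ≤ r) (hr : r < 2)
    (hβ : 0 ≤ β) (hu : 0 < u) (hβu : (2 * (r * κ ^ r * β)) ^ (1 / (2 - r)) ≤ u)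
    (hu' : -β ≤ u') : -(u / 2) ≤ κ * u' * r * (κ * u) ^ (r - 1) := by
  have hderiv : κ * u' * r * (κ * u) ^ (r - 1) = r * κ ^ r * u ^ (r - 1) * u' := by
    rw [Real.mul_rpow hκ.le hu.le, Real.rpow_sub_one hκ.ne']
    field_simp
  have hhalf := mul_rpow_sub_one_le_half (by positivity) hr hu hβu
  have hslope : r * κ ^ r * u ^ (r - 1) * -β ≤ r * κ ^ r * u ^ (r - 1) * u' := by gcongr
  rw [hderiv]
  linarith

lemma eventually_le_of_neg_le_deriv {y y' G G' : ℝ → ℝ} {θ c C β : ℝ} (hθ : 1 / 2 < θ)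
    (hθ1 : θ ≤ 1) (hc : 0 < c) (hC : 0 ≤ C) (hβ : 0 ≤ β) (hy : ∀ t > 0, HasDerivAt y (y' t) t)
    (hG : ∀ t > 0, 1 ≤ G t) (hGd : ∀ t > 0, HasDerivAt G (G' t) t)
    (hG' : ∀ᶠ t in atTop, -β ≤ G' t) (hy' : ∀ t > 0, y' t ≤ -(c * y t ^ θ) + C * G t) :
    ∀ᶠ t in atTop, y t ≤ ((C + 1) / c * (G t +
      (2 * (1 / θ * ((C + 1) / c) ^ (1 / θ) * β)) ^ (1 / (2 - 1 / θ)))) ^ (1 / θ) := by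
  have hθ0 : 0 < θ := by linarith
  set κ := (C + 1) / c
  have hκ : 0 < κ := by positivity
  have hr1 : 1 ≤ 1 / θ := by rwa [le_div_iff₀ hθ0, one_mul]
  have hr2 : 1 / θ < 2 := by rw [div_lt_iff₀ hθ0]; linarith
  set L := (2 * (1 / θ * κ ^ (1 / θ) * β)) ^ (1 / (2 - 1 / θ))
  have hL0 : 0 ≤ L := by positivity
  obtain ⟨T, hT⟩ := eventually_atTop.1 hG'
  have hbarrier : ∀ t > 0, HasDerivAt (fun t => (κ * (G t + L)) ^ (1 / θ))
      (κ * G' t * (1 / θ) * (κ * (G t + L)) ^ (1 / θ - 1)) t := fun t ht =>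
    (((hGd t ht).add_const L).const_mul κ).rpow_const (Or.inr hr1)
  have hdiff : ∀ t > 0, HasDerivAt (fun t => y t - (κ * (G t + L)) ^ (1 / θ))
      (y' t - κ * G' t * (1 / θ) * (κ * (G t + L)) ^ (1 / θ - 1)) t := fun t ht =>
    (hy t ht).sub (hbarrier t ht)
  have hlarge : ∀ t, max T 1 ≤ t → T ≤ t ∧ 0 < t := fun t ht =>
    ⟨(le_max_left _ _).trans ht, one_pos.trans_le ((le_max_right _ _).trans ht)⟩
  refine (eventually_nonpos_of_decrease (T := max T 1) one_half_pos
    (fun t ht => (hdiff t (hlarge t ht).2).continuousAt.continuousWithinAt)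
    fun s t hs hst hpos => ?_).mono fun t ht => sub_nonpos.1 ht
  have hdecay := sub_le_of_hasDerivAt_le (m := -(1 / 2)) hst
    (fun τ hτ => hdiff τ (hlarge τ (hs.trans hτ.1)).2) fun τ hτ => ?_
  · linarith
  · obtain ⟨hTτ, hτ0⟩ := hlarge τ (hs.trans hτ.1)
    have hGτ := hG τ hτ0
    have hdamp := neg_mul_rpow_add_mul_le_neg (u := G τ + L) hθ0 hc hC (by linarith)
      (by linarith) (sub_pos.1 (hpos τ hτ)).le
    have hslope := neg_half_le_deriv_rpow (u := G τ + L) hκ (by positivity) hr2 hβ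
      (by linarith) (by linarith) (hT τ hTτ)
    linarith [hy' τ hτ0]

/- Integrate the derivative of `(s - (t - 1)) * J s + 8 * y s` over `[t - 1, t]`: the factor
`s - (t - 1)` removes `J (t - 1)`, and the damping `-J / 4` of `y` absorbs the terms in `J`. -/
lemma le_add_integral_of_deriv_le {J J' y y' A B : ℝ → ℝ} {t : ℝ} (ht : 1 < t)
    (hJ : ∀ s > 0, HasDerivAt J (J' s) s) (hy : ∀ s > 0, HasDerivAt y (y' s) s)
    (hJ0 : ∀ s > 0, 0 ≤ J s) (hy0 : ∀ s > 0, 0 ≤ y s) (hA0 : ∀ s > 0, 0 ≤ A s)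
    (hJ' : ∀ s > 0, J' s ≤ J s + A s) (hy' : ∀ s > 0, y' s ≤ -(1 / 4 * J s) + B s)
    (hA : ContinuousOn A (Ioi 0)) (hB : ContinuousOn B (Ioi 0)) :
    J t ≤ 8 * y (t - 1) + ∫ s in (t - 1)..t, (A s + 8 * B s) := by
  have hpos : ∀ s ∈ Icc (t - 1) t, 0 < s := fun s hs => by linarith [hs.1]
  have hderiv : ∀ s > 0, HasDerivAt (fun s => (s - (t - 1)) * J s + 8 * y s)
      (1 * J s + (s - (t - 1)) * J' s + 8 * y' s) s := fun s hs =>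
    (((hasDerivAt_id s).sub_const (t - 1)).mul (hJ s hs)).add ((hy s hs).const_mul 8)
  have hle : ∀ s ∈ Ioo (t - 1) t,
      1 * J s + (s - (t - 1)) * J' s + 8 * y' s ≤ A s + 8 * B s := fun s hs => by
    have hs0 := hpos s (Ioo_subset_Icc_self hs)
    have hweight : (s - (t - 1)) * J' s ≤ 1 * (J s + A s) := by
      refine (mul_le_mul_of_nonneg_left (hJ' s hs0) (by linarith [hs.1])).trans ?_
      exact mul_le_mul_of_nonneg_right (by linarith [hs.2]) (add_nonneg (hJ0 s hs0) (hA0 s hs0))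
    linarith [hy' s hs0]
  have h := intervalIntegral.sub_le_integral_of_hasDeriv_right_of_le (by linarith)
    (fun s hs => (hderiv s (hpos s hs)).continuousAt.continuousWithinAt)
    (fun s hs => (hderiv s (hpos s (Ioo_subset_Icc_self hs))).hasDerivWithinAt)
    ((hA.mono hpos).add (continuousOn_const.mul (hB.mono hpos))).integrableOn_Icc hle
  simp only [sub_self, zero_mul, zero_add, sub_sub_cancel, one_mul, Pi.add_apply,
    Pi.mul_apply] at h
  linarith [hy0 t (by linarith)]

lemma mul_rpow_le_add {b X q ε : ℝ} (hb : 0 ≤ b) (hX : 0 ≤ X) (hq : 1 < q) (hε : 0 < ε) :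
    b * X ^ (1 / q) ≤ ε * X + (1 / ε) ^ (1 / (q - 1)) * b ^ (q / (q - 1)) := by
  have hq0 : 0 < q := by linarith
  have hq1 : 0 < q - 1 := by linarith
  have hconj : q.HolderConjugate (q / (q - 1)) := Real.HolderConjugate.conjExponent hq
  have hp1 : 1 ≤ q / (q - 1) := hconj.symm.lt.le
  have hεq : 0 < ε ^ (1 / q) := by positivity
  calc b * X ^ (1 / q) = (ε * X) ^ (1 / q) * (b / ε ^ (1 / q)) := by
        rw [Real.mul_rpow hε.le hX]; field_simp
    _ ≤ ((ε * X) ^ (1 / q)) ^ q / q + (b / ε ^ (1 / q)) ^ (q / (q - 1)) / (q / (q - 1)) :=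
        Real.young_inequality_of_nonneg (by positivity) (by positivity) hconj
    _ ≤ ((ε * X) ^ (1 / q)) ^ q + (b / ε ^ (1 / q)) ^ (q / (q - 1)) :=
        add_le_add (div_le_self (by positivity) hq.le) (div_le_self (by positivity) hp1)
    _ = ε * X + (1 / ε) ^ (1 / (q - 1)) * b ^ (q / (q - 1)) := by
        rw [← Real.rpow_mul (by positivity), one_div_mul_cancel hq0.ne', Real.rpow_one,
          Real.div_rpow hb hεq.le, ← Real.rpow_mul hε.le,
          show 1 / q * (q / (q - 1)) = 1 / (q - 1) by field_simp, Real.div_rpow one_pos.le hε.le,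
          Real.one_rpow]
        ring

lemma exists_le_integral_of_lintegral_eq_top {h : ℝ → ℝ} {T : ℝ} (hcont : ContinuousOn h (Ici T))
    (h0 : ∀ t ≥ T, 0 ≤ h t) (hdiv : ∫⁻ t in Ici T, ENNReal.ofReal (h t) = ⊤) (R : ℝ) :
    ∃ r ≥ T, ∀ t ≥ r, R ≤ ∫ s in T..t, h s := by
  have hInt : ∀ t, IntegrableOn h (Icc T t) := fun t =>
    (hcont.mono fun s hs => hs.1).integrableOn_Icc
  obtain ⟨r, hr, hR⟩ : ∃ r ≥ T, R ≤ ∫ s in T..r, h s := by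
    by_contra! hlt
    have hfinite : IntegrableOn h (Ioi T) := by
      refine integrableOn_Ioi_of_intervalIntegral_norm_bounded (b := id) (l := atTop) R T
        (fun t => (hInt t).mono_set Ioc_subset_Icc_self) tendsto_id ?_
      filter_upwards [eventually_ge_atTop T] with t ht
      refine le_trans (le_of_eq ?_) (hlt t ht).le
      refine intervalIntegral.integral_congr fun s hs => ?_
      rw [id, uIcc_of_le ht] at hs
      exact Real.norm_of_nonneg (h0 s hs.1)
    have htop := hfinite.lintegral_lt_top
    rw [restrict_Ioi_eq_restrict_Ici] at htop
    exact htop.ne hdiv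
  refine ⟨r, hr, fun t ht => hR.trans ?_⟩
  refine intervalIntegral.integral_mono_interval le_rfl hr ht ?_ ?_
  · exact (ae_restrict_iff' measurableSet_Ioc).2 (Eventually.of_forall fun s hs => h0 s hs.1.le)
  · rw [intervalIntegrable_iff_integrableOn_Icc_of_le (hr.trans ht)]
    exact hInt t

lemma lintegral_Ici_eq_top_of_le {h : ℝ → ℝ≥0∞} {S T : ℝ} (hST : S ≤ T) {b : ℝ≥0∞} (hb : b ≠ ⊤)
    (hle : ∀ t ∈ Ico S T, h t ≤ b) (hdiv : ∫⁻ t in Ici S, h t = ⊤) :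
    ∫⁻ t in Ici T, h t = ⊤ := by
  rw [← Ico_union_Ici_eq_Ici hST, lintegral_union measurableSet_Ici
    (Set.disjoint_left.2 fun t ht ht' => absurd ht.2 (not_lt.2 ht'))] at hdiv
  refine (ENNReal.add_eq_top.1 hdiv).resolve_left (ne_of_lt ?_)
  calc ∫⁻ t in Ico S T, h t ≤ ∫⁻ _ in Ico S T, b := setLIntegral_mono measurable_const hle
    _ < ⊤ := by simpa using ENNReal.mul_lt_top hb.lt_top ENNReal.ofReal_lt_top

lemma sub_mul_exp_integral_le {Y Y' h : ℝ → ℝ} {S T c b : ℝ} (hST : S < T)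
    (hY : ∀ t ≥ T, HasDerivAt Y (Y' t) t) (hcont : ContinuousOn h (Ici S))
    (hY' : ∀ t ≥ T, Y' t ≤ -(c * h t * (Y t - b))) {t : ℝ} (ht : T ≤ t) :
    (Y t - b) * Real.exp (c * ∫ s in S..t, h s) ≤
      (Y T - b) * Real.exp (c * ∫ s in S..T, h s) := by
  have hprim : ∀ t ≥ T, HasDerivAt (fun t => ∫ s in S..t, h s) (h t) t := fun t ht => by
    have hSt : S < t := hST.trans_le ht
    refine intervalIntegral.integral_hasDerivAt_right
      (ContinuousOn.intervalIntegrable_of_Icc hSt.le (hcont.mono fun s hs => hs.1))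
      ?_ (hcont.continuousAt (Ici_mem_nhds hSt))
    exact (hcont.mono Ioi_subset_Ici_self).stronglyMeasurableAtFilter isOpen_Ioi t hSt
  have hderiv : ∀ t ≥ T, HasDerivAt (fun t => (Y t - b) * Real.exp (c * ∫ s in S..t, h s))
      (Y' t * Real.exp (c * ∫ s in S..t, h s) +
        (Y t - b) * (Real.exp (c * ∫ s in S..t, h s) * (c * h t))) t := fun t ht =>
    ((hY t ht).sub_const b).mul (((hprim t ht).const_mul c).exp)
  have hanti := sub_le_of_hasDerivAt_le (m := 0) ht (fun τ hτ => hderiv τ hτ.1) fun τ hτ => ?_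
  · linarith
  · calc Y' τ * Real.exp (c * ∫ s in S..τ, h s) +
          (Y τ - b) * (Real.exp (c * ∫ s in S..τ, h s) * (c * h τ))
        = (Y' τ + c * h τ * (Y τ - b)) * Real.exp (c * ∫ s in S..τ, h s) := by ring
      _ ≤ 0 := mul_nonpos_of_nonpos_of_nonneg (by linarith [hY' τ hτ.1]) (Real.exp_pos _).le

lemma eventually_le_of_linear_inequality {Y Y' h : ℝ → ℝ} {c b b' : ℝ} (hc : 0 < c)
    (hbb' : b' < b) (hY : ∀ t > 0, HasDerivAt Y (Y' t) t) (hcont : ContinuousOn h (Ioi 1))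
    (h0 : ∀ t ≥ 1, 0 ≤ h t) (h1 : ∀ t ≥ 1, h t ≤ 1)
    (hdiv : ∫⁻ t in Ici (1 : ℝ), ENNReal.ofReal (h t) = ⊤)
    (hY' : ∀ᶠ t in atTop, Y' t ≤ -(c * h t * (Y t - b'))) : ∀ᶠ t in atTop, Y t ≤ b := by
  obtain ⟨T₀, hT₀⟩ := eventually_atTop.1 hY'
  set S := max T₀ 2
  have hS : 1 < S := one_lt_two.trans_le (le_max_right _ _)
  have hcontS : ContinuousOn h (Ici S) := hcont.mono fun t ht => hS.trans_le ht
  have hdivS : ∫⁻ t in Ici S, ENNReal.ofReal (h t) = ⊤ :=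
    lintegral_Ici_eq_top_of_le hS.le ENNReal.one_ne_top
      (fun t ht => ENNReal.ofReal_le_one.2 (h1 t ht.1)) hdiv
  set f := fun t => (Y t - b') * Real.exp (c * ∫ s in S..t, h s)
  have hanti : ∀ t ≥ S + 1, f t ≤ f (S + 1) := fun t ht =>
    sub_mul_exp_integral_le (lt_add_one S) (fun τ hτ => hY τ (by linarith)) hcontS
      (fun τ hτ => hT₀ τ (by linarith [le_max_left T₀ 2])) ht
  obtain ⟨r, -, hr⟩ := exists_le_integral_of_lintegral_eq_top hcontS
    (fun t ht => h0 t (hS.le.trans ht)) hdivS (|f (S + 1)| / (b - b') / c)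
  filter_upwards [eventually_ge_atTop (S + 1), eventually_ge_atTop r] with t ht htr
  have hexp : |f (S + 1)| / (b - b') ≤ Real.exp (c * ∫ s in S..t, h s) := by
    have hle := hr t htr
    rw [div_le_iff₀ hc] at hle
    linarith [Real.add_one_le_exp (c * ∫ s in S..t, h s)]
  rw [div_le_iff₀ (sub_pos.2 hbb'), mul_comm] at hexp
  have hfb := (hanti t ht).trans ((le_abs_self _).trans hexp)
  linarith [le_of_mul_le_mul_right hfb (Real.exp_pos _)]

lemma limsupInf_le_mul_limsupInf {Y F : ℝ → ℝ} {K : ℝ} (hK : 0 < K)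
    (h : ∀ b b', b' < b → (∀ᶠ t in atTop, K * F t ≤ b') → ∀ᶠ t in atTop, Y t ≤ b) :
    limsupInf Y ≤ ENNReal.ofReal K * limsupInf F := by
  rcases eq_or_ne (limsupInf F) ⊤ with htop | -
  · simp [htop, ENNReal.mul_top, hK]
  refine le_of_forall_gt_imp_ge_of_dense fun b hb => ?_
  rcases eq_or_ne b ⊤ with rfl | hbtop
  · exact le_top
  obtain ⟨b', hb', hb'b⟩ := exists_between hb
  have hb'top : b' ≠ ⊤ := (hb'b.trans_le le_top).ne
  have hlt : limsupInf F < ENNReal.ofReal (b'.toReal / K) := by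
    rw [ENNReal.ofReal_div_of_pos hK, ENNReal.ofReal_toReal hb'top, ENNReal.lt_div_iff_mul_lt
      (Or.inl (by simpa using hK)) (Or.inl ENNReal.ofReal_ne_top), mul_comm]
    exact hb'
  have hF : ∀ᶠ t in atTop, K * F t ≤ b'.toReal := by
    filter_upwards [eventually_lt_of_limsup_lt hlt] with t ht
    rw [mul_comm, ← le_div_iff₀ hK]
    exact (ENNReal.ofReal_lt_ofReal_iff'.1 ht).1.le
  refine limsup_le_of_le (by isBoundedDefault) ?_
  exact (h _ _ (ENNReal.toReal_strict_mono hbtop hb'b) hF).mono fun t ht =>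
    ENNReal.ofReal_le_of_le_toReal ht

lemma limsupInf_le_of_differential_inequality {Y Y' V D : ℝ → ℝ} {σ c C : ℝ} (hc : 0 < c)
    (hC : 0 < C) (hσ : 0 ≤ σ) (hY : ∀ t > 0, HasDerivAt Y (Y' t) t)
    (hV : ContinuousOn V (Ioi 1)) (hV1 : ∀ t ≥ 1, 1 ≤ V t)
    (hdiv : ∫⁻ t in Ici (1 : ℝ), ENNReal.ofReal (V t ^ (-σ)) = ⊤)
    (hY' : ∀ᶠ t in atTop, Y' t ≤ -(c * V t ^ (-σ) * Y t) + C * (V t ^ (1 / 2 : ℝ) * D t)) :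
    limsupInf Y ≤ ENNReal.ofReal (C / c) * limsupInf (fun t => V t ^ (σ + 1 / 2) * D t) := by
  refine limsupInf_le_mul_limsupInf (div_pos hC hc) fun b b' hbb' hF => ?_
  refine eventually_le_of_linear_inequality (h := fun t => V t ^ (-σ)) hc hbb' hY
    (hV.rpow_const fun t ht => Or.inl (zero_lt_one.trans_le (hV1 t (le_of_lt ht))).ne')
    (fun t ht => Real.rpow_nonneg (zero_le_one.trans (hV1 t ht)) _)
    (fun t ht => Real.rpow_le_one_of_one_le_of_nonpos (hV1 t ht) (neg_nonpos.2 hσ)) hdiv ?_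
  filter_upwards [hY', hF, eventually_ge_atTop 1] with t hdecay hforcing ht
  have hVt : 0 < V t := one_pos.trans_le (hV1 t ht)
  calc Y' t ≤ -(c * V t ^ (-σ) * Y t) + C * (V t ^ (1 / 2 : ℝ) * D t) := hdecay
    _ = -(c * V t ^ (-σ) * (Y t - C / c * (V t ^ (σ + 1 / 2) * D t))) := by
        rw [show (1 / 2 : ℝ) = -σ + (σ + 1 / 2) by ring, Real.rpow_add hVt]
        simp only [neg_add_cancel_left]
        field_simp
        ring
    _ ≤ -(c * V t ^ (-σ) * (Y t - b')) := by gcongr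

/-! ### Integral inequalities -/

lemma integrable_of_le_rpow_mul_rpow {X : Type*} [MeasurableSpace X] {μ : Measure X}
    {F f g : X → ℝ} {w : ℝ} (hw0 : 0 < w) (hw1 : w < 1) (hF : AEStronglyMeasurable F μ)
    (hF0 : ∀ᵐ x ∂μ, 0 ≤ F x) (hf : Integrable f μ) (hg : Integrable g μ)
    (hf0 : ∀ᵐ x ∂μ, 0 ≤ f x) (hg0 : ∀ᵐ x ∂μ, 0 ≤ g x)
    (hle : ∀ᵐ x ∂μ, F x ≤ f x ^ w * g x ^ (1 - w)) : Integrable F μ := by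
  refine ((hf.const_mul w).add (hg.const_mul (1 - w))).mono' hF ?_
  filter_upwards [hF0, hf0, hg0, hle] with x hFx hfx hgx hlex
  rw [Real.norm_of_nonneg hFx]
  exact hlex.trans (Real.geom_mean_le_arith_mean2_weighted hw0.le (sub_pos.2 hw1).le hfx hgx
    (add_sub_cancel w 1))

lemma integral_le_rpow_mul_rpow {X : Type*} [MeasurableSpace X] {μ : Measure X} {F f g : X → ℝ}
    {w : ℝ} (hw0 : 0 < w) (hw1 : w < 1) (hF : AEStronglyMeasurable F μ)
    (hF0 : ∀ᵐ x ∂μ, 0 ≤ F x) (hf : Integrable f μ) (hg : Integrable g μ)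
    (hf0 : ∀ᵐ x ∂μ, 0 ≤ f x) (hg0 : ∀ᵐ x ∂μ, 0 ≤ g x)
    (hle : ∀ᵐ x ∂μ, F x ≤ f x ^ w * g x ^ (1 - w)) :
    ∫ x, F x ∂μ ≤ (∫ x, f x ∂μ) ^ w * (∫ x, g x ∂μ) ^ (1 - w) := by
  have hw1' : 0 < 1 - w := sub_pos.2 hw1
  have hA : 0 ≤ ∫ x, f x ∂μ := integral_nonneg_of_ae hf0
  have hB : 0 ≤ ∫ x, g x ∂μ := integral_nonneg_of_ae hg0
  have hInt := integrable_of_le_rpow_mul_rpow hw0 hw1 hF hF0 hf hg hf0 hg0 hle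
  rw [← ENNReal.ofReal_le_ofReal_iff (by positivity), ENNReal.ofReal_mul (by positivity),
    ← ENNReal.ofReal_rpow_of_nonneg hA hw0.le, ← ENNReal.ofReal_rpow_of_nonneg hB hw1'.le,
    ofReal_integral_eq_lintegral_ofReal hInt hF0, ofReal_integral_eq_lintegral_ofReal hf hf0,
    ofReal_integral_eq_lintegral_ofReal hg hg0]
  refine le_trans (lintegral_mono_ae ?_) (ENNReal.lintegral_mul_norm_pow_le
    hf.aemeasurable.ennreal_ofReal hg.aemeasurable.ennreal_ofReal hw0.le hw1'.le
    (add_sub_cancel w 1))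
  filter_upwards [hf0, hg0, hle] with x hfx hgx hlex
  rw [ENNReal.ofReal_rpow_of_nonneg hfx hw0.le, ENNReal.ofReal_rpow_of_nonneg hgx hw1'.le,
    ← ENNReal.ofReal_mul (by positivity)]
  exact ENNReal.ofReal_le_ofReal hlex

lemma le_rpow_half_mul_rpow_half {x y z : ℝ} (hy : 0 ≤ y) (hz : 0 ≤ z) (h : x ^ 2 ≤ y * z) :
    x ≤ y ^ (1 / 2 : ℝ) * z ^ (1 - 1 / 2 : ℝ) := by
  rw [show (1 : ℝ) - 1 / 2 = 1 / 2 by norm_num, ← Real.mul_rpow hy hz, ← Real.sqrt_eq_rpow]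
  exact Real.le_sqrt_of_sq_le h

lemma integrable_of_sq_le_mul {X : Type*} [MeasurableSpace X] {μ : Measure X} {F f g : X → ℝ}
    (hF : AEStronglyMeasurable F μ) (hF0 : ∀ᵐ x ∂μ, 0 ≤ F x) (hf : Integrable f μ)
    (hg : Integrable g μ) (hf0 : ∀ᵐ x ∂μ, 0 ≤ f x) (hg0 : ∀ᵐ x ∂μ, 0 ≤ g x)
    (hle : ∀ᵐ x ∂μ, F x ^ 2 ≤ f x * g x) : Integrable F μ := by
  refine integrable_of_le_rpow_mul_rpow (w := 1 / 2) (by norm_num) (by norm_num) hF hF0 hf hg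
    hf0 hg0 ?_
  filter_upwards [hf0, hg0, hle] with x hfx hgx hlex
  exact le_rpow_half_mul_rpow_half hfx hgx hlex

lemma integral_le_rpow_half_mul_rpow_half {X : Type*} [MeasurableSpace X] {μ : Measure X}
    {F f g : X → ℝ} (hF : AEStronglyMeasurable F μ) (hF0 : ∀ᵐ x ∂μ, 0 ≤ F x)
    (hf : Integrable f μ) (hg : Integrable g μ) (hf0 : ∀ᵐ x ∂μ, 0 ≤ f x)
    (hg0 : ∀ᵐ x ∂μ, 0 ≤ g x) (hle : ∀ᵐ x ∂μ, F x ^ 2 ≤ f x * g x) :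
    ∫ x, F x ∂μ ≤ (∫ x, f x ∂μ) ^ (1 / 2 : ℝ) * (∫ x, g x ∂μ) ^ (1 / 2 : ℝ) := by
  have hholder := integral_le_rpow_mul_rpow (w := 1 / 2) (by norm_num) (by norm_num) hF hF0 hf hg
    hf0 hg0 (by
      filter_upwards [hf0, hg0, hle] with x hfx hgx hlex
      exact le_rpow_half_mul_rpow_half hfx hgx hlex)
  rwa [show (1 : ℝ) - 1 / 2 = 1 / 2 by norm_num] at hholder

/-! ### Gradients of locally Lipschitz functions -/

lemma measurable_gradient {n : ℕ} (u : E n → ℝ) : Measurable (gradient u) :=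
  (InnerProductSpace.toDual ℝ (E n)).symm.continuous.measurable.comp (measurable_fderiv ℝ u)

lemma ae_differentiableAt_of_locallyLipschitzOn {n : ℕ} {U : Set (E n)} (hU : IsOpen U)
    {u : E n → ℝ} (hu : LocallyLipschitzOn U u) :
    ∀ᵐ x ∂(volume.restrict U), DifferentiableAt ℝ u x := by
  rw [ae_restrict_iff' hU.measurableSet, ae_iff]
  refine measure_null_of_locally_null _ fun x hx => ?_
  have hxU : x ∈ U := (Classical.not_imp.1 hx).1
  obtain ⟨K, s, hs, hK⟩ := hu hxU
  rw [hU.nhdsWithin_eq hxU] at hs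
  obtain ⟨v, hvs, hv, hxv⟩ := mem_nhds_iff.1 hs
  have hrademacher := (hK.mono hvs).ae_differentiableWithinAt (μ := volume) hv.measurableSet
  rw [ae_restrict_iff' hv.measurableSet, ae_iff] at hrademacher
  refine ⟨v ∩ {x | ¬(x ∈ U → DifferentiableAt ℝ u x)},
    inter_mem (mem_nhdsWithin_of_mem_nhds (hv.mem_nhds hxv)) self_mem_nhdsWithin,
    measure_mono_null ?_ hrademacher⟩
  rintro y ⟨hyv, hy⟩ hdiff
  exact hy fun _ => (hdiff hyv).differentiableAt (hv.mem_nhds hyv)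

lemma ae_gradient_sub {n : ℕ} {U : Set (E n)} (hU : IsOpen U) {u v : E n → ℝ}
    (hu : LocallyLipschitzOn U u) (hv : LocallyLipschitzOn U v) :
    ∀ᵐ x ∂(volume.restrict U), gradient (u - v) x = gradient u x - gradient v x := by
  filter_upwards [ae_differentiableAt_of_locallyLipschitzOn hU hu,
    ae_differentiableAt_of_locallyLipschitzOn hU hv] with x hux hvx
  unfold gradient
  rw [fderiv_sub hux hvx, map_sub]

/-! ### Regularity in time -/

/-- The part of `Regular` that concerns the dependence on time; unlike `Regular` it is stable under
subtraction. -/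
structure TimeRegular {n : ℕ} (U : Set (E n)) (u : ℝ → E n → ℝ) : Prop where
  cont : ContinuousOn (Function.uncurry u) (Ioi 0 ×ˢ closure U)
  diff_time : ∀ t > 0, ∀ x ∈ closure U, DifferentiableAt ℝ (fun s => u s x) t
  cont_dt : ContinuousOn (Function.uncurry (dt u)) (Ioi 0 ×ˢ closure U)

lemma continuousOn_slice {n : ℕ} {U : Set (E n)} {u : ℝ → E n → ℝ}
    (hu : ContinuousOn (Function.uncurry u) (Ioi 0 ×ˢ closure U)) {t : ℝ} (ht : 0 < t) :
    ContinuousOn (u t) (closure U) :=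
  hu.comp (f := fun x => (t, x)) (by fun_prop) fun _ hx => ⟨ht, hx⟩

section TimeRegular

variable {n : ℕ} {U : Set (E n)} {u v : ℝ → E n → ℝ}

lemma Regular.timeRegular (h : Regular U u) : TimeRegular U u := ⟨h.cont, h.diff_time, h.cont_dt⟩

namespace TimeRegular

lemma dt_sub (hu : TimeRegular U u) (hv : TimeRegular U v) {t : ℝ} (ht : 0 < t) {x : E n}
    (hx : x ∈ closure U) : dt (u - v) t x = dt u t x - dt v t x :=
  deriv_fun_sub (hu.diff_time t ht x hx) (hv.diff_time t ht x hx)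

lemma sub (hu : TimeRegular U u) (hv : TimeRegular U v) : TimeRegular U (u - v) where
  cont := hu.cont.sub hv.cont
  diff_time t ht x hx := (hu.diff_time t ht x hx).fun_sub (hv.diff_time t ht x hx)
  cont_dt := (hu.cont_dt.sub hv.cont_dt).congr fun _ hz => hu.dt_sub hv hz.1 hz.2

lemma continuousOn (hu : TimeRegular U u) {t : ℝ} (ht : 0 < t) : ContinuousOn (u t) (closure U) :=
  continuousOn_slice hu.cont ht

lemma continuousOn_dt (hu : TimeRegular U u) {t : ℝ} (ht : 0 < t) :
    ContinuousOn (dt u t) (closure U) :=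
  continuousOn_slice hu.cont_dt ht

end TimeRegular

end TimeRegular

/-! ### Integrals over the porous medium -/

/-- An open bounded domain `U` filled with a medium of porosity `φ` and Forchheimer coefficients
`a`, with admissible exponents `α`: the standing assumptions on the equation. -/
structure Setting {n N : ℕ} (U : Set (E n)) (φ : E n → ℝ) (α : Fin (N + 1) → ℝ)
    (a : Fin (N + 1) → E n → ℝ) : Prop where
  isOpen : IsOpen U
  isBounded : Bornology.IsBounded U
  exponent_zero : α 0 = 0
  exponent_strictMono : StrictMono α
  one_le : 1 ≤ N
  medium : IsMedium U φ a

/-- The square `∫_U φ u² dx` of the weighted norm of `L²_φ`. -/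
def mass {n : ℕ} (U : Set (E n)) (φ : E n → ℝ) (u : E n → ℝ) : ℝ :=
  ∫ x in U, φ x * u x ^ 2

/-- The energy `∫_U K(x, |y|) |y|² dx` of a vector field `y`; for `y = ∇p` it is the dissipation
of the flow. -/
def energy {n N : ℕ} (U : Set (E n)) (α : Fin (N + 1) → ℝ) (a : Fin (N + 1) → E n → ℝ)
    (y : E n → E n) : ℝ :=
  ∫ x in U, K α a x ‖y x‖ * ‖y x‖ ^ 2

/-- The integral `∫_U a₀⁻¹ |z|² dx`, which controls the pairing of `z` with the flux of a field of
finite energy, because `K ≤ a₀⁻¹`. -/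
def dualEnergy {n N : ℕ} (U : Set (E n)) (a : Fin (N + 1) → E n → ℝ) (z : E n → E n) : ℝ :=
  ∫ x in U, (a 0 x)⁻¹ * ‖z x‖ ^ 2

/-- The integral `∫_U W₁ |z|^(2-a) dx` on the right-hand side of the Poincaré-Sobolev inequality. -/
def sobolevEnergy {n N : ℕ} (U : Set (E n)) (α : Fin (N + 1) → ℝ) (a : Fin (N + 1) → E n → ℝ)
    (z : E n → E n) : ℝ :=
  ∫ x in U, W1 α a x * ‖z x‖ ^ (2 - expo α)

lemma wnorm_two_eq_mass_rpow {n : ℕ} (U : Set (E n)) (φ u : E n → ℝ) :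
    wnorm U φ 2 u = mass U φ u ^ (1 / 2 : ℝ) := by
  simp only [wnorm, mass, Real.rpow_two, Real.norm_eq_abs, sq_abs]

namespace Setting

variable {n N : ℕ} {U : Set (E n)} {φ : E n → ℝ} {α : Fin (N + 1) → ℝ}
  {a : Fin (N + 1) → E n → ℝ} (S : Setting U φ α a)
include S

lemma isCoeff {x : E n} (hx : x ∈ U) : IsCoeff α (fun j => a j x) where
  exponent_zero := S.exponent_zero
  exponent_strictMono := S.exponent_strictMono
  coeff_zero_pos := S.medium.coeff_zero_pos x hx
  coeff_nonneg j := S.medium.coeff_nonneg j x hx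
  coeff_last_pos := S.medium.coeff_last_pos x hx
  one_le := S.one_le

lemma ae_isCoeff : ∀ᵐ x ∂(volume.restrict U), IsCoeff α (fun j => a j x) :=
  (ae_restrict_mem S.isOpen.measurableSet).mono fun _ hx => S.isCoeff hx

lemma ae_porosity_mem : ∀ᵐ x ∂(volume.restrict U), φ x ∈ Ioc (0 : ℝ) 1 :=
  (ae_restrict_mem S.isOpen.measurableSet).mono S.medium.porosity_mem

lemma expo_mem : expo α ∈ Ioo (0 : ℝ) 1 := by
  have h : IsCoeff α (fun _ => 1) :=
    ⟨S.exponent_zero, S.exponent_strictMono, one_pos, fun _ => zero_le_one, one_pos, S.one_le⟩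
  exact ⟨h.expo_pos, h.expo_lt_one⟩

lemma isCompact_closure : IsCompact (closure U) := S.isBounded.isCompact_closure

lemma integrableOn_porosity_mul {f : E n → ℝ} (hf : ContinuousOn f (closure U)) :
    IntegrableOn (fun x => φ x * f x) U := by
  refine Integrable.bdd_mul (c := 1)
    ((hf.integrableOn_compact S.isCompact_closure).mono_set subset_closure)
    S.medium.measurable_porosity.aestronglyMeasurable ?_
  filter_upwards [S.ae_porosity_mem] with x hx
  rw [Real.norm_of_nonneg hx.1.le]
  exact hx.2

lemma integrableOn_porosity_mul_sq {u : E n → ℝ} (hu : ContinuousOn u (closure U)) :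
    IntegrableOn (fun x => φ x * u x ^ 2) U :=
  S.integrableOn_porosity_mul (hu.pow 2)

lemma ae_porosity_mul_sq_nonneg (u : E n → ℝ) :
    ∀ᵐ x ∂(volume.restrict U), 0 ≤ φ x * u x ^ 2 :=
  S.ae_porosity_mem.mono fun _ hx => mul_nonneg hx.1.le (sq_nonneg _)

lemma ae_energy_density_nonneg (y : E n → E n) :
    ∀ᵐ x ∂(volume.restrict U), 0 ≤ K α a x ‖y x‖ * ‖y x‖ ^ 2 :=
  S.ae_isCoeff.mono fun _ hx => mul_nonneg (hx.cond_pos _).le (sq_nonneg _)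

lemma ae_dualEnergy_density_nonneg (z : E n → E n) :
    ∀ᵐ x ∂(volume.restrict U), 0 ≤ (a 0 x)⁻¹ * ‖z x‖ ^ 2 :=
  S.ae_isCoeff.mono fun _ hx => mul_nonneg (inv_nonneg.2 hx.coeff_zero_pos.le) (sq_nonneg _)

lemma ae_sobolevEnergy_density_nonneg (z : E n → E n) :
    ∀ᵐ x ∂(volume.restrict U), 0 ≤ W1 α a x * ‖z x‖ ^ (2 - expo α) :=
  S.ae_isCoeff.mono fun _ hx => mul_nonneg hx.weight_pos.le (Real.rpow_nonneg (norm_nonneg _) _)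

lemma mass_nonneg (u : E n → ℝ) : 0 ≤ mass U φ u :=
  integral_nonneg_of_ae (S.ae_porosity_mul_sq_nonneg u)

lemma energy_nonneg (y : E n → E n) : 0 ≤ energy U α a y :=
  integral_nonneg_of_ae (S.ae_energy_density_nonneg y)

lemma dualEnergy_nonneg (z : E n → E n) : 0 ≤ dualEnergy U a z :=
  integral_nonneg_of_ae (S.ae_dualEnergy_density_nonneg z)

lemma sobolevEnergy_nonneg (z : E n → E n) : 0 ≤ sobolevEnergy U α a z :=
  integral_nonneg_of_ae (S.ae_sobolevEnergy_density_nonneg z)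

lemma aestronglyMeasurable_K {ξ : E n → ℝ} (hξ : Measurable ξ) :
    AEStronglyMeasurable (fun x => K α a x (ξ x)) (volume.restrict U) := by
  have hroot := aemeasurable_root (μ := volume) S.isOpen.measurableSet (fun _ hx => S.isCoeff hx)
    S.medium.measurable_coeff hξ
  refine AEMeasurable.aestronglyMeasurable (AEMeasurable.const_div
    (Finset.aemeasurable_fun_sum _ fun j _ => ?_) 1)
  exact (S.medium.measurable_coeff j).aemeasurable.mul (hroot.pow_const _)

lemma aestronglyMeasurable_potential {ξ : E n → ℝ} (hξ : Measurable ξ) :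
    AEStronglyMeasurable (fun x => potential α (fun j => a j x) (ξ x)) (volume.restrict U) :=
  Forchheimer.aestronglyMeasurable_potential S.isOpen.measurableSet (fun _ hx => S.isCoeff hx)
    S.medium.measurable_coeff hξ

lemma measurable_W1 : Measurable (W1 α a) := by
  have hsup : Measurable fun x => Finset.univ.sup' Finset.univ_nonempty (fun j => a j x) := by
    convert Finset.measurable_sup' Finset.univ_nonempty fun j _ => S.medium.measurable_coeff j
      using 1
    ext x
    rw [Finset.sup'_apply]
  exact ((S.medium.measurable_coeff _).pow_const _).div (measurable_const.mul hsup)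

section Flux

variable {y z : E n → E n} (hy : Measurable y) (hz : Measurable z)
include hy hz

lemma aestronglyMeasurable_flux_inner :
    AEStronglyMeasurable (fun x => K α a x ‖y x‖ * inner ℝ (y x) (z x)) (volume.restrict U) :=
  (S.aestronglyMeasurable_K hy.norm).mul (hy.inner hz).aestronglyMeasurable

lemma aestronglyMeasurable_flux_norm :
    AEStronglyMeasurable (fun x => K α a x ‖y x‖ * (‖y x‖ * ‖z x‖)) (volume.restrict U) :=
  (S.aestronglyMeasurable_K hy.norm).mul (hy.norm.mul hz.norm).aestronglyMeasurable

lemma integrableOn_flux_norm (hyE : IntegrableOn (fun x => K α a x ‖y x‖ * ‖y x‖ ^ 2) U)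
    (hzD : IntegrableOn (fun x => (a 0 x)⁻¹ * ‖z x‖ ^ 2) U) :
    IntegrableOn (fun x => K α a x ‖y x‖ * (‖y x‖ * ‖z x‖)) U :=
  integrable_of_sq_le_mul (S.aestronglyMeasurable_flux_norm hy hz)
    (S.ae_isCoeff.mono fun _ hx => mul_nonneg (hx.cond_pos _).le (by positivity)) hyE hzD
    (S.ae_energy_density_nonneg y) (S.ae_dualEnergy_density_nonneg z)
    (S.ae_isCoeff.mono fun _ hx => hx.cond_mul_mul_sq_le _ _)

lemma integral_flux_norm_le (hyE : IntegrableOn (fun x => K α a x ‖y x‖ * ‖y x‖ ^ 2) U)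
    (hzD : IntegrableOn (fun x => (a 0 x)⁻¹ * ‖z x‖ ^ 2) U) :
    ∫ x in U, K α a x ‖y x‖ * (‖y x‖ * ‖z x‖) ≤
      energy U α a y ^ (1 / 2 : ℝ) * dualEnergy U a z ^ (1 / 2 : ℝ) :=
  integral_le_rpow_half_mul_rpow_half (S.aestronglyMeasurable_flux_norm hy hz)
    (S.ae_isCoeff.mono fun _ hx => mul_nonneg (hx.cond_pos _).le (by positivity)) hyE hzD
    (S.ae_energy_density_nonneg y) (S.ae_dualEnergy_density_nonneg z)
    (S.ae_isCoeff.mono fun _ hx => hx.cond_mul_mul_sq_le _ _)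

lemma integrableOn_flux_inner_of_norm
    (hyz : IntegrableOn (fun x => K α a x ‖y x‖ * (‖y x‖ * ‖z x‖)) U) :
    IntegrableOn (fun x => K α a x ‖y x‖ * inner ℝ (y x) (z x)) U := by
  refine hyz.mono' (S.aestronglyMeasurable_flux_inner hy hz) ?_
  filter_upwards [S.ae_isCoeff] with x hx
  have hK : 0 ≤ K α a x ‖y x‖ := (hx.cond_pos _).le
  rw [norm_mul, Real.norm_of_nonneg hK]
  exact mul_le_mul_of_nonneg_left (norm_inner_le_norm _ _) hK

lemma integrableOn_flux_inner (hyE : IntegrableOn (fun x => K α a x ‖y x‖ * ‖y x‖ ^ 2) U)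
    (hzD : IntegrableOn (fun x => (a 0 x)⁻¹ * ‖z x‖ ^ 2) U) :
    IntegrableOn (fun x => K α a x ‖y x‖ * inner ℝ (y x) (z x)) U :=
  S.integrableOn_flux_inner_of_norm hy hz (S.integrableOn_flux_norm hy hz hyE hzD)

lemma two_mul_integral_flux_inner_le
    (hyE : IntegrableOn (fun x => K α a x ‖y x‖ * ‖y x‖ ^ 2) U)
    (hzD : IntegrableOn (fun x => (a 0 x)⁻¹ * ‖z x‖ ^ 2) U) :
    2 * ∫ x in U, K α a x ‖y x‖ * inner ℝ (y x) (z x) ≤ energy U α a y + dualEnergy U a z := by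
  rw [← integral_const_mul, energy, dualEnergy, ← integral_add hyE hzD]
  refine integral_mono_ae ((S.integrableOn_flux_inner hy hz hyE hzD).const_mul 2)
    (hyE.add hzD) ?_
  filter_upwards [S.ae_isCoeff] with x hx
  exact hx.two_mul_cond_mul_inner_le (y x) (z x)

lemma integrableOn_flux_inner_of_energy
    (hyE : IntegrableOn (fun x => K α a x ‖y x‖ * ‖y x‖ ^ 2) U)
    (hzE : IntegrableOn (fun x => K α a x ‖z x‖ * ‖z x‖ ^ 2) U) :
    IntegrableOn (fun x => K α a x ‖y x‖ * inner ℝ (y x) (z x)) U := by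
  refine S.integrableOn_flux_inner_of_norm hy hz
    ((hyE.add hzE).mono' (S.aestronglyMeasurable_flux_norm hy hz) ?_)
  filter_upwards [S.ae_isCoeff] with x hx
  have hK : 0 ≤ K α a x ‖y x‖ := (hx.cond_pos _).le
  rw [Real.norm_of_nonneg (by positivity)]
  exact hx.cond_mul_mul_le_add (norm_nonneg _) (norm_nonneg _)

end Flux

section Mass

variable {u v : E n → ℝ}

lemma abs_integral_porosity_mul_le (hu : ContinuousOn u (closure U))
    (hv : ContinuousOn v (closure U)) :
    |∫ x in U, φ x * (u x * v x)| ≤ mass U φ u ^ (1 / 2 : ℝ) * mass U φ v ^ (1 / 2 : ℝ) :=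
  abs_integral_le_integral_abs.trans (integral_le_rpow_half_mul_rpow_half
    (S.integrableOn_porosity_mul (hu.mul hv)).abs.aestronglyMeasurable
    (Eventually.of_forall fun _ => abs_nonneg _)
    (S.integrableOn_porosity_mul_sq hu) (S.integrableOn_porosity_mul_sq hv)
    (S.ae_porosity_mul_sq_nonneg u) (S.ae_porosity_mul_sq_nonneg v)
    (Eventually.of_forall fun x => by rw [sq_abs]; exact le_of_eq (by ring)))

lemma mass_sub_le (hu : ContinuousOn u (closure U)) (hv : ContinuousOn v (closure U)) :
    mass U φ (u - v) ≤ 2 * (mass U φ u + mass U φ v) := by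
  have hint_u := S.integrableOn_porosity_mul_sq hu
  have hint_v := S.integrableOn_porosity_mul_sq hv
  unfold mass
  rw [← integral_add hint_u hint_v, ← integral_const_mul]
  refine integral_mono_ae (S.integrableOn_porosity_mul_sq (hu.sub hv))
    ((hint_u.add hint_v).const_mul 2) ?_
  filter_upwards [S.ae_porosity_mem] with x hx
  have hsq := mul_nonneg hx.1.le (sq_nonneg (u x + v x))
  simp only [Pi.sub_apply]
  linarith

lemma wnorm_two_sq (u : E n → ℝ) : wnorm U φ 2 u ^ 2 = mass U φ u := by
  rw [wnorm_two_eq_mass_rpow, ← Real.sqrt_eq_rpow, Real.sq_sqrt (S.mass_nonneg u)]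

lemma mass_rpow_half_le {cP : ℝ} (hcP : 0 < cP) (h : PoincareSobolev U φ α a cP u) {X : ℝ}
    (hX : sobolevEnergy U α a (gradient u) ≤ X) :
    mass U φ u ^ (1 / 2 : ℝ) ≤ cP * X ^ (1 / (2 - expo α)) := by
  rw [PoincareSobolev, wnorm_two_eq_mass_rpow] at h
  have ha := S.expo_mem.2
  exact h.trans (mul_le_mul_of_nonneg_left (Real.rpow_le_rpow (S.sobolevEnergy_nonneg _) hX
    (one_div_nonneg.2 (by linarith))) hcP.le)

end Mass

/-! ### Differentiation of integrals in time -/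

lemma exists_abs_mul_dt_le {u : ℝ → E n → ℝ} (hu : TimeRegular U u) {t : ℝ} (ht : 0 < t) :
    ∃ B, ∀ s ∈ Ioo (t / 2) (2 * t), ∀ x ∈ closure U, |u s x * dt u s x| ≤ B := by
  have hcompact : IsCompact (Icc (t / 2) (2 * t) ×ˢ closure U) :=
    isCompact_Icc.prod S.isCompact_closure
  obtain ⟨B, hB⟩ := hcompact.exists_bound_of_continuousOn ((hu.cont.mul hu.cont_dt).mono
    (prod_mono (fun _ hs => (half_pos ht).trans_le hs.1) Subset.rfl))
  exact ⟨B, fun s hs x hx => hB (s, x) ⟨Ioo_subset_Icc_self hs, hx⟩⟩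

lemma hasDerivAt_mass {u : ℝ → E n → ℝ} (hu : TimeRegular U u) {t : ℝ} (ht : 0 < t) :
    HasDerivAt (fun s => mass U φ (u s)) (2 * ∫ x in U, φ x * (u t x * dt u t x)) t := by
  obtain ⟨B, hB⟩ := S.exists_abs_mul_dt_le hu ht
  have hmem := ae_restrict_mem (μ := volume) S.isOpen.measurableSet
  have hnhds : Ioo (t / 2) (2 * t) ∈ 𝓝 t := Ioo_mem_nhds (by linarith) (by linarith)
  have hderiv := hasDerivAt_integral_of_dominated_loc_of_deriv_le (μ := volume.restrict U)
    (F := fun s x => φ x * u s x ^ 2) (F' := fun s x => 2 * (φ x * (u s x * dt u s x)))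
    (bound := fun _ => 2 * B) hnhds ?_
    (S.integrableOn_porosity_mul_sq (hu.continuousOn ht))
    ((S.integrableOn_porosity_mul
      ((hu.continuousOn ht).mul (hu.continuousOn_dt ht))).const_mul 2).aestronglyMeasurable ?_
    (integrableOn_const S.isBounded.measure_lt_top.ne) ?_
  · rw [← integral_const_mul]
    exact hderiv.2
  · filter_upwards [lt_mem_nhds ht] with s hs
    exact (S.integrableOn_porosity_mul_sq (hu.continuousOn hs)).aestronglyMeasurable
  · filter_upwards [hmem, S.ae_porosity_mem] with x hx hφ s hs
    rw [norm_mul, norm_mul, Real.norm_of_nonneg zero_le_two, Real.norm_of_nonneg hφ.1.le]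
    gcongr
    exact (mul_le_of_le_one_left (norm_nonneg _) hφ.2).trans (hB s hs x (subset_closure hx))
  · filter_upwards [hmem] with x hx s hs
    have hs0 : 0 < s := (half_pos ht).trans hs.1
    exact (((hu.diff_time s hs0 x (subset_closure hx)).hasDerivAt.fun_pow 2).const_mul
      (φ x)).congr_deriv (by norm_num [dt]; ring)

lemma integrableOn_potential {y : E n → E n} (hy : Measurable y)
    (hyE : IntegrableOn (fun x => K α a x ‖y x‖ * ‖y x‖ ^ 2) U) :
    IntegrableOn (fun x => potential α (fun j => a j x) ‖y x‖) U := by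
  refine (hyE.const_mul 2).mono' (S.aestronglyMeasurable_potential hy.norm) ?_
  filter_upwards [S.ae_isCoeff] with x hx
  rw [Real.norm_of_nonneg (hx.potential_nonneg (norm_nonneg _))]
  exact hx.potential_le (norm_nonneg _)

lemma energy_le_integral_potential {y : E n → E n} (hy : Measurable y)
    (hyE : IntegrableOn (fun x => K α a x ‖y x‖ * ‖y x‖ ^ 2) U) :
    energy U α a y ≤ ∫ x in U, potential α (fun j => a j x) ‖y x‖ :=
  integral_mono_ae hyE (S.integrableOn_potential hy hyE)
    (S.ae_isCoeff.mono fun _ hx => hx.cond_mul_sq_le_potential (norm_nonneg _))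

lemma integral_potential_le {y : E n → E n} (hy : Measurable y)
    (hyE : IntegrableOn (fun x => K α a x ‖y x‖ * ‖y x‖ ^ 2) U) :
    ∫ x in U, potential α (fun j => a j x) ‖y x‖ ≤ 2 * energy U α a y := by
  rw [energy, ← integral_const_mul]
  exact integral_mono_ae (S.integrableOn_potential hy hyE) (hyE.const_mul 2)
    (S.ae_isCoeff.mono fun _ hx => hx.potential_le (norm_nonneg _))

section Potential

variable {y y' : ℝ → E n → E n} {t : ℝ} (hy : ∀ s, Measurable (y s)) (hy' : Measurable (y' t))

include hy hy' in
lemma integrableOn_flux_inner_of_dominated {b : E n → ℝ} (hb : IntegrableOn b U)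
    (hle : ∀ᵐ x ∂(volume.restrict U), K α a x ‖y t x‖ * ‖y t x‖ * ‖y' t x‖ ≤ b x) :
    IntegrableOn (fun x => K α a x ‖y t x‖ * inner ℝ (y t x) (y' t x)) U := by
  refine S.integrableOn_flux_inner_of_norm (hy t) hy'
    (hb.mono' (S.aestronglyMeasurable_flux_norm (hy t) hy') ?_)
  filter_upwards [S.ae_isCoeff, hle] with x hx hlex
  have hK : 0 ≤ K α a x ‖y t x‖ := (hx.cond_pos _).le
  rwa [Real.norm_of_nonneg (by positivity), ← mul_assoc]

include hy hy' in
lemma hasDerivAt_integral_potential {ε : ℝ} (hε : 0 < ε) (ht : 0 < t)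
    (hyE : IntegrableOn (fun x => K α a x ‖y t x‖ * ‖y t x‖ ^ 2) U) {b : E n → ℝ}
    (hb : IntegrableOn b U)
    (hle : ∀ᵐ x ∂(volume.restrict U), ∀ s ∈ Ioo (t - ε) (t + ε),
      K α a x ‖y s x‖ * ‖y s x‖ * ‖y' s x‖ ≤ b x)
    (hderiv : ∀ᵐ x ∂(volume.restrict U), ∀ s > 0, HasDerivAt (fun s => y s x) (y' s x) s) :
    HasDerivAt (fun s => ∫ x in U, potential α (fun j => a j x) ‖y s x‖)
      (2 * ∫ x in U, K α a x ‖y t x‖ * inner ℝ (y t x) (y' t x)) t := by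
  have hnhds : Ioo (t - ε) (t + ε) ∩ Ioi 0 ∈ 𝓝 t :=
    inter_mem (Ioo_mem_nhds (by linarith) (by linarith)) (Ioi_mem_nhds ht)
  have hInt := S.integrableOn_flux_inner_of_dominated hy hy' hb
    (hle.mono fun x hx => hx t (mem_of_mem_nhds hnhds).1)
  have hd := hasDerivAt_integral_of_dominated_loc_of_deriv_le (μ := volume.restrict U)
    (F := fun s x => potential α (fun j => a j x) ‖y s x‖)
    (F' := fun s x => 2 * (K α a x ‖y s x‖ * inner ℝ (y s x) (y' s x)))
    (bound := fun x => 2 * b x) hnhds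
    (Eventually.of_forall fun s => S.aestronglyMeasurable_potential (hy s).norm)
    (S.integrableOn_potential (hy t) hyE) (hInt.const_mul 2).aestronglyMeasurable ?_
    (hb.const_mul 2) ?_
  · rw [← integral_const_mul]
    exact hd.2
  · filter_upwards [S.ae_isCoeff, hle] with x hx hlex s hs
    have hK : 0 ≤ K α a x ‖y s x‖ := (hx.cond_pos _).le
    rw [norm_mul, norm_mul, Real.norm_of_nonneg zero_le_two, Real.norm_of_nonneg hK]
    refine mul_le_mul_of_nonneg_left (le_trans ?_ (hlex s hs.1)) zero_le_two
    rw [mul_assoc]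
    exact mul_le_mul_of_nonneg_left (norm_inner_le_norm _ _) hK
  · filter_upwards [S.ae_isCoeff, hderiv] with x hx hderivx s hs
    exact hx.hasDerivAt_potential_norm (hderivx s hs.2)

end Potential

end Setting

/-! ### Boundary data -/

lemma add_rpow_le_four_mul {u v q : ℝ} (hu : 0 ≤ u) (hv : 0 ≤ v) (hq0 : 0 ≤ q) (hq : q ≤ 2) :
    (u + v) ^ q ≤ 4 * (u ^ q + v ^ q) := by
  have hmax : 0 ≤ max u v := hu.trans (le_max_left _ _)
  calc (u + v) ^ q ≤ (2 * max u v) ^ q := by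
        gcongr
        linarith [le_max_left u v, le_max_right u v]
    _ = 2 ^ q * max u v ^ q := Real.mul_rpow zero_le_two hmax
    _ ≤ 2 ^ (2 : ℝ) * max u v ^ q := by
        gcongr
        exact one_le_two
    _ ≤ 4 * (u ^ q + v ^ q) := by
        norm_num
        have hu_rpow := Real.rpow_nonneg hu q
        have hv_rpow := Real.rpow_nonneg hv q
        rcases max_choice u v with hmax | hmax <;> rw [hmax] <;> linarith

lemma integral_abs_sq_mul_eq_mass {n : ℕ} (U : Set (E n)) (φ u : E n → ℝ) :
    ∫ x in U, |u x| ^ 2 * φ x = mass U φ u := by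
  simp only [mass, sq_abs, mul_comm]

lemma G_eq {n N : ℕ} (U : Set (E n)) (φ : E n → ℝ) (α : Fin (N + 1) → ℝ)
    (a : Fin (N + 1) → E n → ℝ) (Ψ : ℝ → E n → ℝ) (t : ℝ) :
    G U φ α a Ψ t =
      max (∫ x in U, a (Fin.last N) x) 1 + dualEnergy U a (gradient (Ψ t))
        + sobolevEnergy U α a (gradient (Ψ t))
        + mass U φ (dt Ψ t) ^ ((2 - expo α) / (2 * (1 - expo α))) := by
  rw [G, integral_abs_sq_mul_eq_mass, dualEnergy, sobolevEnergy]

namespace Setting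

variable {n N : ℕ} {U : Set (E n)} {φ : E n → ℝ} {α : Fin (N + 1) → ℝ}
  {a : Fin (N + 1) → E n → ℝ} (S : Setting U φ α a)
include S

section BoundaryTerms

variable (Ψ : ℝ → E n → ℝ) (t : ℝ)

lemma one_add_dualEnergy_add_mass_rpow_le_G :
    1 + dualEnergy U a (gradient (Ψ t))
      + mass U φ (dt Ψ t) ^ ((2 - expo α) / (2 * (1 - expo α))) ≤ G U φ α a Ψ t := by
  rw [G_eq]
  linarith [le_max_right (∫ x in U, a (Fin.last N) x) 1, S.sobolevEnergy_nonneg (gradient (Ψ t))]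

lemma mass_rpow_nonneg (u : E n → ℝ) (r : ℝ) : 0 ≤ mass U φ u ^ r :=
  Real.rpow_nonneg (S.mass_nonneg u) r

lemma one_le_G : 1 ≤ G U φ α a Ψ t := by
  linarith [S.one_add_dualEnergy_add_mass_rpow_le_G Ψ t, S.dualEnergy_nonneg (gradient (Ψ t)),
    S.mass_rpow_nonneg (dt Ψ t) ((2 - expo α) / (2 * (1 - expo α)))]

lemma dualEnergy_le_G : dualEnergy U a (gradient (Ψ t)) ≤ G U φ α a Ψ t := by
  linarith [S.one_add_dualEnergy_add_mass_rpow_le_G Ψ t,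
    S.mass_rpow_nonneg (dt Ψ t) ((2 - expo α) / (2 * (1 - expo α)))]

lemma mass_dt_rpow_le_G :
    mass U φ (dt Ψ t) ^ ((2 - expo α) / (2 * (1 - expo α))) ≤ G U φ α a Ψ t := by
  linarith [S.one_add_dualEnergy_add_mass_rpow_le_G Ψ t, S.dualEnergy_nonneg (gradient (Ψ t))]

lemma integral_coeff_last_add_sobolevEnergy_le_G :
    (∫ x in U, a (Fin.last N) x) + sobolevEnergy U α a (gradient (Ψ t)) ≤ G U φ α a Ψ t := by
  rw [G_eq]
  linarith [le_max_left (∫ x in U, a (Fin.last N) x) 1, S.dualEnergy_nonneg (gradient (Ψ t)),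
    S.mass_rpow_nonneg (dt Ψ t) ((2 - expo α) / (2 * (1 - expo α)))]

lemma G1_nonneg : 0 ≤ G1 U a Ψ t := S.dualEnergy_nonneg _

lemma G2_nonneg : 0 ≤ G2 U φ Ψ t :=
  (S.mass_nonneg _).trans_eq (integral_abs_sq_mul_eq_mass U φ _).symm

lemma mass_dt_le_G : mass U φ (dt Ψ t) ≤ G U φ α a Ψ t := by
  have ha := S.expo_mem
  rcases le_total (mass U φ (dt Ψ t)) 1 with hle | hge
  · exact hle.trans (S.one_le_G Ψ t)
  · refine (Real.self_le_rpow_of_one_le hge ?_).trans (S.mass_dt_rpow_le_G Ψ t)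
    rw [le_div_iff₀ (by linarith [ha.2])]
    linarith [ha.1]

end BoundaryTerms

section SobolevEnergy

variable {y z w : E n → E n} (hy : Measurable y)
  (hyE : IntegrableOn (fun x => K α a x ‖y x‖ * ‖y x‖ ^ 2) U)
include hy hyE

lemma integrableOn_sobolevEnergy_density :
    IntegrableOn (fun x => W1 α a x * ‖y x‖ ^ (2 - expo α)) U := by
  refine (hyE.add S.medium.integrable_coeff_last).mono'
    (S.measurable_W1.mul (hy.norm.pow_const _)).aestronglyMeasurable ?_
  filter_upwards [S.ae_isCoeff, S.ae_sobolevEnergy_density_nonneg y] with x hx hnonneg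
  rw [Real.norm_of_nonneg hnonneg]
  exact hx.weight_mul_rpow_le (norm_nonneg _)

lemma sobolevEnergy_le :
    sobolevEnergy U α a y ≤ energy U α a y + ∫ x in U, a (Fin.last N) x := by
  have hlast := S.medium.integrable_coeff_last
  rw [energy, ← integral_add hyE hlast]
  exact integral_mono_ae (S.integrableOn_sobolevEnergy_density hy hyE) (hyE.add hlast)
    (S.ae_isCoeff.mono fun x hx => hx.weight_mul_rpow_le (norm_nonneg _))

lemma sobolevEnergy_sub_le (hzW : IntegrableOn (fun x => W1 α a x * ‖z x‖ ^ (2 - expo α)) U)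
    (hw : ∀ᵐ x ∂(volume.restrict U), w x = y x - z x) :
    sobolevEnergy U α a w ≤
      4 * (energy U α a y + (∫ x in U, a (Fin.last N) x) + sobolevEnergy U α a z) := by
  have hyW := S.integrableOn_sobolevEnergy_density hy hyE
  have ha := S.expo_mem
  calc sobolevEnergy U α a w
      ≤ ∫ x in U, 4 * (W1 α a x * ‖y x‖ ^ (2 - expo α) + W1 α a x * ‖z x‖ ^ (2 - expo α)) := by
        refine integral_mono_of_nonneg (S.ae_sobolevEnergy_density_nonneg w)
          ((hyW.add hzW).const_mul 4) ?_
        filter_upwards [S.ae_isCoeff, hw] with x hx hwx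
        have hW : 0 < W1 α a x := hx.weight_pos
        have hnorm : ‖w x‖ ^ (2 - expo α) ≤ (‖y x‖ + ‖z x‖) ^ (2 - expo α) :=
          Real.rpow_le_rpow (norm_nonneg _) (hwx ▸ norm_sub_le _ _) (by linarith [ha.2])
        have hadd := add_rpow_le_four_mul (norm_nonneg (y x)) (norm_nonneg (z x))
          (show 0 ≤ 2 - expo α by linarith [ha.2]) (by linarith [ha.1])
        linarith [mul_le_mul_of_nonneg_left (hnorm.trans hadd) hW.le]
    _ = 4 * (sobolevEnergy U α a y + sobolevEnergy U α a z) := by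
        rw [integral_const_mul, integral_add hyW hzW, sobolevEnergy, sobolevEnergy]
    _ ≤ _ := by linarith [S.sobolevEnergy_le hy hyE]

end SobolevEnergy

lemma sobolevEnergy_gradient_sub_le {p : E n → ℝ} {Ψ : ℝ → E n → ℝ} {t : ℝ}
    (hΨ : IsBoundaryData U φ α a Ψ) (ht : 0 < t) (hp : LocallyLipschitzOn U p)
    (hpE : IntegrableOn (fun x => K α a x ‖gradient p x‖ * ‖gradient p x‖ ^ 2) U) :
    sobolevEnergy U α a (gradient (p - Ψ t)) ≤
      4 * (energy U α a (gradient p) + G U φ α a Ψ t) := by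
  have hsub := S.sobolevEnergy_sub_le (measurable_gradient p) hpE (hΨ.integrable_grad_W1 t ht)
    (ae_gradient_sub S.isOpen hp (hΨ.regular.lip t ht))
  linarith [S.integral_coeff_last_add_sobolevEnergy_le_G Ψ t]

end Setting

/-! ### The energy inequality -/

lemma IsSolution.integral_mul_sub_eq {n N : ℕ} {U : Set (E n)} {φ : E n → ℝ}
    {α : Fin (N + 1) → ℝ} {a : Fin (N + 1) → E n → ℝ} {p Ψ : ℝ → E n → ℝ}
    (hp : IsSolution U φ α a p Ψ) (hU : IsOpen U) {t : ℝ} (ht : 0 < t) {v w : E n → ℝ}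
    (hv : ContinuousOn v (closure U)) (hw : ContinuousOn w (closure U))
    (hvLip : LocallyLipschitzOn U v) (hwLip : LocallyLipschitzOn U w)
    (hvw : ∀ x ∈ frontier U, v x = w x)
    (hvInt : IntegrableOn
      (fun x => K α a x ‖gradient (p t) x‖ * inner ℝ (gradient (p t) x) (gradient v x)) U)
    (hwInt : IntegrableOn
      (fun x => K α a x ‖gradient (p t) x‖ * inner ℝ (gradient (p t) x) (gradient w x)) U) :
    ∫ x in U, φ x * (dt p t x * (v x - w x)) =
      (∫ x in U, K α a x ‖gradient (p t) x‖ * inner ℝ (gradient (p t) x) (gradient w x)) -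
        ∫ x in U, K α a x ‖gradient (p t) x‖ * inner ℝ (gradient (p t) x) (gradient v x) := by
  have hgrad : (fun x => K α a x ‖gradient (p t) x‖ *
        inner ℝ (gradient (p t) x) (gradient (v - w) x)) =ᵐ[volume.restrict U]
      fun x => K α a x ‖gradient (p t) x‖ * inner ℝ (gradient (p t) x) (gradient v x) -
        K α a x ‖gradient (p t) x‖ * inner ℝ (gradient (p t) x) (gradient w x) := by
    filter_upwards [ae_gradient_sub hU hvLip hwLip] with x hx
    rw [hx, inner_sub_right, mul_sub]
  have hweak := hp.weak t ht (v - w) (hv.sub hw) (hvLip.sub hwLip)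
    (fun x hx => sub_eq_zero.2 (hvw x hx)) ((hvInt.sub hwInt).congr hgrad.symm)
  rw [integral_congr_ae hgrad, integral_sub hvInt hwInt, neg_sub] at hweak
  simpa only [Pi.sub_apply, mul_assoc] using hweak

/-- The coefficient of the damping term `(∫ φ |p - Ψ|²)^((2-a)/2)` in the energy inequality. -/
def dampingConst (A cP : ℝ) : ℝ := 1 / (16 * cP ^ (2 - A))

/-- The constant of Young's inequality for the product of `(∫ φ Ψ_t²)^(1/2)` and the right-hand
side of the Poincaré-Sobolev inequality. -/
def youngConst (A cP : ℝ) : ℝ := 16 ^ (1 / (1 - A)) * (2 * cP) ^ ((2 - A) / (1 - A))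

/-- The coefficient of `G[Ψ]` in the energy inequality. -/
def forcingConst (A cP : ℝ) : ℝ := 3 / 2 + youngConst A cP

lemma two_mul_rpow_half_mul_rpow_le {A cP m X : ℝ} (hA : A < 1) (hcP : 0 < cP) (hm : 0 ≤ m)
    (hX : 0 ≤ X) :
    2 * cP * m ^ (1 / 2 : ℝ) * X ^ (1 / (2 - A)) ≤
      1 / 16 * X + youngConst A cP * m ^ ((2 - A) / (2 * (1 - A))) := by
  have hA1 : 1 - A ≠ 0 := by linarith
  have hyoung := mul_rpow_le_add (b := 2 * cP * m ^ (1 / 2 : ℝ)) (q := 2 - A) (ε := 1 / 16)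
    (by positivity) hX (by linarith) (by norm_num)
  have hpow : (2 * cP * m ^ (1 / 2 : ℝ)) ^ ((2 - A) / (1 - A)) =
      (2 * cP) ^ ((2 - A) / (1 - A)) * m ^ ((2 - A) / (2 * (1 - A))) := by
    rw [Real.mul_rpow (by positivity) (by positivity), ← Real.rpow_mul hm]
    congr 2
    field_simp
  rwa [show 2 - A - 1 = 1 - A by ring, hpow, one_div_one_div, ← mul_assoc] at hyoung

namespace Setting

variable {n N : ℕ} {U : Set (E n)} {φ : E n → ℝ} {α : Fin (N + 1) → ℝ}
  {a : Fin (N + 1) → E n → ℝ} (S : Setting U φ α a) {p Ψ : ℝ → E n → ℝ}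
  (hΨ : IsBoundaryData U φ α a Ψ) (hp : IsSolution U φ α a p Ψ) {t : ℝ} (ht : 0 < t)
include S

section

variable {cP : ℝ} (hcP : 0 < cP) {u : E n → ℝ} (hPS : PoincareSobolev U φ α a cP u)
include hcP hPS

lemma dampingConst_mul_mass_rpow_le {X : ℝ}
    (hX : sobolevEnergy U α a (gradient u) ≤ 4 * X) :
    dampingConst (expo α) cP * mass U φ u ^ ((2 - expo α) / 2) ≤ 1 / 4 * X := by
  have ha : 0 < 2 - expo α := by linarith [S.expo_mem.2]
  have hX0 : 0 ≤ 4 * X := (S.sobolevEnergy_nonneg _).trans hX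
  have hpow := Real.rpow_le_rpow (S.mass_rpow_nonneg u _) (S.mass_rpow_half_le hcP hPS hX) ha.le
  rw [← Real.rpow_mul (S.mass_nonneg u), Real.mul_rpow hcP.le (by positivity),
    ← Real.rpow_mul hX0, one_div_mul_cancel ha.ne', Real.rpow_one, one_div_mul_eq_div] at hpow
  rw [dampingConst, one_div_mul_eq_div, div_le_iff₀ (by positivity)]
  linarith

lemma neg_two_mul_integral_porosity_mul_le {v : E n → ℝ} (hu : ContinuousOn u (closure U))
    (hv : ContinuousOn v (closure U)) :
    -(2 * ∫ x in U, φ x * (u x * v x)) ≤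
      1 / 16 * sobolevEnergy U α a (gradient u)
        + youngConst (expo α) cP * mass U φ v ^ ((2 - expo α) / (2 * (1 - expo α))) := by
  refine le_trans ?_ (two_mul_rpow_half_mul_rpow_le S.expo_mem.2 hcP (S.mass_nonneg v)
    (S.sobolevEnergy_nonneg _))
  have hcauchy := neg_le_of_abs_le (S.abs_integral_porosity_mul_le hu hv)
  have hpoincare := mul_le_mul_of_nonneg_right (S.mass_rpow_half_le hcP hPS le_rfl)
    (S.mass_rpow_nonneg v (1 / 2))
  linarith

end

include hΨ hp ht

lemma integral_porosity_mul_sub_mul_dt_sub_eq :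
    ∫ x in U, φ x * ((p - Ψ) t x * dt (p - Ψ) t x) =
      (∫ x in U, K α a x ‖gradient (p t) x‖ *
          inner ℝ (gradient (p t) x) (gradient (Ψ t) x))
        - energy U α a (gradient (p t)) - ∫ x in U, φ x * ((p - Ψ) t x * dt Ψ t x) := by
  have hp_time := hp.regular.timeRegular
  have hΨ_time := hΨ.regular.timeRegular
  have hdiff := (hp_time.sub hΨ_time).continuousOn ht
  have hself : (fun x => K α a x ‖gradient (p t) x‖ *
        inner ℝ (gradient (p t) x) (gradient (p t) x)) =
      fun x => K α a x ‖gradient (p t) x‖ * ‖gradient (p t) x‖ ^ 2 := by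
    simp only [real_inner_self_eq_norm_sq]
  have htest := hp.integral_mul_sub_eq S.isOpen ht (hp_time.continuousOn ht)
    (hΨ_time.continuousOn ht) (hp.regular.lip t ht) (hΨ.regular.lip t ht) (hp.boundary t ht)
    (by rw [hself]; exact hp.energy t ht)
    (S.integrableOn_flux_inner (measurable_gradient _) (measurable_gradient _) (hp.energy t ht)
      (hΨ.integrable_grad t ht))
  rw [hself] at htest
  rw [energy, ← htest]
  refine Eq.trans ?_ (integral_sub
    (S.integrableOn_porosity_mul ((hp_time.continuousOn_dt ht).mul hdiff))
    (S.integrableOn_porosity_mul (hdiff.mul (hΨ_time.continuousOn_dt ht))))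
  refine setIntegral_congr_fun S.isOpen.measurableSet fun x hx => ?_
  simp only [hp_time.dt_sub hΨ_time ht (subset_closure hx), Pi.sub_apply]
  ring

lemma energy_inequality {cP : ℝ} (hcP : 0 < cP)
    (hPS : PoincareSobolev U φ α a cP (p t - Ψ t)) :
    2 * ∫ x in U, φ x * ((p - Ψ) t x * dt (p - Ψ) t x) ≤
      -(dampingConst (expo α) cP * mass U φ ((p - Ψ) t) ^ ((2 - expo α) / 2))
        - 1 / 2 * energy U α a (gradient (p t))
        + forcingConst (expo α) cP * G U φ α a Ψ t := by
  have hsobolev := S.sobolevEnergy_gradient_sub_le hΨ ht (hp.regular.lip t ht) (hp.energy t ht)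
  have hdamping := S.dampingConst_mul_mass_rpow_le hcP hPS hsobolev
  have hflux := S.two_mul_integral_flux_inner_le (measurable_gradient _) (measurable_gradient _)
    (hp.energy t ht) (hΨ.integrable_grad t ht)
  have hforcing := S.neg_two_mul_integral_porosity_mul_le hcP hPS
    ((hp.regular.timeRegular.sub hΨ.regular.timeRegular).continuousOn ht)
    (hΨ.regular.timeRegular.continuousOn_dt ht)
  have hyoung : youngConst (expo α) cP *
      mass U φ (dt Ψ t) ^ ((2 - expo α) / (2 * (1 - expo α))) ≤
      youngConst (expo α) cP * G U φ α a Ψ t :=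
    mul_le_mul_of_nonneg_left (S.mass_dt_rpow_le_G Ψ t)
      (mul_nonneg (by positivity) (by positivity))
  rw [S.integral_porosity_mul_sub_mul_dt_sub_eq hΨ hp ht, forcingConst]
  change _ ≤ -(_ * mass U φ (p t - Ψ t) ^ _) - _ + _
  change -(2 * ∫ x in U, φ x * ((p - Ψ) t x * dt Ψ t x)) ≤ _ at hforcing
  linarith [S.dualEnergy_le_G Ψ t]

/-! ### The inequality for the time derivative of the potential -/

omit hΨ in
lemma integrableOn_flux_inner_gradient_dt :
    IntegrableOn (fun x => K α a x ‖gradient (p t) x‖ *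
      inner ℝ (gradient (p t) x) (gradient (dt p t) x)) U := by
  obtain ⟨ε, hε, b, hb, hle⟩ := hp.energy_dt t ht
  exact S.integrableOn_flux_inner_of_dominated (y := fun s => gradient (p s))
    (y' := fun s => gradient (dt p s)) (fun _ => measurable_gradient _) (measurable_gradient _) hb
    (hle.mono fun x hx => hx t ⟨by linarith, by linarith⟩)

omit hΨ in
lemma hasDerivAt_integral_potential_gradient :
    HasDerivAt (fun s => ∫ x in U, potential α (fun j => a j x) ‖gradient (p s) x‖)
      (2 * ∫ x in U, K α a x ‖gradient (p t) x‖ *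
        inner ℝ (gradient (p t) x) (gradient (dt p t) x)) t := by
  obtain ⟨ε, hε, b, hb, hle⟩ := hp.energy_dt t ht
  exact S.hasDerivAt_integral_potential (y := fun s => gradient (p s))
    (y' := fun s => gradient (dt p s)) (fun _ => measurable_gradient _) (measurable_gradient _) hε
    ht (hp.energy t ht) hb hle hp.grad_dt

omit hΨ hp ht in
lemma neg_two_mul_integral_porosity_mul_sub_le {u v : E n → ℝ} (hu : ContinuousOn u (closure U))
    (hv : ContinuousOn v (closure U)) :
    -(2 * ∫ x in U, φ x * (u x * (u x - v x))) ≤ mass U φ v := by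
  rw [← integral_const_mul, ← integral_neg]
  refine integral_mono_ae ((S.integrableOn_porosity_mul (hu.mul (hu.sub hv))).const_mul 2).neg
    (S.integrableOn_porosity_mul_sq hv) ?_
  filter_upwards [S.ae_porosity_mem] with x hx
  linarith [mul_nonneg hx.1.le (sq_nonneg (u x - v x)), mul_nonneg hx.1.le (sq_nonneg (u x))]

lemma potential_inequality :
    2 * ∫ x in U, K α a x ‖gradient (p t) x‖ *
        inner ℝ (gradient (p t) x) (gradient (dt p t) x) ≤
      energy U α a (gradient (p t)) + (G U φ α a Ψ t + G1 U a Ψ t) := by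
  have hp_dt := hp.regular.timeRegular.continuousOn_dt ht
  have hΨ_dt := hΨ.regular.timeRegular.continuousOn_dt ht
  have hboundary : ∀ x ∈ frontier U, dt p t x = dt Ψ t x := fun x hx => by
    refine EventuallyEq.deriv_eq ?_
    filter_upwards [lt_mem_nhds ht] with s hs
    exact hp.boundary s hs x hx
  have htest := hp.integral_mul_sub_eq S.isOpen ht hp_dt hΨ_dt (hp.regular.lip_dt t ht)
    (hΨ.regular.lip_dt t ht) hboundary (S.integrableOn_flux_inner_gradient_dt hp ht)
    (S.integrableOn_flux_inner (measurable_gradient _) (measurable_gradient _) (hp.energy t ht)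
      (hΨ.integrable_grad_dt t ht))
  have hflux := S.two_mul_integral_flux_inner_le (measurable_gradient _) (measurable_gradient _)
    (hp.energy t ht) (hΨ.integrable_grad_dt t ht)
  change _ ≤ _ + G1 U a Ψ t at hflux
  linarith [S.neg_two_mul_integral_porosity_mul_sub_le hp_dt hΨ_dt, S.mass_dt_le_G Ψ t]

end Setting

/-! ### The difference of two solutions -/

lemma norm_sub_sq_le_two_mul {F : Type*} [SeminormedAddCommGroup F] (y z : F) :
    ‖y - z‖ ^ 2 ≤ 2 * (‖y‖ ^ 2 + ‖z‖ ^ 2) :=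
  (pow_le_pow_left₀ (norm_nonneg _) (norm_sub_le y z) 2).trans (add_sq_le (a := ‖y‖) (b := ‖z‖))

namespace IsCoeff

variable {N : ℕ} {α c : Fin (N + 1) → ℝ} (h : IsCoeff α c)
include h

lemma cond_max_mul_max_sq_le_add (ξ η : ℝ) :
    cond α c (max ξ η) * max ξ η ^ 2 ≤ cond α c ξ * ξ ^ 2 + cond α c η * η ^ 2 := by
  have hξ := mul_nonneg (h.cond_pos ξ).le (sq_nonneg ξ)
  have hη := mul_nonneg (h.cond_pos η).le (sq_nonneg η)
  rcases max_choice ξ η with hmax | hmax <;> rw [hmax] <;> linarith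

variable {F : Type*} [NormedAddCommGroup F]

lemma cond_max_mul_norm_sub_sub_sq_le (y z w : F) :
    cond α c (max ‖y‖ ‖z‖) * ‖y - z - w‖ ^ 2 ≤
      4 * (cond α c ‖y‖ * ‖y‖ ^ 2 + cond α c ‖z‖ * ‖z‖ ^ 2 + (c 0)⁻¹ * ‖w‖ ^ 2) := by
  have hnorm : ‖y - z - w‖ ^ 2 ≤ 4 * (‖y‖ ^ 2 + ‖z‖ ^ 2 + ‖w‖ ^ 2) := by
    linarith [norm_sub_sq_le_two_mul (y - z) w, norm_sub_sq_le_two_mul y z, sq_nonneg ‖w‖]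
  have hcond := mul_le_mul_of_nonneg_left hnorm (h.cond_pos (max ‖y‖ ‖z‖)).le
  have hy := mul_le_mul_of_nonneg_right (h.antitone_cond (le_max_left ‖y‖ ‖z‖)) (sq_nonneg ‖y‖)
  have hz := mul_le_mul_of_nonneg_right (h.antitone_cond (le_max_right ‖y‖ ‖z‖)) (sq_nonneg ‖z‖)
  have hw := mul_le_mul_of_nonneg_right (h.cond_le (max ‖y‖ ‖z‖)) (sq_nonneg ‖w‖)
  linarith

lemma cond_max_mul_norm_sub_sub_sq_le_two_mul_inner_sub_inner [InnerProductSpace ℝ F]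
    (y z w : F) :
    (1 - expo α) * (cond α c (max ‖y‖ ‖z‖) * ‖y - z - w‖ ^ 2) ≤
      2 * (cond α c ‖y‖ * inner ℝ y (y - z - w) - cond α c ‖z‖ * inner ℝ z (y - z - w))
        + 2 * ((c 0)⁻¹ * ‖w‖ ^ 2)
        + 2 * (cond α c ‖y‖ * (‖y‖ * ‖w‖) + cond α c ‖z‖ * (‖z‖ * ‖w‖)) := by
  have hmonotone := h.one_sub_expo_mul_cond_max_le_inner y z
  have hk := h.cond_pos (max ‖y‖ ‖z‖)
  have hnorm := mul_le_mul_of_nonneg_left (norm_sub_sq_le_two_mul (y - z) w)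
    (mul_nonneg (sub_nonneg.2 h.expo_lt_one.le) hk.le)
  have hw : (1 - expo α) * cond α c (max ‖y‖ ‖z‖) * ‖w‖ ^ 2 ≤ (c 0)⁻¹ * ‖w‖ ^ 2 :=
    mul_le_mul_of_nonneg_right
      (by nlinarith [h.expo_pos, h.cond_le (max ‖y‖ ‖z‖)]) (sq_nonneg _)
  have hyw := mul_le_mul_of_nonneg_left (real_inner_le_norm y w) (h.cond_pos ‖y‖).le
  have hzw := mul_le_mul_of_nonneg_left (neg_le_of_abs_le (abs_real_inner_le_norm z w))
    (h.cond_pos ‖z‖).le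
  rw [inner_sub_left, real_inner_smul_left, real_inner_smul_left] at hmonotone
  rw [inner_sub_right y (y - z) w, inner_sub_right z (y - z) w]
  linarith

end IsCoeff

/-- The integral `∫_U K(x, max(|y|, |z|)) |v|² dx`, which the monotonicity of the flux bounds when
`v = y - z`. -/
def pairEnergy {n N : ℕ} (U : Set (E n)) (α : Fin (N + 1) → ℝ) (a : Fin (N + 1) → E n → ℝ)
    (y z v : E n → E n) : ℝ :=
  ∫ x in U, K α a x (max ‖y x‖ ‖z x‖) * ‖v x‖ ^ 2

lemma le_sq_mul_rpow_mul_of_rpow_half_le {A c m Z L : ℝ} (hA : A ≠ 2) (hm : 0 ≤ m)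
    (hZ : 0 ≤ Z) (hL : 0 ≤ L)
    (h : m ^ (1 / 2 : ℝ) ≤ c * (Z ^ ((2 - A) / 2) * L ^ (A / 2)) ^ (1 / (2 - A))) :
    m ≤ c ^ 2 * L ^ (A / (2 - A)) * Z := by
  have hA2 : 2 - A ≠ 0 := sub_ne_zero.2 hA.symm
  have hexp : (Z ^ ((2 - A) / 2) * L ^ (A / 2)) ^ (1 / (2 - A)) =
      √Z * √(L ^ (A / (2 - A))) := by
    rw [Real.mul_rpow (by positivity) (by positivity), ← Real.rpow_mul hZ, ← Real.rpow_mul hL,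
      Real.sqrt_eq_rpow, Real.sqrt_eq_rpow, ← Real.rpow_mul hL]
    congr 2 <;> field_simp
  rw [hexp, ← Real.sqrt_eq_rpow] at h
  have hsq := pow_le_pow_left₀ (Real.sqrt_nonneg m) h 2
  rw [Real.sq_sqrt hm, mul_pow, mul_pow, Real.sq_sqrt hZ, Real.sq_sqrt (by positivity)] at hsq
  linarith

namespace Setting

variable {n N : ℕ} {U : Set (E n)} {φ : E n → ℝ} {α : Fin (N + 1) → ℝ}
  {a : Fin (N + 1) → E n → ℝ} (S : Setting U φ α a)
include S

lemma ae_pairEnergy_density_nonneg (y z v : E n → E n) :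
    ∀ᵐ x ∂(volume.restrict U), 0 ≤ K α a x (max ‖y x‖ ‖z x‖) * ‖v x‖ ^ 2 :=
  S.ae_isCoeff.mono fun _ hx => mul_nonneg (hx.cond_pos _).le (sq_nonneg _)

lemma pairEnergy_nonneg (y z v : E n → E n) : 0 ≤ pairEnergy U α a y z v :=
  integral_nonneg_of_ae (S.ae_pairEnergy_density_nonneg y z v)

lemma integral_coeff_last_nonneg : 0 ≤ ∫ x in U, a (Fin.last N) x :=
  integral_nonneg_of_ae (S.ae_isCoeff.mono fun _ hx => hx.coeff_last_pos.le)

section PairEnergy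

variable {y z w v : E n → E n}

lemma integrableOn_dualEnergy_density_sub (hw : Measurable w)
    (hyD : IntegrableOn (fun x => (a 0 x)⁻¹ * ‖y x‖ ^ 2) U)
    (hzD : IntegrableOn (fun x => (a 0 x)⁻¹ * ‖z x‖ ^ 2) U)
    (hwyz : ∀ᵐ x ∂(volume.restrict U), w x = y x - z x) :
    IntegrableOn (fun x => (a 0 x)⁻¹ * ‖w x‖ ^ 2) U := by
  refine ((hyD.add hzD).const_mul 2).mono'
    ((S.medium.measurable_coeff 0).inv.mul (hw.norm.pow_const 2)).aestronglyMeasurable ?_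
  filter_upwards [S.ae_isCoeff, hwyz] with x hx hwx
  have ha0 : 0 < a 0 x := hx.coeff_zero_pos
  rw [Real.norm_of_nonneg (by positivity), hwx]
  simp only [Pi.add_apply]
  linarith [mul_le_mul_of_nonneg_left (norm_sub_sq_le_two_mul (y x) (z x)) (inv_nonneg.2 ha0.le)]

variable (hyE : IntegrableOn (fun x => K α a x ‖y x‖ * ‖y x‖ ^ 2) U)
  (hzE : IntegrableOn (fun x => K α a x ‖z x‖ * ‖z x‖ ^ 2) U)
include hyE hzE

lemma sobolevEnergy_le_pairEnergy_rpow_mul (hv : Measurable v)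
    (hI : IntegrableOn (fun x => K α a x (max ‖y x‖ ‖z x‖) * ‖v x‖ ^ 2) U) :
    sobolevEnergy U α a v ≤ pairEnergy U α a y z v ^ ((2 - expo α) / 2) *
      (energy U α a y + energy U α a z + ∫ x in U, a (Fin.last N) x) ^ (expo α / 2) := by
  obtain ⟨ha0, ha1⟩ := S.expo_mem
  have hlast := S.medium.integrable_coeff_last
  have hdual : 1 - (2 - expo α) / 2 = expo α / 2 := by ring
  have hsum : IntegrableOn (fun x =>
      K α a x ‖y x‖ * ‖y x‖ ^ 2 + K α a x ‖z x‖ * ‖z x‖ ^ 2) U := hyE.add hzE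
  rw [energy, energy, ← integral_add hyE hzE, ← integral_add hsum hlast, ← hdual]
  have hsum_nonneg : ∀ᵐ x ∂(volume.restrict U), 0 ≤
      K α a x ‖y x‖ * ‖y x‖ ^ 2 + K α a x ‖z x‖ * ‖z x‖ ^ 2 + a (Fin.last N) x := by
    filter_upwards [S.ae_energy_density_nonneg y, S.ae_energy_density_nonneg z, S.ae_isCoeff]
      with x hy hz hx
    exact add_nonneg (add_nonneg hy hz) hx.coeff_last_pos.le
  refine integral_le_rpow_mul_rpow (by linarith) (by linarith)
    (S.measurable_W1.mul (hv.norm.pow_const _)).aestronglyMeasurable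
    (S.ae_sobolevEnergy_density_nonneg v) hI (hsum.add hlast)
    (S.ae_pairEnergy_density_nonneg y z v) hsum_nonneg ?_
  filter_upwards [S.ae_isCoeff] with x hx
  have hmax : 0 ≤ max ‖y x‖ ‖z x‖ := (norm_nonneg _).trans (le_max_left _ _)
  have hk := hx.cond_pos (max ‖y x‖ ‖z x‖)
  have hlast_pos : 0 < a (Fin.last N) x := hx.coeff_last_pos
  rw [hdual]
  exact (hx.weight_mul_rpow_le_mul_rpow hmax (norm_nonneg (v x))).trans
    (mul_le_mul_of_nonneg_left (Real.rpow_le_rpow (by positivity)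
      (add_le_add_left (hx.cond_max_mul_max_sq_le_add _ _) _) (by linarith))
      (Real.rpow_nonneg (mul_nonneg hk.le (sq_nonneg _)) _))

lemma mass_le_mul_pairEnergy {cP : ℝ} (hcP : 0 < cP) {u : E n → ℝ}
    (hPS : PoincareSobolev U φ α a cP u)
    (hI : IntegrableOn (fun x => K α a x (max ‖y x‖ ‖z x‖) * ‖gradient u x‖ ^ 2) U) :
    mass U φ u ≤ cP ^ 2 *
      (energy U α a y + energy U α a z + ∫ x in U, a (Fin.last N) x) ^ (expo α / (2 - expo α)) *
        pairEnergy U α a y z (gradient u) :=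
  le_sq_mul_rpow_mul_of_rpow_half_le (by linarith [S.expo_mem.2]) (S.mass_nonneg u)
    (S.pairEnergy_nonneg y z _)
    (add_nonneg (add_nonneg (S.energy_nonneg y) (S.energy_nonneg z)) S.integral_coeff_last_nonneg)
    (S.mass_rpow_half_le hcP hPS
      (S.sobolevEnergy_le_pairEnergy_rpow_mul hyE hzE (measurable_gradient u) hI))

variable (hwD : IntegrableOn (fun x => (a 0 x)⁻¹ * ‖w x‖ ^ 2) U)
  (hvyzw : ∀ᵐ x ∂(volume.restrict U), v x = y x - z x - w x) (hy : Measurable y)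
  (hz : Measurable z)
include hwD hvyzw hy hz

lemma integrableOn_pairEnergy_density (hv : Measurable v) :
    IntegrableOn (fun x => K α a x (max ‖y x‖ ‖z x‖) * ‖v x‖ ^ 2) U := by
  refine (((hyE.add hzE).add hwD).const_mul 4).mono'
    ((S.aestronglyMeasurable_K (hy.norm.max hz.norm)).mul
      (hv.norm.pow_const 2).aestronglyMeasurable) ?_
  filter_upwards [S.ae_isCoeff, S.ae_pairEnergy_density_nonneg y z v, hvyzw] with x hx hnonneg hvx
  rw [Real.norm_of_nonneg hnonneg, hvx]
  exact hx.cond_max_mul_norm_sub_sub_sq_le _ _ _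

variable (hw : Measurable w)
include hw

lemma integrableOn_flux_inner_sub_sub {q : E n → E n} (hq : Measurable q)
    (hqE : IntegrableOn (fun x => K α a x ‖q x‖ * ‖q x‖ ^ 2) U) :
    IntegrableOn (fun x => K α a x ‖q x‖ * inner ℝ (q x) (v x)) U := by
  refine (((S.integrableOn_flux_inner_of_energy hq hy hqE hyE).sub
    (S.integrableOn_flux_inner_of_energy hq hz hqE hzE)).sub
    (S.integrableOn_flux_inner hq hw hqE hwD)).congr ?_
  filter_upwards [hvyzw] with x hvx
  simp only [Pi.sub_apply, hvx, inner_sub_right, mul_sub]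

lemma one_sub_expo_mul_pairEnergy_le (hv : Measurable v) :
    (1 - expo α) * pairEnergy U α a y z v ≤
      2 * ((∫ x in U, K α a x ‖y x‖ * inner ℝ (y x) (v x)) -
          ∫ x in U, K α a x ‖z x‖ * inner ℝ (z x) (v x))
        + 2 * dualEnergy U a w
        + 2 * ((energy U α a y ^ (1 / 2 : ℝ) + energy U α a z ^ (1 / 2 : ℝ)) *
          dualEnergy U a w ^ (1 / 2 : ℝ)) := by
  have hpair := S.integrableOn_pairEnergy_density hyE hzE hwD hvyzw hy hz hv
  have hflux_y := S.integrableOn_flux_inner_sub_sub hyE hzE hwD hvyzw hy hz hw hy hyE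
  have hflux_z := S.integrableOn_flux_inner_sub_sub hyE hzE hwD hvyzw hy hz hw hz hzE
  have hnorm_y := S.integrableOn_flux_norm hy hw hyE hwD
  have hnorm_z := S.integrableOn_flux_norm hz hw hzE hwD
  have hflux : IntegrableOn (fun x =>
      2 * (K α a x ‖y x‖ * inner ℝ (y x) (v x) - K α a x ‖z x‖ * inner ℝ (z x) (v x))) U :=
    (hflux_y.sub hflux_z).const_mul 2
  have hnorm : IntegrableOn (fun x =>
      2 * (K α a x ‖y x‖ * (‖y x‖ * ‖w x‖) + K α a x ‖z x‖ * (‖z x‖ * ‖w x‖))) U :=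
    (hnorm_y.add hnorm_z).const_mul 2
  have hflux_dual : IntegrableOn (fun x =>
      2 * (K α a x ‖y x‖ * inner ℝ (y x) (v x) - K α a x ‖z x‖ * inner ℝ (z x) (v x))
        + 2 * ((a 0 x)⁻¹ * ‖w x‖ ^ 2)) U := hflux.add (hwD.const_mul 2)
  have hintegrated := integral_mono_ae (hpair.const_mul (1 - expo α)) (hflux_dual.add hnorm) (by
    filter_upwards [S.ae_isCoeff, hvyzw] with x hx hvx
    simp only [Pi.add_apply, hvx]
    exact hx.cond_max_mul_norm_sub_sub_sq_le_two_mul_inner_sub_inner (y x) (z x) (w x))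
  simp only [Pi.add_apply] at hintegrated
  rw [integral_add hflux_dual hnorm, integral_add hflux (hwD.const_mul 2), integral_const_mul,
    integral_const_mul, integral_const_mul, integral_const_mul, integral_sub hflux_y hflux_z,
    integral_add hnorm_y hnorm_z] at hintegrated
  rw [pairEnergy, dualEnergy]
  have hy_flux := S.integral_flux_norm_le hy hw hyE hwD
  have hz_flux := S.integral_flux_norm_le hz hw hzE hwD
  rw [dualEnergy] at hy_flux hz_flux
  linarith

end PairEnergy

end Setting

lemma D_eq {n N : ℕ} (U : Set (E n)) (φ : E n → ℝ) (a : Fin (N + 1) → E n → ℝ)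
    (Φ : ℝ → E n → ℝ) (t : ℝ) :
    D U φ a Φ t = dualEnergy U a (gradient (Φ t)) + dualEnergy U a (gradient (Φ t)) ^ (1 / 2 : ℝ)
      + mass U φ (dt Φ t) ^ (1 / 2 : ℝ) := by
  rw [D, integral_abs_sq_mul_eq_mass, dualEnergy]

/-- The function `P̄ = (p₁ - Ψ₁) - (p₂ - Ψ₂)`, which vanishes on the boundary. -/
abbrev pressureGap {n : ℕ} (p₁ p₂ Ψ₁ Ψ₂ : ℝ → E n → ℝ) : ℝ → E n → ℝ :=
  (p₁ - Ψ₁) - (p₂ - Ψ₂)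

lemma two_mul_add_le_four_mul_rpow_half {Λ d e₁ e₂ m μ : ℝ} (hΛ : 1 ≤ Λ) (hd : 0 ≤ d)
    (he₁Λ : e₁ ≤ Λ) (he₂Λ : e₂ ≤ Λ) (hmΛ : m ≤ Λ) :
    2 * d + 2 * ((e₁ ^ (1 / 2 : ℝ) + e₂ ^ (1 / 2 : ℝ)) * d ^ (1 / 2 : ℝ))
        + 2 * (m ^ (1 / 2 : ℝ) * μ ^ (1 / 2 : ℝ)) ≤
      4 * (Λ ^ (1 / 2 : ℝ) * (d + d ^ (1 / 2 : ℝ) + μ ^ (1 / 2 : ℝ))) := by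
  simp only [← Real.sqrt_eq_rpow]
  have hd' : d ≤ √Λ * d := le_mul_of_one_le_left hd (Real.one_le_sqrt.2 hΛ)
  have he₁' := mul_le_mul_of_nonneg_right (Real.sqrt_le_sqrt he₁Λ) (Real.sqrt_nonneg d)
  have he₂' := mul_le_mul_of_nonneg_right (Real.sqrt_le_sqrt he₂Λ) (Real.sqrt_nonneg d)
  have hm' := mul_le_mul_of_nonneg_right (Real.sqrt_le_sqrt hmΛ) (Real.sqrt_nonneg μ)
  linarith [mul_nonneg (Real.sqrt_nonneg Λ) (Real.sqrt_nonneg μ)]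

namespace Setting

variable {n N : ℕ} {U : Set (E n)} {φ : E n → ℝ} {α : Fin (N + 1) → ℝ}
  {a : Fin (N + 1) → E n → ℝ} (S : Setting U φ α a) {p₁ p₂ Ψ₁ Ψ₂ : ℝ → E n → ℝ}
  (hΨ₁ : IsBoundaryData U φ α a Ψ₁) (hΨ₂ : IsBoundaryData U φ α a Ψ₂)
  (hp₁ : IsSolution U φ α a p₁ Ψ₁) (hp₂ : IsSolution U φ α a p₂ Ψ₂) {t : ℝ} (ht : 0 < t)
include S hΨ₁ hΨ₂ ht

lemma integrableOn_dualEnergy_density_gradient_sub :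
    IntegrableOn (fun x => (a 0 x)⁻¹ * ‖gradient ((Ψ₁ - Ψ₂) t) x‖ ^ 2) U :=
  S.integrableOn_dualEnergy_density_sub (measurable_gradient _) (hΨ₁.integrable_grad t ht)
    (hΨ₂.integrable_grad t ht)
    (ae_gradient_sub S.isOpen (hΨ₁.regular.lip t ht) (hΨ₂.regular.lip t ht))

include hp₁ hp₂

lemma ae_gradient_pressureGap :
    ∀ᵐ x ∂(volume.restrict U), gradient (pressureGap p₁ p₂ Ψ₁ Ψ₂ t) x =
      gradient (p₁ t) x - gradient (p₂ t) x - gradient ((Ψ₁ - Ψ₂) t) x := by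
  have hp₁_lip := hp₁.regular.lip t ht
  have hp₂_lip := hp₂.regular.lip t ht
  have hΨ₁_lip := hΨ₁.regular.lip t ht
  have hΨ₂_lip := hΨ₂.regular.lip t ht
  filter_upwards [ae_gradient_sub S.isOpen hΨ₁_lip hΨ₂_lip,
    ae_gradient_sub S.isOpen hp₁_lip hΨ₁_lip, ae_gradient_sub S.isOpen hp₂_lip hΨ₂_lip,
    ae_gradient_sub (u := p₁ t - Ψ₁ t) (v := p₂ t - Ψ₂ t) S.isOpen (hp₁_lip.sub hΨ₁_lip)
      (hp₂_lip.sub hΨ₂_lip)] with x hΨ h₁ h₂ hgap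
  change gradient (p₁ t - Ψ₁ t - (p₂ t - Ψ₂ t)) x = _ - _ - gradient (Ψ₁ t - Ψ₂ t) x
  rw [hgap, h₁, h₂, hΨ]
  abel

lemma integrableOn_flux_inner_gradient_pressureGap {q : E n → E n} (hq : Measurable q)
    (hqE : IntegrableOn (fun x => K α a x ‖q x‖ * ‖q x‖ ^ 2) U) :
    IntegrableOn (fun x => K α a x ‖q x‖ *
      inner ℝ (q x) (gradient (pressureGap p₁ p₂ Ψ₁ Ψ₂ t) x)) U :=
  S.integrableOn_flux_inner_sub_sub (hp₁.energy t ht) (hp₂.energy t ht)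
    (S.integrableOn_dualEnergy_density_gradient_sub hΨ₁ hΨ₂ ht)
    (S.ae_gradient_pressureGap hΨ₁ hΨ₂ hp₁ hp₂ ht) (measurable_gradient _)
    (measurable_gradient _) (measurable_gradient _) hq hqE

lemma integral_porosity_mul_pressureGap_mul_dt_eq :
    ∫ x in U, φ x * (pressureGap p₁ p₂ Ψ₁ Ψ₂ t x * dt (pressureGap p₁ p₂ Ψ₁ Ψ₂) t x) =
      (∫ x in U, K α a x ‖gradient (p₂ t) x‖ *
          inner ℝ (gradient (p₂ t) x) (gradient (pressureGap p₁ p₂ Ψ₁ Ψ₂ t) x))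
        - (∫ x in U, K α a x ‖gradient (p₁ t) x‖ *
          inner ℝ (gradient (p₁ t) x) (gradient (pressureGap p₁ p₂ Ψ₁ Ψ₂ t) x))
        - ∫ x in U, φ x * (pressureGap p₁ p₂ Ψ₁ Ψ₂ t x * dt (Ψ₁ - Ψ₂) t x) := by
  have hp₁_time := hp₁.regular.timeRegular
  have hp₂_time := hp₂.regular.timeRegular
  have hΨ₁_time := hΨ₁.regular.timeRegular
  have hΨ₂_time := hΨ₂.regular.timeRegular
  have hgap : ContinuousOn (pressureGap p₁ p₂ Ψ₁ Ψ₂ t) (closure U) :=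
    ((hp₁_time.sub hΨ₁_time).sub (hp₂_time.sub hΨ₂_time)).continuousOn ht
  have hgap_lip : LocallyLipschitzOn U (pressureGap p₁ p₂ Ψ₁ Ψ₂ t) :=
    ((hp₁.regular.lip t ht).sub (hΨ₁.regular.lip t ht)).sub
      ((hp₂.regular.lip t ht).sub (hΨ₂.regular.lip t ht))
  have hgap_boundary : ∀ x ∈ frontier U, pressureGap p₁ p₂ Ψ₁ Ψ₂ t x = 0 := fun x hx => by
    simp only [Pi.sub_apply, hp₁.boundary t ht x hx, hp₂.boundary t ht x hx, sub_self]
  have hweak₁ := hp₁.weak t ht _ hgap hgap_lip hgap_boundary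
    (S.integrableOn_flux_inner_gradient_pressureGap hΨ₁ hΨ₂ hp₁ hp₂ ht (measurable_gradient _)
      (hp₁.energy t ht))
  have hweak₂ := hp₂.weak t ht _ hgap hgap_lip hgap_boundary
    (S.integrableOn_flux_inner_gradient_pressureGap hΨ₁ hΨ₂ hp₁ hp₂ ht (measurable_gradient _)
      (hp₂.energy t ht))
  simp only [mul_assoc] at hweak₁ hweak₂
  have hInt {p Ψ : ℝ → E n → ℝ} (hp : IsSolution U φ α a p Ψ) :
      IntegrableOn (fun x => φ x * (dt p t x * pressureGap p₁ p₂ Ψ₁ Ψ₂ t x)) U :=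
    S.integrableOn_porosity_mul ((hp.regular.timeRegular.continuousOn_dt ht).mul hgap)
  have hint_sub : IntegrableOn (fun x => φ x * (dt p₁ t x * pressureGap p₁ p₂ Ψ₁ Ψ₂ t x)
      - φ x * (dt p₂ t x * pressureGap p₁ p₂ Ψ₁ Ψ₂ t x)) U := (hInt hp₁).sub (hInt hp₂)
  have hIntΦ : IntegrableOn (fun x => φ x * (pressureGap p₁ p₂ Ψ₁ Ψ₂ t x * dt (Ψ₁ - Ψ₂) t x)) U :=
    S.integrableOn_porosity_mul (hgap.mul ((hΨ₁_time.sub hΨ₂_time).continuousOn_dt ht))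
  rw [← neg_sub_neg (∫ x in U, K α a x ‖gradient (p₁ t) x‖ * _), ← hweak₁, ← hweak₂,
    ← integral_sub (hInt hp₁) (hInt hp₂), ← integral_sub hint_sub hIntΦ]
  refine setIntegral_congr_fun S.isOpen.measurableSet fun x hx => ?_
  have hx' := subset_closure hx
  simp only [pressureGap, (hp₁_time.sub hΨ₁_time).dt_sub (hp₂_time.sub hΨ₂_time) ht hx',
    hp₁_time.dt_sub hΨ₁_time ht hx', hp₂_time.dt_sub hΨ₂_time ht hx',
    hΨ₁_time.dt_sub hΨ₂_time ht hx']
  ring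

lemma mul_mass_pressureGap_le_mul_pairEnergy {cP Λ : ℝ} (hcP : 0 < cP) (hΛ : 1 ≤ Λ)
    (hPS : PoincareSobolev U φ α a cP (pressureGap p₁ p₂ Ψ₁ Ψ₂ t))
    (hE : energy U α a (gradient (p₁ t)) + energy U α a (gradient (p₂ t)) +
      ∫ x in U, a (Fin.last N) x ≤ Λ) :
    (1 - expo α) / cP ^ 2 * Λ ^ (-(expo α / (2 - expo α))) *
        mass U φ (pressureGap p₁ p₂ Ψ₁ Ψ₂ t) ≤
      (1 - expo α) * pairEnergy U α a (gradient (p₁ t)) (gradient (p₂ t))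
        (gradient (pressureGap p₁ p₂ Ψ₁ Ψ₂ t)) := by
  obtain ⟨ha0, ha1⟩ := S.expo_mem
  have hΛ0 : 0 < Λ := one_pos.trans_le hΛ
  have hexp : 0 ≤ expo α / (2 - expo α) := div_nonneg ha0.le (by linarith)
  have hpair := S.pairEnergy_nonneg (gradient (p₁ t)) (gradient (p₂ t))
    (gradient (pressureGap p₁ p₂ Ψ₁ Ψ₂ t))
  have hmass : mass U φ (pressureGap p₁ p₂ Ψ₁ Ψ₂ t) ≤ cP ^ 2 * Λ ^ (expo α / (2 - expo α)) *
      pairEnergy U α a (gradient (p₁ t)) (gradient (p₂ t))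
        (gradient (pressureGap p₁ p₂ Ψ₁ Ψ₂ t)) := by
    refine (S.mass_le_mul_pairEnergy (hp₁.energy t ht) (hp₂.energy t ht) hcP hPS
      (S.integrableOn_pairEnergy_density (hp₁.energy t ht) (hp₂.energy t ht)
        (S.integrableOn_dualEnergy_density_gradient_sub hΨ₁ hΨ₂ ht)
        (S.ae_gradient_pressureGap hΨ₁ hΨ₂ hp₁ hp₂ ht) (measurable_gradient _)
        (measurable_gradient _) (measurable_gradient _))).trans ?_
    have := S.energy_nonneg (gradient (p₁ t))
    have := S.energy_nonneg (gradient (p₂ t))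
    have := S.integral_coeff_last_nonneg
    gcongr
  have hfactor : 0 ≤ (1 - expo α) / cP ^ 2 * Λ ^ (-(expo α / (2 - expo α))) :=
    mul_nonneg (div_nonneg (by linarith) (sq_nonneg cP)) (by positivity)
  refine (mul_le_mul_of_nonneg_left hmass hfactor).trans (le_of_eq ?_)
  rw [Real.rpow_neg hΛ0.le]
  field_simp

lemma difference_inequality {cP Λ : ℝ} (hcP : 0 < cP) (hΛ : 1 ≤ Λ)
    (hPS : PoincareSobolev U φ α a cP (pressureGap p₁ p₂ Ψ₁ Ψ₂ t))
    (hE : energy U α a (gradient (p₁ t)) + energy U α a (gradient (p₂ t)) +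
      ∫ x in U, a (Fin.last N) x ≤ Λ)
    (hm : mass U φ (pressureGap p₁ p₂ Ψ₁ Ψ₂ t) ≤ Λ) :
    2 * ∫ x in U, φ x * (pressureGap p₁ p₂ Ψ₁ Ψ₂ t x * dt (pressureGap p₁ p₂ Ψ₁ Ψ₂) t x) ≤
      -((1 - expo α) / cP ^ 2 * Λ ^ (-(expo α / (2 - expo α))) *
          mass U φ (pressureGap p₁ p₂ Ψ₁ Ψ₂ t))
        + 4 * (Λ ^ (1 / 2 : ℝ) * D U φ a (Ψ₁ - Ψ₂) t) := by
  have hdissipation := S.mul_mass_pressureGap_le_mul_pairEnergy hΨ₁ hΨ₂ hp₁ hp₂ ht hcP hΛ hPS hE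
  have hmonotone := S.one_sub_expo_mul_pairEnergy_le (hp₁.energy t ht) (hp₂.energy t ht)
    (S.integrableOn_dualEnergy_density_gradient_sub hΨ₁ hΨ₂ ht)
    (S.ae_gradient_pressureGap hΨ₁ hΨ₂ hp₁ hp₂ ht) (measurable_gradient _)
    (measurable_gradient _) (measurable_gradient _) (measurable_gradient _)
  have hgap := ((hp₁.regular.timeRegular.sub hΨ₁.regular.timeRegular).sub
    (hp₂.regular.timeRegular.sub hΨ₂.regular.timeRegular)).continuousOn ht
  have hcauchy := neg_le_of_abs_le (S.abs_integral_porosity_mul_le hgap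
    ((hΨ₁.regular.timeRegular.sub hΨ₂.regular.timeRegular).continuousOn_dt ht))
  have hE₁ := S.energy_nonneg (gradient (p₁ t))
  have hE₂ := S.energy_nonneg (gradient (p₂ t))
  have hlast := S.integral_coeff_last_nonneg
  have hforcing := two_mul_add_le_four_mul_rpow_half hΛ
    (μ := mass U φ (dt (Ψ₁ - Ψ₂) t)) (S.dualEnergy_nonneg (gradient ((Ψ₁ - Ψ₂) t)))
    (show energy U α a (gradient (p₁ t)) ≤ Λ by linarith)
    (show energy U α a (gradient (p₂ t)) ≤ Λ by linarith) hm
  rw [S.integral_porosity_mul_pressureGap_mul_dt_eq hΨ₁ hΨ₂ hp₁ hp₂ ht, D_eq]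
  linarith

end Setting

/-! ### Energy bounds over a unit window -/

lemma forcingConst_nonneg (A : ℝ) {cP : ℝ} (hcP : 0 < cP) : 0 ≤ forcingConst A cP := by
  unfold forcingConst youngConst
  positivity

lemma dampingConst_pos (A : ℝ) {cP : ℝ} (hcP : 0 < cP) : 0 < dampingConst A cP := by
  unfold dampingConst
  positivity

lemma Icc_sub_one_subset_Ioi_zero {t : ℝ} (ht : 1 < t) : Icc (t - 1) t ⊆ Ioi 0 := fun _ hs =>
  (sub_pos.2 ht).trans_le hs.1

lemma intervalIntegrable_sub_one {f : ℝ → ℝ} (hf : ContinuousOn f (Ioi 0)) {t : ℝ} (ht : 1 < t) :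
    IntervalIntegrable f volume (t - 1) t :=
  (hf.mono (Icc_sub_one_subset_Ioi_zero ht)).intervalIntegrable_of_Icc (sub_one_lt t).le

/-- Bounds over the unit window `[t - 1, t]` for the mass of `p - Ψ` and the boundary functionals
`G[Ψ]` and `G₁[Ψ]`; they are what it takes to bound the energy of `p` at time `t`. -/
structure WindowBound {n N : ℕ} (U : Set (E n)) (φ : E n → ℝ) (α : Fin (N + 1) → ℝ)
    (a : Fin (N + 1) → E n → ℝ) (p Ψ : ℝ → E n → ℝ) (b t : ℝ) : Prop where
  mass_le : ∀ τ ∈ Icc (t - 1) t, mass U φ ((p - Ψ) τ) ≤ b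
  G_le : ∀ τ ∈ Icc (t - 1) t, G U φ α a Ψ τ ≤ b
  integral_G1_le : ∫ τ in (t - 1)..t, G1 U a Ψ τ ≤ b

/-- Under window bounds `b` for two solutions, the sum of their energies, the integral of `a_N` and
the mass of the pressure gap are at most `energyConst * b`. -/
def energyConst (A cP : ℝ) : ℝ := 24 + 16 * forcingConst A cP

/-- The ratio of the forcing constant to the damping constant in the differential inequality for
the mass of the pressure gap, when the window bounds are `C₀ * V`. -/
def limitConst (A cP C₀ : ℝ) : ℝ :=
  4 * (energyConst A cP * C₀) ^ (1 / 2 : ℝ) /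
    ((1 - A) / cP ^ 2 * (energyConst A cP * C₀) ^ (-(A / (2 - A))))

lemma one_le_energyConst (A : ℝ) {cP : ℝ} (hcP : 0 < cP) : 1 ≤ energyConst A cP := by
  unfold energyConst
  linarith [forcingConst_nonneg A hcP]

namespace Setting

variable {n N : ℕ} {U : Set (E n)} {φ : E n → ℝ} {α : Fin (N + 1) → ℝ}
  {a : Fin (N + 1) → E n → ℝ} (S : Setting U φ α a)
include S

section OneSolution

variable {cP : ℝ} (hcP : 0 < cP) {p Ψ : ℝ → E n → ℝ} (hΨ : IsBoundaryData U φ α a Ψ)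
  (hp : IsSolution U φ α a p Ψ) (hPS : ∀ t > 0, PoincareSobolev U φ α a cP (p t - Ψ t))
include hcP hΨ hp hPS

lemma energy_le {t : ℝ} (ht : 1 < t) :
    energy U α a (gradient (p t)) ≤ 8 * mass U φ ((p - Ψ) (t - 1)) +
      ∫ s in (t - 1)..t, ((G U φ α a Ψ s + G1 U a Ψ s) +
        8 * (forcingConst (expo α) cP * G U φ α a Ψ s)) := by
  have hgap := hp.regular.timeRegular.sub hΨ.regular.timeRegular
  have hpotential {s : ℝ} (hs : 0 < s) :=
    S.energy_le_integral_potential (measurable_gradient (p s)) (hp.energy s hs)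
  refine (hpotential (by linarith)).trans (le_add_integral_of_deriv_le
    (J := fun s => ∫ x in U, potential α (fun j => a j x) ‖gradient (p s) x‖)
    (y := fun s => mass U φ ((p - Ψ) s)) (A := fun s => G U φ α a Ψ s + G1 U a Ψ s)
    (B := fun s => forcingConst (expo α) cP * G U φ α a Ψ s) ht
    (fun s hs => S.hasDerivAt_integral_potential_gradient hp hs)
    (fun s hs => S.hasDerivAt_mass hgap hs) (fun s hs => (S.energy_nonneg _).trans (hpotential hs))
    (fun s _ => S.mass_nonneg _)
    (fun s _ => add_nonneg (zero_le_one.trans (S.one_le_G Ψ s)) (S.G1_nonneg Ψ s))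
    (fun s hs => (S.potential_inequality hΨ hp hs).trans
      (add_le_add_left (hpotential hs) _)) (fun s hs => ?_) (hΨ.cont_G.add hΨ.cont_G1)
    (continuousOn_const.mul hΨ.cont_G))
  have henergy := S.energy_inequality hΨ hp hs hcP (hPS s hs)
  have hpotential_le := S.integral_potential_le (measurable_gradient _) (hp.energy s hs)
  have hdamping : 0 ≤ dampingConst (expo α) cP * mass U φ ((p - Ψ) s) ^ ((2 - expo α) / 2) :=
    mul_nonneg (dampingConst_pos _ hcP).le (S.mass_rpow_nonneg _ _)
  linarith

lemma energy_le_of_windowBound {b t : ℝ} (ht : 1 < t) (hb : WindowBound U φ α a p Ψ b t) :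
    energy U α a (gradient (p t)) ≤ (10 + 8 * forcingConst (expo α) cP) * b := by
  have hle : t - 1 ≤ t := (sub_one_lt t).le
  have hG := intervalIntegrable_sub_one hΨ.cont_G ht
  have hG1 := intervalIntegrable_sub_one hΨ.cont_G1 ht
  have henergy := S.energy_le hcP hΨ hp hPS ht
  rw [intervalIntegral.integral_add (hG.add hG1) ((hG.const_mul _).const_mul 8),
    intervalIntegral.integral_add hG hG1, intervalIntegral.integral_const_mul,
    intervalIntegral.integral_const_mul] at henergy
  have hintG : ∫ s in (t - 1)..t, G U φ α a Ψ s ≤ b := by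
    simpa only [intervalIntegral.integral_const, sub_sub_cancel, one_smul] using
      intervalIntegral.integral_mono_on hle hG intervalIntegrable_const hb.G_le
  have hforcing := mul_le_mul_of_nonneg_left hintG (forcingConst_nonneg (expo α) hcP)
  linarith [hb.mass_le (t - 1) ⟨le_rfl, hle⟩, hb.integral_G1_le]

end OneSolution

variable {cP : ℝ} (hcP : 0 < cP) {p₁ p₂ Ψ₁ Ψ₂ : ℝ → E n → ℝ}
  (hΨ₁ : IsBoundaryData U φ α a Ψ₁) (hΨ₂ : IsBoundaryData U φ α a Ψ₂)
  (hp₁ : IsSolution U φ α a p₁ Ψ₁) (hp₂ : IsSolution U φ α a p₂ Ψ₂)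
  (hPS₁ : ∀ t > 0, PoincareSobolev U φ α a cP (p₁ t - Ψ₁ t))
  (hPS₂ : ∀ t > 0, PoincareSobolev U φ α a cP (p₂ t - Ψ₂ t))
  (hPS : ∀ t > 0, PoincareSobolev U φ α a cP (pressureGap p₁ p₂ Ψ₁ Ψ₂ t))
include hcP hΨ₁ hΨ₂ hp₁ hp₂ hPS₁ hPS₂ hPS

lemma difference_inequality_of_windowBound {b t : ℝ} (ht : 1 < t)
    (hb₁ : WindowBound U φ α a p₁ Ψ₁ b t) (hb₂ : WindowBound U φ α a p₂ Ψ₂ b t) :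
    2 * ∫ x in U, φ x * (pressureGap p₁ p₂ Ψ₁ Ψ₂ t x * dt (pressureGap p₁ p₂ Ψ₁ Ψ₂) t x) ≤
      -((1 - expo α) / cP ^ 2 * (energyConst (expo α) cP * b) ^ (-(expo α / (2 - expo α))) *
          mass U φ (pressureGap p₁ p₂ Ψ₁ Ψ₂ t))
        + 4 * ((energyConst (expo α) cP * b) ^ (1 / 2 : ℝ) * D U φ a (Ψ₁ - Ψ₂) t) := by
  have ht0 : 0 < t := one_pos.trans ht
  have ht_mem : t ∈ Icc (t - 1) t := ⟨(sub_one_lt t).le, le_rfl⟩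
  have hG := hb₁.G_le t ht_mem
  have hb1 : 1 ≤ b := (S.one_le_G Ψ₁ t).trans hG
  have hforcing : 0 ≤ forcingConst (expo α) cP * b :=
    mul_nonneg (forcingConst_nonneg (expo α) hcP) (zero_le_one.trans hb1)
  have hΛ : energyConst (expo α) cP * b = 24 * b + 16 * (forcingConst (expo α) cP * b) := by
    unfold energyConst
    ring
  refine S.difference_inequality hΨ₁ hΨ₂ hp₁ hp₂ ht0 hcP
    (one_le_mul_of_one_le_of_one_le (one_le_energyConst _ hcP) hb1) (hPS t ht0) ?_ ?_
  · have hE₁ := S.energy_le_of_windowBound hcP hΨ₁ hp₁ hPS₁ ht hb₁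
    have hE₂ := S.energy_le_of_windowBound hcP hΨ₂ hp₂ hPS₂ ht hb₂
    have hlast := S.integral_coeff_last_add_sobolevEnergy_le_G Ψ₁ t
    have hsobolev := S.sobolevEnergy_nonneg (gradient (Ψ₁ t))
    linarith
  · have hmass : mass U φ (pressureGap p₁ p₂ Ψ₁ Ψ₂ t) ≤
        2 * (mass U φ ((p₁ - Ψ₁) t) + mass U φ ((p₂ - Ψ₂) t)) :=
      S.mass_sub_le ((hp₁.regular.timeRegular.sub hΨ₁.regular.timeRegular).continuousOn ht0)
        ((hp₂.regular.timeRegular.sub hΨ₂.regular.timeRegular).continuousOn ht0)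
    linarith [hb₁.mass_le t ht_mem, hb₂.mass_le t ht_mem]

lemma limsupInf_wnorm_pressureGap_le {C₀ : ℝ} (hC₀ : 0 < C₀) {V : ℝ → ℝ}
    (hV : ContinuousOn V (Ioi 1)) (hV1 : ∀ t ≥ 1, 1 ≤ V t)
    (hb₁ : ∀ᶠ t in atTop, WindowBound U φ α a p₁ Ψ₁ (C₀ * V t) t)
    (hb₂ : ∀ᶠ t in atTop, WindowBound U φ α a p₂ Ψ₂ (C₀ * V t) t)
    (hdiv : DivergentIntegral α V) :
    limsupInf (fun t => wnorm U φ 2 (pressureGap p₁ p₂ Ψ₁ Ψ₂ t) ^ 2) ≤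
      ENNReal.ofReal (limitConst (expo α) cP C₀) *
        limsupInf (fun t => V t ^ kappa α * D U φ a (Ψ₁ - Ψ₂) t) := by
  obtain ⟨ha0, ha1⟩ := S.expo_mem
  have hE : 0 < energyConst (expo α) cP * C₀ :=
    mul_pos (one_pos.trans_le (one_le_energyConst _ hcP)) hC₀
  have hdamping : 0 < (1 - expo α) / cP ^ 2 *
      (energyConst (expo α) cP * C₀) ^ (-(expo α / (2 - expo α))) :=
    mul_pos (div_pos (by linarith) (by positivity)) (Real.rpow_pos_of_pos hE _)
  simp only [S.wnorm_two_sq]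
  refine limsupInf_le_of_differential_inequality (σ := expo α / (2 - expo α)) hdamping
    (by positivity : 0 < 4 * (energyConst (expo α) cP * C₀) ^ (1 / 2 : ℝ))
    (div_nonneg ha0.le (by linarith)) (fun t ht => S.hasDerivAt_mass
      ((hp₁.regular.timeRegular.sub hΨ₁.regular.timeRegular).sub
        (hp₂.regular.timeRegular.sub hΨ₂.regular.timeRegular)) ht) hV hV1 hdiv ?_
  filter_upwards [hb₁, hb₂, eventually_gt_atTop 1] with t hb₁t hb₂t ht
  have hVt : 0 ≤ V t := zero_le_one.trans (hV1 t ht.le)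
  have hdifference := S.difference_inequality_of_windowBound hcP hΨ₁ hΨ₂ hp₁ hp₂ hPS₁ hPS₂ hPS ht
    hb₁t hb₂t
  rw [← mul_assoc (energyConst _ _), Real.mul_rpow hE.le hVt, Real.mul_rpow hE.le hVt]
    at hdifference
  linarith

end Setting

lemma continuousOn_integral_sub_one {f : ℝ → ℝ} (hf : ContinuousOn f (Ioi 0)) :
    ContinuousOn (fun t => ∫ τ in (t - 1)..t, f τ) (Ioi 1) := by
  have hInt {s t : ℝ} (hs : 0 < s) (ht : 0 < t) : IntervalIntegrable f volume s t :=
    (hf.mono fun τ hτ => (lt_min hs ht).trans_le hτ.1).intervalIntegrable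
  have hprimitive : ContinuousOn (fun t => ∫ τ in (1 : ℝ)..t, f τ) (Ioi 0) := fun t ht =>
    (intervalIntegral.integral_hasDerivAt_right (hInt one_pos ht)
      (hf.stronglyMeasurableAtFilter isOpen_Ioi t ht)
      (hf.continuousAt (Ioi_mem_nhds ht))).continuousAt.continuousWithinAt
  have hshift : ContinuousOn (fun t => ∫ τ in (1 : ℝ)..(t - 1), f τ) (Ioi 1) :=
    hprimitive.comp (f := fun t => t - 1) (by fun_prop) fun t ht => mem_Ioi.2 (sub_pos.2 ht)
  refine ((hprimitive.mono (Ioi_subset_Ioi zero_le_one)).sub hshift).congr fun t ht => ?_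
  exact (intervalIntegral.integral_interval_sub_left (hInt one_pos (one_pos.trans ht))
    (hInt one_pos (sub_pos.2 ht))).symm

section Window

variable {n N : ℕ} {U : Set (E n)} {φ : E n → ℝ} {α : Fin (N + 1) → ℝ}
  {a : Fin (N + 1) → E n → ℝ} {Ψ₁ Ψ₂ : ℝ → E n → ℝ}

lemma window_comm (t : ℝ) : window U φ a Ψ₁ Ψ₂ t = window U φ a Ψ₂ Ψ₁ t := by
  simp only [window, add_comm]

variable (hΨ₁ : IsBoundaryData U φ α a Ψ₁) (hΨ₂ : IsBoundaryData U φ α a Ψ₂)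
include hΨ₁ hΨ₂

lemma continuousOn_window_integrand :
    ContinuousOn (fun τ => (G1 U a Ψ₁ τ + G1 U a Ψ₂ τ) + (G2 U φ Ψ₁ τ + G2 U φ Ψ₂ τ)) (Ioi 0) :=
  (hΨ₁.cont_G1.add hΨ₂.cont_G1).add (hΨ₁.cont_G2.add hΨ₂.cont_G2)

lemma continuousOn_window : ContinuousOn (window U φ a Ψ₁ Ψ₂) (Ioi 1) :=
  continuousOn_integral_sub_one (continuousOn_window_integrand hΨ₁ hΨ₂)

end Window

namespace Setting

variable {n N : ℕ} {U : Set (E n)} {φ : E n → ℝ} {α : Fin (N + 1) → ℝ}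
  {a : Fin (N + 1) → E n → ℝ} (S : Setting U φ α a) {Ψ₁ Ψ₂ : ℝ → E n → ℝ}
include S

lemma window_nonneg (t : ℝ) : 0 ≤ window U φ a Ψ₁ Ψ₂ t :=
  intervalIntegral.integral_nonneg (by linarith) fun τ _ => add_nonneg
    (add_nonneg (S.G1_nonneg Ψ₁ τ) (S.G1_nonneg Ψ₂ τ))
    (add_nonneg (S.G2_nonneg Ψ₁ τ) (S.G2_nonneg Ψ₂ τ))

lemma integral_G1_le_window (hΨ₁ : IsBoundaryData U φ α a Ψ₁) (hΨ₂ : IsBoundaryData U φ α a Ψ₂)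
    {t : ℝ} (ht : 1 < t) : ∫ τ in (t - 1)..t, G1 U a Ψ₁ τ ≤ window U φ a Ψ₁ Ψ₂ t :=
  intervalIntegral.integral_mono_on (sub_one_lt t).le (intervalIntegrable_sub_one hΨ₁.cont_G1 ht)
    (intervalIntegrable_sub_one (continuousOn_window_integrand hΨ₁ hΨ₂) ht) fun τ _ => by
      linarith [S.G1_nonneg Ψ₂ τ, S.G2_nonneg Ψ₁ τ, S.G2_nonneg Ψ₂ τ]

end Setting

/-! ### Growth functions -/

lemma eventually_forall_Icc_sub_one {P : ℝ → Prop} (hP : ∀ᶠ t in atTop, P t) :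
    ∀ᶠ t in atTop, ∀ τ ∈ Icc (t - 1) t, P τ := by
  obtain ⟨T, hT⟩ := eventually_atTop.1 hP
  filter_upwards [eventually_ge_atTop (T + 1)] with t ht τ hτ
  exact hT τ (by linarith [hτ.1])

lemma one_le_two_div_two_sub {A : ℝ} (hA0 : 0 ≤ A) (hA1 : A < 1) : 1 ≤ 2 / (2 - A) := by
  rw [one_le_div (by linarith)]
  linarith

lemma two_div_two_sub_lt_two {A : ℝ} (hA1 : A < 1) : 2 / (2 - A) < 2 := by
  rw [div_lt_iff₀ (by linarith)]
  linarith

lemma two_div_two_sub_div_two_sub {A : ℝ} (hA1 : A < 1) :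
    2 / (2 - A) / (2 - 2 / (2 - A)) = 1 / (1 - A) := by
  have hone_sub : 1 - A ≠ 0 := (sub_pos.2 hA1).ne'
  have htwo_sub : 2 - A ≠ 0 := by linarith
  rw [show 2 - 2 / (2 - A) = 2 * (1 - A) / (2 - A) by field_simp; ring]
  field_simp

lemma add_one_rpow_le {b s v : ℝ} (hb : 0 ≤ b) (hs : 0 ≤ s) (hv : 1 ≤ v) (hbv : b ^ s ≤ v) :
    (b + 1) ^ s ≤ 2 ^ s * v := by
  have hmax : max b 1 ^ s ≤ v := by
    rcases max_choice b 1 with h | h <;> rw [h]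
    · exact hbv
    · rwa [Real.one_rpow]
  calc (b + 1) ^ s ≤ (2 * max b 1) ^ s :=
        Real.rpow_le_rpow (by linarith) (by linarith [le_max_left b 1, le_max_right b 1]) hs
    _ = 2 ^ s * max b 1 ^ s := Real.mul_rpow zero_le_two (le_max_of_le_left hb)
    _ ≤ 2 ^ s * v := by gcongr

lemma add_add_rpow_le {g β q r k v : ℝ} (hg : 0 ≤ g) (hβ : 1 ≤ β) (hq : 0 ≤ q) (hr1 : 1 ≤ r)
    (hr2 : r < 2) (hv : 0 ≤ v) (hgv : g ^ r ≤ v) (hβv : β ^ (r / (2 - r)) ≤ k * v) :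
    (g + (β + (q * β) ^ (1 / (2 - r)))) ^ r ≤ 16 * (1 + k * (1 + q ^ (r / (2 - r)))) * v := by
  have hr0 : 0 ≤ r := by linarith
  have hr2' : 0 < 2 - r := sub_pos.2 hr2
  have hβ0 : 0 ≤ β := by linarith
  set L := (q * β) ^ (1 / (2 - r))
  have hL0 : 0 ≤ L := by positivity
  have hLr : L ^ r = q ^ (r / (2 - r)) * β ^ (r / (2 - r)) := by
    rw [← Real.rpow_mul (by positivity), one_div_mul_eq_div, Real.mul_rpow hq hβ0]
  have hβr : β ^ r ≤ k * v :=
    (Real.rpow_le_rpow_of_exponent_le hβ (le_div_self hr0 hr2' (by linarith))).trans hβv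
  calc (g + (β + L)) ^ r ≤ 4 * (g ^ r + (β + L) ^ r) :=
        add_rpow_le_four_mul hg (by positivity) hr0 hr2.le
    _ ≤ 4 * (g ^ r + 4 * (β ^ r + L ^ r)) := by
        gcongr
        exact add_rpow_le_four_mul hβ0 hL0 hr0 hr2.le
    _ ≤ 4 * (v + 4 * (k * v + q ^ (r / (2 - r)) * (k * v))) := by
        rw [hLr]
        gcongr
    _ ≤ 16 * (1 + k * (1 + q ^ (r / (2 - r)))) * v := by linarith

lemma le_add_of_neg_le_deriv {f : ℝ → ℝ} {τ t β : ℝ} (hτt : τ ≤ t) (htτ : t - 1 ≤ τ) (hβ : 0 ≤ β)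
    (hf : ∀ s ∈ Icc τ t, DifferentiableAt ℝ f s) (hf' : ∀ s ∈ Icc τ t, -β ≤ deriv f s) :
    f τ ≤ f t + β := by
  have hinc := sub_le_of_hasDerivAt_le hτt (fun s hs => (hf s hs).hasDerivAt.neg)
    fun s hs => neg_le.2 (hf' s hs)
  rw [Pi.neg_apply, Pi.neg_apply] at hinc
  linarith [mul_le_of_le_one_right hβ (by linarith : t - τ ≤ 1)]

lemma eventually_neg_le_deriv_of_limsupInf_lt {f : ℝ → ℝ} {β : ℝ}
    (hf : limsupInf (fun t => max (-deriv f t) 0) < ENNReal.ofReal β) :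
    ∀ᶠ t in atTop, -β ≤ deriv f t := by
  filter_upwards [eventually_lt_of_limsup_lt hf] with t ht
  have hlt := (ENNReal.ofReal_lt_ofReal_iff'.1 ht).1
  linarith [le_max_left (-deriv f t) 0]

/-- The ratio between the bound for the mass of `p - Ψ` and the power `2 / (2 - a)` of the function
that dominates `G[Ψ]`. -/
def barrierConst (A cP : ℝ) : ℝ :=
  ((forcingConst A cP + 1) / dampingConst A cP) ^ (2 / (2 - A))

/-- The ratio between the window bounds and the growth function `Vfin`. -/
def finConst (A cP : ℝ) : ℝ :=
  1 + 2 ^ (1 / (1 - A)) + barrierConst A cP * (16 * (1 + 2 ^ (1 / (1 - A)) *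
    (1 + (2 * (2 / (2 - A) * barrierConst A cP)) ^ (1 / (1 - A)))))

lemma div_barrier_nonneg (A : ℝ) {cP : ℝ} (hcP : 0 < cP) :
    0 ≤ (forcingConst A cP + 1) / dampingConst A cP :=
  div_nonneg (by linarith [forcingConst_nonneg A hcP]) (dampingConst_pos A hcP).le

lemma barrierConst_nonneg (A : ℝ) {cP : ℝ} (hcP : 0 < cP) : 0 ≤ barrierConst A cP :=
  Real.rpow_nonneg (div_barrier_nonneg A hcP) _

lemma one_le_finConst {A cP : ℝ} (hA1 : A < 1) (hcP : 0 < cP) : 1 ≤ finConst A cP := by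
  have hB := barrierConst_nonneg A hcP
  have hratio : 0 ≤ 2 / (2 - A) := div_nonneg zero_le_two (by linarith)
  unfold finConst
  rw [add_assoc]
  exact le_add_of_nonneg_right (by positivity)

section FinConst

variable {A cP b g v : ℝ} (hA0 : 0 ≤ A) (hA1 : A < 1) (hcP : 0 < cP) (hb : 0 ≤ b) (hg : 1 ≤ g)
  (hgv : g ^ (2 / (2 - A)) ≤ v) (hbv : b ^ (1 / (1 - A)) ≤ v)
include hA0 hA1 hcP hb hg hgv hbv

lemma add_add_one_le_finConst_mul : g + (b + 1) ≤ finConst A cP * v := by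
  have hB := barrierConst_nonneg A hcP
  have hr1 := one_le_two_div_two_sub hA0 hA1
  have hs1 : 1 ≤ 1 / (1 - A) := by rw [one_le_div (by linarith)]; linarith
  have hgv' : g ≤ v := (Real.self_le_rpow_of_one_le hg hr1).trans hgv
  have hb1 : b + 1 ≤ 2 ^ (1 / (1 - A)) * v :=
    (Real.self_le_rpow_of_one_le (by linarith) hs1).trans
      (add_one_rpow_le hb (by linarith) (by linarith) hbv)
  have hv : 0 ≤ v := by linarith
  calc g + (b + 1) ≤ (1 + 2 ^ (1 / (1 - A))) * v := by linarith
    _ ≤ finConst A cP * v := by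
      refine mul_le_mul_of_nonneg_right ?_ hv
      exact le_add_of_nonneg_right (by positivity)

lemma barrierConst_mul_rpow_le_finConst_mul :
    barrierConst A cP * (g + (b + 1 + (2 * (2 / (2 - A) * barrierConst A cP) * (b + 1)) ^
      (1 / (2 - 2 / (2 - A))))) ^ (2 / (2 - A)) ≤ finConst A cP * v := by
  have hB := barrierConst_nonneg A hcP
  have hr1 := one_le_two_div_two_sub hA0 hA1
  have hs : 0 ≤ 1 / (1 - A) := one_div_nonneg.2 (by linarith)
  have hv : 1 ≤ v := (Real.one_le_rpow hg (by linarith)).trans hgv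
  have hbarrier := add_add_rpow_le (zero_le_one.trans hg) (by linarith : 1 ≤ b + 1)
    (by positivity : 0 ≤ 2 * (2 / (2 - A) * barrierConst A cP)) hr1 (two_div_two_sub_lt_two hA1)
    (zero_le_one.trans hv) hgv (k := 2 ^ (1 / (1 - A)))
    (by rw [two_div_two_sub_div_two_sub hA1]; exact add_one_rpow_le hb hs hv hbv)
  rw [two_div_two_sub_div_two_sub hA1] at hbarrier
  refine (mul_le_mul_of_nonneg_left hbarrier hB).trans ?_
  rw [← mul_assoc]
  unfold finConst
  gcongr
  exact le_add_of_nonneg_left (by positivity)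

end FinConst

namespace Setting

variable {n N : ℕ} {U : Set (E n)} {φ : E n → ℝ} {α : Fin (N + 1) → ℝ}
  {a : Fin (N + 1) → E n → ℝ} (S : Setting U φ α a)

section OneSolution

variable {cP : ℝ} (hcP : 0 < cP) {p Ψ : ℝ → E n → ℝ} (hΨ : IsBoundaryData U φ α a Ψ)
  (hp : IsSolution U φ α a p Ψ) (hPS : ∀ t > 0, PoincareSobolev U φ α a cP (p t - Ψ t))
include S hcP hΨ hp hPS

lemma mass_deriv_le {t : ℝ} (ht : 0 < t) :
    2 * ∫ x in U, φ x * ((p - Ψ) t x * dt (p - Ψ) t x) ≤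
      -(dampingConst (expo α) cP * mass U φ ((p - Ψ) t) ^ ((2 - expo α) / 2))
        + forcingConst (expo α) cP * G U φ α a Ψ t := by
  linarith [S.energy_inequality hΨ hp ht hcP (hPS t ht), S.energy_nonneg (gradient (p t))]

lemma eventually_mass_le_of_isMajorant {M : ℝ → ℝ} (hM : IsMajorant M (G U φ α a Ψ)) :
    ∀ᶠ t in atTop, mass U φ ((p - Ψ) t) ≤
      barrierConst (expo α) cP * M t ^ (2 / (2 - expo α)) := by
  have hbarrier := eventually_le_of_majorant (y := fun t => mass U φ ((p - Ψ) t))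
    (θ := (2 - expo α) / 2) (by linarith [S.expo_mem.2]) (dampingConst_pos (expo α) hcP)
    (forcingConst_nonneg (expo α) hcP)
    (fun t ht => S.hasDerivAt_mass (hp.regular.timeRegular.sub hΨ.regular.timeRegular) ht)
    (fun t _ => S.one_le_G Ψ t) hM fun t ht => S.mass_deriv_le hcP hΨ hp hPS ht
  filter_upwards [hbarrier, eventually_gt_atTop 0] with t hle ht
  have hMt : 0 ≤ M t := zero_le_one.trans ((S.one_le_G Ψ t).trans (hM.le t ht))
  rwa [one_div_div, Real.mul_rpow (div_barrier_nonneg _ hcP) hMt] at hle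

lemma eventually_windowBound_of_isMajorant {M V : ℝ → ℝ} (hM : IsMajorant M (G U φ α a Ψ))
    (hMV : ∀ t > 0, M t ^ (2 / (2 - expo α)) ≤ V t)
    (hG1V : ∀ t > 1, ∫ τ in (t - 1)..t, G1 U a Ψ τ ≤ V t) :
    ∀ᶠ t in atTop, WindowBound U φ α a p Ψ ((1 + barrierConst (expo α) cP) * V t) t := by
  obtain ⟨ha0, ha1⟩ := S.expo_mem
  have hr1 := one_le_two_div_two_sub ha0.le ha1
  have hB := barrierConst_nonneg (expo α) hcP
  filter_upwards [eventually_forall_Icc_sub_one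
    (S.eventually_mass_le_of_isMajorant hcP hΨ hp hPS hM), eventually_gt_atTop 1] with t hmass ht
  have ht0 : 0 < t := one_pos.trans ht
  have hpos : ∀ τ ∈ Icc (t - 1) t, 0 < τ := fun τ hτ => Icc_sub_one_subset_Ioi_zero ht hτ
  have hM1 : ∀ τ ∈ Icc (t - 1) t, 1 ≤ M τ := fun τ hτ =>
    (S.one_le_G Ψ τ).trans (hM.le τ (hpos τ hτ))
  have hMle : ∀ τ ∈ Icc (t - 1) t, M τ ≤ M t := fun τ hτ =>
    hM.mono (hpos τ hτ).le ht0.le hτ.2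
  have hMt : 1 ≤ M t := hM1 t ⟨(sub_one_lt t).le, le_rfl⟩
  have hMtV : M t ≤ V t := (Real.self_le_rpow_of_one_le hMt hr1).trans (hMV t ht0)
  have hV : 0 ≤ V t := by linarith
  have hBV : 0 ≤ barrierConst (expo α) cP * V t := mul_nonneg hB hV
  refine ⟨fun τ hτ => ?_, fun τ hτ => ?_, ?_⟩
  · have hpow : M τ ^ (2 / (2 - expo α)) ≤ V t :=
      (Real.rpow_le_rpow (zero_le_one.trans (hM1 τ hτ)) (hMle τ hτ) (by linarith)).trans (hMV t ht0)
    linarith [hmass τ hτ, mul_le_mul_of_nonneg_left hpow hB]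
  · linarith [hM.le τ (hpos τ hτ), hMle τ hτ]
  · linarith [hG1V t ht]

lemma eventually_mass_le_of_neg_le_deriv {β : ℝ} (hβ : 0 ≤ β)
    (hGd : ∀ t > 0, DifferentiableAt ℝ (G U φ α a Ψ) t)
    (hG' : ∀ᶠ t in atTop, -β ≤ deriv (G U φ α a Ψ) t) :
    ∀ᶠ t in atTop, mass U φ ((p - Ψ) t) ≤ barrierConst (expo α) cP * (G U φ α a Ψ t +
      (2 * (2 / (2 - expo α) * barrierConst (expo α) cP) * β) ^ (1 / (2 - 2 / (2 - expo α)))) ^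
        (2 / (2 - expo α)) := by
  obtain ⟨ha0, ha1⟩ := S.expo_mem
  have hbarrier := eventually_le_of_neg_le_deriv (y := fun t => mass U φ ((p - Ψ) t))
    (θ := (2 - expo α) / 2) (by linarith) (by linarith) (dampingConst_pos (expo α) hcP)
    (forcingConst_nonneg (expo α) hcP) hβ
    (fun t ht => S.hasDerivAt_mass (hp.regular.timeRegular.sub hΨ.regular.timeRegular) ht)
    (fun t _ => S.one_le_G Ψ t) (fun t ht => (hGd t ht).hasDerivAt) hG'
    fun t ht => S.mass_deriv_le hcP hΨ hp hPS ht
  refine hbarrier.mono fun t hle => ?_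
  have hslope : 0 ≤ 2 * (2 / (2 - expo α) * barrierConst (expo α) cP) * β :=
    mul_nonneg (mul_nonneg zero_le_two (mul_nonneg (div_nonneg zero_le_two (by linarith))
      (barrierConst_nonneg _ hcP))) hβ
  rw [one_div_div] at hle
  change _ ≤ (_ * (_ + (2 * (2 / (2 - expo α) * barrierConst (expo α) cP * β)) ^ _)) ^ _ at hle
  rwa [← mul_assoc 2, Real.mul_rpow (div_barrier_nonneg _ hcP)
    (add_nonneg (zero_le_one.trans (S.one_le_G Ψ t)) (Real.rpow_nonneg hslope _))] at hle

lemma eventually_windowBound_of_limsupInf_lt {b : ℝ} (hb : 0 ≤ b) {V : ℝ → ℝ}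
    (hGd : ∀ t > 0, DifferentiableAt ℝ (G U φ α a Ψ) t)
    (hG' : limsupInf (fun t => max (-deriv (G U φ α a Ψ) t) 0) < ENNReal.ofReal (b + 1))
    (hbV : ∀ t > 0, b ^ (1 / (1 - expo α)) ≤ V t)
    (hGV : ∀ t > 0, G U φ α a Ψ t ^ (2 / (2 - expo α)) ≤ V t)
    (hG1V : ∀ t > 1, ∫ τ in (t - 1)..t, G1 U a Ψ τ ≤ V t) :
    ∀ᶠ t in atTop, WindowBound U φ α a p Ψ (finConst (expo α) cP * V t) t := by
  have hb1 : 0 ≤ b + 1 := by linarith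
  have hr : 0 ≤ 2 / (2 - expo α) := div_nonneg zero_le_two (by linarith [S.expo_mem.2])
  have hderiv := eventually_neg_le_deriv_of_limsupInf_lt hG'
  filter_upwards [eventually_forall_Icc_sub_one
      (S.eventually_mass_le_of_neg_le_deriv hcP hΨ hp hPS hb1 hGd hderiv),
    eventually_forall_Icc_sub_one hderiv, eventually_gt_atTop 1] with t hmass_t hderiv_t ht
  have ht0 : 0 < t := one_pos.trans ht
  have hGt := S.one_le_G Ψ t
  have hGτ : ∀ τ ∈ Icc (t - 1) t, G U φ α a Ψ τ ≤ G U φ α a Ψ t + (b + 1) := fun τ hτ =>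
    le_add_of_neg_le_deriv hτ.2 hτ.1 hb1
      (fun σ hσ => hGd σ (Icc_sub_one_subset_Ioi_zero ht (Icc_subset_Icc_left hτ.1 hσ)))
      fun σ hσ => hderiv_t σ (Icc_subset_Icc_left hτ.1 hσ)
  have hbase : 0 ≤ 2 * (2 / (2 - expo α) * barrierConst (expo α) cP) * (b + 1) :=
    mul_nonneg (mul_nonneg zero_le_two (mul_nonneg hr (barrierConst_nonneg _ hcP))) hb1
  refine ⟨fun τ hτ => ?_, fun τ hτ => ?_, ?_⟩
  · refine (hmass_t τ hτ).trans (le_trans (mul_le_mul_of_nonneg_left ?_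
      (barrierConst_nonneg _ hcP)) (barrierConst_mul_rpow_le_finConst_mul S.expo_mem.1.le
        S.expo_mem.2 hcP hb hGt (hGV t ht0) (hbV t ht0)))
    refine Real.rpow_le_rpow (add_nonneg (zero_le_one.trans (S.one_le_G Ψ τ))
      (Real.rpow_nonneg hbase _)) ?_ hr
    linarith [hGτ τ hτ]
  · exact (hGτ τ hτ).trans (add_add_one_le_finConst_mul S.expo_mem.1.le S.expo_mem.2 hcP hb hGt
      (hGV t ht0) (hbV t ht0))
  · have hV : 0 ≤ V t := (Real.rpow_nonneg hb _).trans (hbV t ht0)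
    exact (hG1V t ht).trans
      (le_mul_of_one_le_left hV (one_le_finConst S.expo_mem.2 hcP))

end OneSolution

variable {cP : ℝ} (hcP : 0 < cP) {p₁ p₂ Ψ₁ Ψ₂ : ℝ → E n → ℝ}
  (hΨ₁ : IsBoundaryData U φ α a Ψ₁) (hΨ₂ : IsBoundaryData U φ α a Ψ₂)
  (hp₁ : IsSolution U φ α a p₁ Ψ₁) (hp₂ : IsSolution U φ α a p₂ Ψ₂)
  (hPS₁ : ∀ t > 0, PoincareSobolev U φ α a cP (p₁ t - Ψ₁ t))
  (hPS₂ : ∀ t > 0, PoincareSobolev U φ α a cP (p₂ t - Ψ₂ t))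
  (hPS : ∀ t > 0, PoincareSobolev U φ α a cP (pressureGap p₁ p₂ Ψ₁ Ψ₂ t))
include S

lemma rpow_le_Vgen {M₁ M₂ : ℝ → ℝ} {t u : ℝ} (hu : 0 ≤ u) (hle : u ≤ M₁ t + M₂ t) :
    u ^ (2 / (2 - expo α)) ≤ Vgen U φ α a Ψ₁ Ψ₂ M₁ M₂ t :=
  (Real.rpow_le_rpow hu hle (div_nonneg zero_le_two (by linarith [S.expo_mem.2]))).trans
    (le_add_of_nonneg_right (S.window_nonneg t))

lemma rpow_le_Vfin {t u : ℝ} (hu : 0 ≤ u) (hle : u ≤ G U φ α a Ψ₁ t + G U φ α a Ψ₂ t) :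
    u ^ (2 / (2 - expo α)) ≤ Vfin U φ α a Ψ₁ Ψ₂ t :=
  (Real.rpow_le_rpow hu hle (div_nonneg zero_le_two (by linarith [S.expo_mem.2]))).trans
    ((le_add_of_nonneg_left (Real.rpow_nonneg ENNReal.toReal_nonneg _)).trans
      (le_add_of_nonneg_right (S.window_nonneg t)))

lemma G_add_G_rpow_nonneg (t : ℝ) :
    0 ≤ (G U φ α a Ψ₁ t + G U φ α a Ψ₂ t) ^ (2 / (2 - expo α)) :=
  Real.rpow_nonneg (by linarith [S.one_le_G Ψ₁ t, S.one_le_G Ψ₂ t]) _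

lemma Btilde_rpow_le_Vfin (t : ℝ) :
    (Btilde U φ α a Ψ₁ Ψ₂).toReal ^ (1 / (1 - expo α)) ≤ Vfin U φ α a Ψ₁ Ψ₂ t :=
  (le_add_of_nonneg_right (S.G_add_G_rpow_nonneg t)).trans
    (le_add_of_nonneg_right (S.window_nonneg t))

lemma window_le_Vfin (t : ℝ) : window U φ a Ψ₁ Ψ₂ t ≤ Vfin U φ α a Ψ₁ Ψ₂ t :=
  le_add_of_nonneg_left
    (add_nonneg (Real.rpow_nonneg ENNReal.toReal_nonneg _) (S.G_add_G_rpow_nonneg t))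

include hcP hΨ₁ hΨ₂ hp₁ hp₂ hPS₁ hPS₂ hPS

theorem limsupInf_wnorm_pressureGap_le_Vgen {M₁ M₂ : ℝ → ℝ}
    (hM₁ : IsMajorant M₁ (G U φ α a Ψ₁)) (hM₂ : IsMajorant M₂ (G U φ α a Ψ₂))
    (hdiv : DivergentIntegral α (Vgen U φ α a Ψ₁ Ψ₂ M₁ M₂)) :
    limsupInf (fun t => wnorm U φ 2 (pressureGap p₁ p₂ Ψ₁ Ψ₂ t) ^ 2) ≤
      ENNReal.ofReal (limitConst (expo α) cP (1 + barrierConst (expo α) cP)) *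
        limsupInf (fun t => Vgen U φ α a Ψ₁ Ψ₂ M₁ M₂ t ^ kappa α * D U φ a (Ψ₁ - Ψ₂) t) := by
  have hM₁1 : ∀ t > 0, 1 ≤ M₁ t := fun t ht => (S.one_le_G Ψ₁ t).trans (hM₁.le t ht)
  have hM₂1 : ∀ t > 0, 1 ≤ M₂ t := fun t ht => (S.one_le_G Ψ₂ t).trans (hM₂.le t ht)
  have hwindow : ∀ t > 1, window U φ a Ψ₁ Ψ₂ t ≤ Vgen U φ α a Ψ₁ Ψ₂ M₁ M₂ t := fun t ht => by
    have ht0 : 0 < t := one_pos.trans ht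
    exact le_add_of_nonneg_left (Real.rpow_nonneg (by linarith [hM₁1 t ht0, hM₂1 t ht0]) _)
  have hcont : ContinuousOn (Vgen U φ α a Ψ₁ Ψ₂ M₁ M₂) (Ioi 1) := by
    refine ContinuousOn.add (ContinuousOn.rpow_const ?_ fun _ _ => Or.inr ?_)
      (continuousOn_window hΨ₁ hΨ₂)
    · exact (hM₁.cont.add hM₂.cont).mono
        ((Ioi_subset_Ioi zero_le_one).trans Ioi_subset_Ici_self)
    · exact div_nonneg zero_le_two (by linarith [S.expo_mem.2])
  have hone : ∀ t ≥ 1, 1 ≤ Vgen U φ α a Ψ₁ Ψ₂ M₁ M₂ t := fun t ht => by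
    have ht0 : 0 < t := one_pos.trans_le ht
    simpa only [Real.one_rpow] using S.rpow_le_Vgen (Ψ₁ := Ψ₁) (Ψ₂ := Ψ₂) zero_le_one
      (by linarith [hM₁1 t ht0, hM₂1 t ht0])
  refine S.limsupInf_wnorm_pressureGap_le hcP hΨ₁ hΨ₂ hp₁ hp₂ hPS₁ hPS₂ hPS
    (by linarith [barrierConst_nonneg (expo α) hcP]) hcont hone ?_ ?_ hdiv
  · exact S.eventually_windowBound_of_isMajorant hcP hΨ₁ hp₁ hPS₁ hM₁
      (fun t ht => S.rpow_le_Vgen (by linarith [hM₁1 t ht]) (by linarith [hM₂1 t ht]))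
      fun t ht => (S.integral_G1_le_window hΨ₁ hΨ₂ ht).trans (hwindow t ht)
  · exact S.eventually_windowBound_of_isMajorant hcP hΨ₂ hp₂ hPS₂ hM₂
      (fun t ht => S.rpow_le_Vgen (by linarith [hM₂1 t ht]) (by linarith [hM₁1 t ht]))
      fun t ht => (S.integral_G1_le_window hΨ₂ hΨ₁ ht).trans
        ((window_comm t).trans_le (hwindow t ht))

theorem limsupInf_wnorm_pressureGap_le_Vfin (hG₁ : ∀ t > 0, DifferentiableAt ℝ (G U φ α a Ψ₁) t)
    (hG₂ : ∀ t > 0, DifferentiableAt ℝ (G U φ α a Ψ₂) t) (hB : Btilde U φ α a Ψ₁ Ψ₂ < ⊤)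
    (hdiv : DivergentIntegral α (Vfin U φ α a Ψ₁ Ψ₂)) :
    limsupInf (fun t => wnorm U φ 2 (pressureGap p₁ p₂ Ψ₁ Ψ₂ t) ^ 2) ≤
      ENNReal.ofReal (limitConst (expo α) cP (finConst (expo α) cP)) *
        limsupInf (fun t => Vfin U φ α a Ψ₁ Ψ₂ t ^ kappa α * D U φ a (Ψ₁ - Ψ₂) t) := by
  have hG₁1 := S.one_le_G Ψ₁
  have hG₂1 := S.one_le_G Ψ₂
  have hb : 0 ≤ (Btilde U φ α a Ψ₁ Ψ₂).toReal := ENNReal.toReal_nonneg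
  have hBlt : Btilde U φ α a Ψ₁ Ψ₂ < ENNReal.ofReal ((Btilde U φ α a Ψ₁ Ψ₂).toReal + 1) :=
    (ENNReal.lt_ofReal_iff_toReal_lt hB.ne).2 (lt_add_one _)
  have hcont : ContinuousOn (Vfin U φ α a Ψ₁ Ψ₂) (Ioi 1) := by
    refine (continuousOn_const.add (ContinuousOn.rpow_const ?_ fun _ _ => Or.inr ?_)).add
      (continuousOn_window hΨ₁ hΨ₂)
    · exact (hΨ₁.cont_G.add hΨ₂.cont_G).mono (Ioi_subset_Ioi zero_le_one)
    · exact div_nonneg zero_le_two (by linarith [S.expo_mem.2])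
  have hone : ∀ t ≥ 1, 1 ≤ Vfin U φ α a Ψ₁ Ψ₂ t := fun t _ => by
    simpa only [Real.one_rpow] using S.rpow_le_Vfin (Ψ₁ := Ψ₁) (Ψ₂ := Ψ₂) zero_le_one
      (by linarith [hG₁1 t, hG₂1 t])
  refine S.limsupInf_wnorm_pressureGap_le hcP hΨ₁ hΨ₂ hp₁ hp₂ hPS₁ hPS₂ hPS
    (by linarith [one_le_finConst S.expo_mem.2 hcP]) hcont hone ?_ ?_ hdiv
  · exact S.eventually_windowBound_of_limsupInf_lt hcP hΨ₁ hp₁ hPS₁ hb hG₁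
      (le_self_add.trans_lt hBlt) (fun t _ => S.Btilde_rpow_le_Vfin t)
      (fun t _ => S.rpow_le_Vfin (by linarith [hG₁1 t]) (by linarith [hG₂1 t]))
      fun t ht => (S.integral_G1_le_window hΨ₁ hΨ₂ ht).trans (S.window_le_Vfin t)
  · exact S.eventually_windowBound_of_limsupInf_lt hcP hΨ₂ hp₂ hPS₂ hb hG₂
      (le_add_self.trans_lt hBlt) (fun t _ => S.Btilde_rpow_le_Vfin t)
      (fun t _ => S.rpow_le_Vfin (by linarith [hG₂1 t]) (by linarith [hG₁1 t]))
      fun t ht => (S.integral_G1_le_window hΨ₂ hΨ₁ ht).trans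
        ((window_comm t).trans_le (S.window_le_Vfin t))

end Setting

end

end Forchheimer

open Forchheimer in
theorem mainTheorem8_general {N : ℕ} (hN : 1 ≤ N)
    (α : Fin (N + 1) → ℝ) (hα0 : α 0 = 0) (hα : StrictMono α) (cP : ℝ) (hcP : 0 < cP) :
    ∃ C : ℝ, 0 < C ∧
      ∀ (n : ℕ) (U : Set (E n)), IsOpen U → Bornology.IsBounded U →
        ∀ (φ : E n → ℝ) (a : Fin (N + 1) → E n → ℝ) (p₁ p₂ Ψ₁ Ψ₂ : ℝ → E n → ℝ),
        IsMedium U φ a →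
        IsBoundaryData U φ α a Ψ₁ →
        IsBoundaryData U φ α a Ψ₂ →
        IsSolution U φ α a p₁ Ψ₁ →
        IsSolution U φ α a p₂ Ψ₂ →
        (∀ t > 0, PoincareSobolev U φ α a cP (p₁ t - Ψ₁ t)) →
        (∀ t > 0, PoincareSobolev U φ α a cP (p₂ t - Ψ₂ t)) →
        (∀ t > 0, PoincareSobolev U φ α a cP
          ((p₁ t - Ψ₁ t) - (p₂ t - Ψ₂ t))) →
        (∀ M₁ M₂ : ℝ → ℝ,
          IsMajorant M₁ (G U φ α a Ψ₁) →
          IsMajorant M₂ (G U φ α a Ψ₂) →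
          DivergentIntegral α (Vgen U φ α a Ψ₁ Ψ₂ M₁ M₂) →
          limsupInf (fun t =>
              wnorm U φ 2 ((p₁ t - Ψ₁ t) - (p₂ t - Ψ₂ t)) ^ 2) ≤
            ENNReal.ofReal C * limsupInf (fun t =>
              Vgen U φ α a Ψ₁ Ψ₂ M₁ M₂ t ^ kappa α *
                D U φ a (Ψ₁ - Ψ₂) t)) ∧
        (ContDiffOn ℝ 1 (G U φ α a Ψ₁) (Ioi 0) →
          ContDiffOn ℝ 1 (G U φ α a Ψ₂) (Ioi 0) →
          Btilde U φ α a Ψ₁ Ψ₂ < ⊤ →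
          DivergentIntegral α (Vfin U φ α a Ψ₁ Ψ₂) →
          limsupInf (fun t =>
              wnorm U φ 2 ((p₁ t - Ψ₁ t) - (p₂ t - Ψ₂ t)) ^ 2) ≤
            ENNReal.ofReal C * limsupInf (fun t =>
              Vfin U φ α a Ψ₁ Ψ₂ t ^ kappa α *
                D U φ a (Ψ₁ - Ψ₂) t)) := by
  refine ⟨max 1 (max (limitConst (expo α) cP (1 + barrierConst (expo α) cP))
    (limitConst (expo α) cP (finConst (expo α) cP))), one_pos.trans_le (le_max_left _ _), ?_⟩
  intro n U hUo hUb φ a p₁ p₂ Ψ₁ Ψ₂ hmed hΨ₁ hΨ₂ hp₁ hp₂ hPS₁ hPS₂ hPS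
  have S : Setting U φ α a := ⟨hUo, hUb, hα0, hα, hN, hmed⟩
  refine ⟨fun M₁ M₂ hM₁ hM₂ hdiv => ?_, fun hG₁ hG₂ hB hdiv => ?_⟩
  · refine (S.limsupInf_wnorm_pressureGap_le_Vgen hcP hΨ₁ hΨ₂ hp₁ hp₂ hPS₁ hPS₂ hPS hM₁ hM₂
      hdiv).trans ?_
    gcongr
    exact (le_max_left _ _).trans (le_max_right _ _)
  · have hdiff {f : ℝ → ℝ} (hf : ContDiffOn ℝ 1 f (Ioi 0)) : ∀ t > 0, DifferentiableAt ℝ f t :=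
      fun t ht => (hf.differentiableOn one_ne_zero).differentiableAt (Ioi_mem_nhds ht)
    refine (S.limsupInf_wnorm_pressureGap_le_Vfin hcP hΨ₁ hΨ₂ hp₁ hp₂ hPS₁ hPS₂ hPS (hdiff hG₁)
      (hdiff hG₂) hB hdiv).trans ?_
    gcongr
    exact (le_max_right _ _).trans (le_max_right _ _)

theorem mainTheorem8 (n : ℕ) (hn : 2 ≤ n) (U : Set (Forchheimer.E n)) (hUo : IsOpen U)
    (hUc : IsConnected U) (hUb : Bornology.IsBounded U) (N : ℕ) (hN : 1 ≤ N)
    (α : Fin (N + 1) → ℝ) (hα0 : α 0 = 0) (hα : StrictMono α) (cP : ℝ) (hcP : 0 < cP) :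
    ∃ C : ℝ, 0 < C ∧
      ∀ (φ : Forchheimer.E n → ℝ) (a : Fin (N + 1) → Forchheimer.E n → ℝ)
        (p₁ p₂ Ψ₁ Ψ₂ : ℝ → Forchheimer.E n → ℝ),
        Forchheimer.IsMedium U φ a →
        Forchheimer.IsBoundaryData U φ α a Ψ₁ →
        Forchheimer.IsBoundaryData U φ α a Ψ₂ →
        Forchheimer.IsSolution U φ α a p₁ Ψ₁ →
        Forchheimer.IsSolution U φ α a p₂ Ψ₂ →
        (∀ t > 0, Forchheimer.PoincareSobolev U φ α a cP (p₁ t - Ψ₁ t)) →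
        (∀ t > 0, Forchheimer.PoincareSobolev U φ α a cP (p₂ t - Ψ₂ t)) →
        (∀ t > 0, Forchheimer.PoincareSobolev U φ α a cP
          ((p₁ t - Ψ₁ t) - (p₂ t - Ψ₂ t))) →
        Forchheimer.Atilde U φ α a Ψ₁ Ψ₂ = ⊤ →
        (∀ M₁ M₂ : ℝ → ℝ,
          Forchheimer.IsMajorant M₁ (Forchheimer.G U φ α a Ψ₁) →
          Forchheimer.IsMajorant M₂ (Forchheimer.G U φ α a Ψ₂) →
          Forchheimer.DivergentIntegral α (Forchheimer.Vgen U φ α a Ψ₁ Ψ₂ M₁ M₂) →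
          Forchheimer.limsupInf (fun t =>
              Forchheimer.wnorm U φ 2 ((p₁ t - Ψ₁ t) - (p₂ t - Ψ₂ t)) ^ 2) ≤
            ENNReal.ofReal C * Forchheimer.limsupInf (fun t =>
              Forchheimer.Vgen U φ α a Ψ₁ Ψ₂ M₁ M₂ t ^ Forchheimer.kappa α *
                Forchheimer.D U φ a (Ψ₁ - Ψ₂) t)) ∧
        (ContDiffOn ℝ 1 (Forchheimer.G U φ α a Ψ₁) (Ioi 0) →
          ContDiffOn ℝ 1 (Forchheimer.G U φ α a Ψ₂) (Ioi 0) →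
          Forchheimer.Btilde U φ α a Ψ₁ Ψ₂ < ⊤ →
          Forchheimer.DivergentIntegral α (Forchheimer.Vfin U φ α a Ψ₁ Ψ₂) →
          Forchheimer.limsupInf (fun t =>
              Forchheimer.wnorm U φ 2 ((p₁ t - Ψ₁ t) - (p₂ t - Ψ₂ t)) ^ 2) ≤
            ENNReal.ofReal C * Forchheimer.limsupInf (fun t =>
              Forchheimer.Vfin U φ α a Ψ₁ Ψ₂ t ^ Forchheimer.kappa α *
                Forchheimer.D U φ a (Ψ₁ - Ψ₂) t)) := by
  obtain ⟨C, hC, hbound⟩ := mainTheorem8_general hN α hα0 hα cP hcP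
  exact ⟨C, hC, fun φ a p₁ p₂ Ψ₁ Ψ₂ hmed hΨ₁ hΨ₂ hp₁ hp₂ hPS₁ hPS₂ hPS _ =>
    hbound n U hUo hUb φ a p₁ p₂ Ψ₁ Ψ₂ hmed hΨ₁ hΨ₂ hp₁ hp₂ hPS₁ hPS₂ hPS⟩
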